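/- Let $d\ge 3$, put $\delta=\lfloor d/2\rfloor$, and let $\Delta$ be a $(d-1)$-dimensional homology sphere (over an arbitrary nonzero commutative coefficient ring $R$, for instance $\mathbb Z$ or a field): a finite simplicial complex such that for every face $F$ of $\Delta$, the empty face included, the reduced simplicial homology $\tilde H_i(\mathrm{lk}_\Delta F;R)$ is isomorphic to $R$ for $i=d-1-|F|$ and is zero for all other $i$. Let $f_i(\Delta)$ be the number of $i$-dimensional faces of $\Delta$, with $f_{-1}(\Delta)=1$, define $h_0,\dots,h_d$ by $$\sum_{i=0}^{d} f_{i-1}(\Delta)\,x^{d-i}=\sum_{i=0}^{d}h_i\,(x+1)^{d-i},$$ and define the $g$-vector $(g_0,\dots,g_\delta)$ of $\Delta$ by $g_0=1$ and $g_i=h_i-h_{i-1}$ for $1\le i\le\delta$. Assume that the $g$-vector is an $m$-sequence, that is, $g_0=1$ and, for all integers $m\ge j>1$ with $j\le\delta$, $g_j\ge\binom{m}{j}$ implies $g_{j-1}\ge\binom{m-1}{j-1}$. For $n>d$ let $C(n,d)\subset\mathbb R^d$ be the cyclic polytope, the convex hull of $n$ points $(t_k,t_k^2,\dots,t_k^d)$,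 $t_1<\dots<t_n$, on the moment curve, and let $f_i(C(n,d))$ be the number of its $i$-dimensional faces. If $$f_r(\Delta)\le f_r(C(n,d))$$ for some integers $n>d$ and $0\le r\le d-2$, then $$f_s(\Delta)\le f_s(C(n,d))$$ for all integers $s$ with $r<s<d$. -/

import Mathlib

/-! Face numbers of finite simplicial complexes -/

/-- The number `f_i` of `i`-dimensional faces, that is, of faces with `i + 1` vertices. -/
noncomputable def PreAbstractSimplicialComplex.fNumber {V : Type*}
    (K : PreAbstractSimplicialComplex V) (i : ℕ) : ℕ :=
  {F : Finset V | F ∈ K.faces ∧ F.card = i + 1}.ncard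

/-- The face numbers shifted by one: `fShift i` is `f_{i-1}`, with the convention `f_{-1} = 1`. -/
noncomputable def PreAbstractSimplicialComplex.fShift {V : Type*}
    (K : PreAbstractSimplicialComplex V) : ℕ → ℕ
  | 0 => 1
  | i + 1 => K.fNumber i

/-- The number `h_i` (for `i ≤ d`) of a `(d-1)`-dimensional complex: the coefficient of `x ^ (d-i)`
in `∑ j, f_{j-1} (x - 1) ^ (d-j)`. The defining identity
`∑ i, f_{i-1} x ^ (d-i) = ∑ i, h_i (x + 1) ^ (d-i)` is `sum_hNumber` below. -/
noncomputable def PreAbstractSimplicialComplex.hNumber {V : Type*}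
    (K : PreAbstractSimplicialComplex V) (d i : ℕ) : ℤ :=
  (∑ j ∈ Finset.range (d + 1), Polynomial.C (K.fShift j : ℤ) *
    ((Polynomial.X : Polynomial ℤ) - 1) ^ (d - j)).coeff (d - i)

theorem PreAbstractSimplicialComplex.sum_hNumber {V : Type*}
    (K : PreAbstractSimplicialComplex V) (d : ℕ) :
    ∑ i ∈ Finset.range (d + 1), Polynomial.C (K.fShift i : ℤ) *
        (Polynomial.X : Polynomial ℤ) ^ (d - i) =
      ∑ i ∈ Finset.range (d + 1), Polynomial.C (K.hNumber d i) *
        ((Polynomial.X : Polynomial ℤ) + 1) ^ (d - i) := by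
  set p : Polynomial ℤ := ∑ j ∈ Finset.range (d + 1), Polynomial.C (K.fShift j : ℤ) *
    ((Polynomial.X : Polynomial ℤ) - 1) ^ (d - j) with hp
  have hdeg : p.natDegree < d + 1 := by
    refine Nat.lt_succ_of_le (Polynomial.natDegree_sum_le_of_forall_le _ _ fun j _ => ?_)
    refine (Polynomial.natDegree_C_mul_le _ _).trans (Polynomial.natDegree_pow_le.trans ?_)
    have h1 : ((Polynomial.X : Polynomial ℤ) - 1).natDegree ≤ 1 := by
      simpa using Polynomial.natDegree_X_sub_C_le (1 : ℤ)
    calc (d - j) * ((Polynomial.X : Polynomial ℤ) - 1).natDegree ≤ (d - j) * 1 :=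
          Nat.mul_le_mul_left _ h1
      _ ≤ d := by omega
  have hcomp := congrArg (fun q : Polynomial ℤ => q.comp (Polynomial.X + 1))
    (Polynomial.as_sum_range_C_mul_X_pow' p hdeg)
  rw [← Finset.sum_range_reflect] at hcomp
  simp only [hp, Polynomial.sum_comp, Polynomial.mul_comp, Polynomial.C_comp,
    Polynomial.pow_comp, Polynomial.sub_comp, Polynomial.X_comp, Polynomial.one_comp,
    add_sub_cancel_right] at hcomp
  rw [hcomp]
  refine Finset.sum_congr rfl fun i _ => ?_
  simp [PreAbstractSimplicialComplex.hNumber]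

/-- The `g`-vector of a `(d-1)`-dimensional complex: `g_0 = 1` and `g_i = h_i - h_{i-1}`
(for `1 ≤ i ≤ ⌊d/2⌋`). -/
noncomputable def PreAbstractSimplicialComplex.gNumber {V : Type*}
    (K : PreAbstractSimplicialComplex V) (d : ℕ) : ℕ → ℤ
  | 0 => 1
  | i + 1 => K.hNumber d (i + 1) - K.hNumber d i

/-- The integer vector `(a 0, …, a δ)` is an `m`-sequence: `a 0 = 1`, and `a j ≥ binom(m, j)`
implies `a (j-1) ≥ binom(m-1, j-1)`, for all `m ≥ j > 1`. -/
def IsLittleMSequence (δ : ℕ) (a : ℕ → ℤ) : Prop :=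
  a 0 = 1 ∧ ∀ j m : ℕ, 1 < j → j ≤ δ → j ≤ m →
    (m.choose j : ℤ) ≤ a j → ((m - 1).choose (j - 1) : ℤ) ≤ a (j - 1)

/-! Reduced simplicial homology and homology spheres -/

/-- All faces of the complex, including the empty face. -/
def PreAbstractSimplicialComplex.allFaces {V : Type*}
    (K : PreAbstractSimplicialComplex V) : Set (Finset V) :=
  insert ∅ K.faces

/-- All faces (including the empty one) of the link of the face `F`. -/
def PreAbstractSimplicialComplex.linkFaces {V : Type*} [DecidableEq V]
    (K : PreAbstractSimplicialComplex V) (F : Finset V) : Set (Finset V) :=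
  {G | Disjoint F G ∧ F ∪ G ∈ K.allFaces}

/-- The augmented simplicial boundary map, the vertices being ordered: a finite set `F` is sent to
the sum of the sets `F \ {v}`, `v ∈ F`, with sign `(-1) ^ (position of v in F)`.
A one-point set is sent to the empty set, and the empty set is sent to zero. -/
noncomputable def simplicialBoundary (R : Type*) [CommRing R] (V : Type*) [LinearOrder V] :
    (Finset V →₀ R) →ₗ[R] (Finset V →₀ R) :=
  Finsupp.linearCombination R fun F : Finset V =>
    ∑ v ∈ F, Finsupp.single (F.erase v) ((-1 : R) ^ (F.filter (fun w => w < v)).card)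

/-- The chains carried by the members of `L` with `k` vertices (the chains of degree `k - 1`). -/
def simplicialChains (R : Type*) [CommRing R] {V : Type*} (L : Set (Finset V)) (k : ℕ) :
    Submodule R (Finset V →₀ R) :=
  Finsupp.supported R R {F | F ∈ L ∧ F.card = k}

/-- The cycles of degree `k - 1`. -/
noncomputable def simplicialCycles (R : Type*) [CommRing R] {V : Type*} [LinearOrder V]
    (L : Set (Finset V)) (k : ℕ) : Submodule R (Finset V →₀ R) :=
  simplicialChains R L k ⊓ LinearMap.ker (simplicialBoundary R V)

/-- The boundaries of degree `k - 1`. -/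
noncomputable def simplicialBoundaries (R : Type*) [CommRing R] {V : Type*} [LinearOrder V]
    (L : Set (Finset V)) (k : ℕ) : Submodule R (Finset V →₀ R) :=
  (simplicialChains R L (k + 1)).map (simplicialBoundary R V)

/-- The reduced simplicial homology module of degree `k - 1`, with coefficients in `R`, of the
complex with set of faces `L` (closed under taking subsets, the empty face included): cycles modulo
boundaries, realized as the image of the module of cycles in the quotient by the boundaries. -/
noncomputable def reducedHomology (R : Type*) [CommRing R] {V : Type*} [LinearOrder V]
    (L : Set (Finset V)) (k : ℕ) : Submodule R ((Finset V →₀ R) ⧸ simplicialBoundaries R L k) :=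
  (simplicialCycles R L k).map (simplicialBoundaries R L k).mkQ

/-- `K` is a `(d-1)`-dimensional homology sphere over `R`: a finite simplicial complex such that
the link of every face `F` (the link of the empty face being `K`) has the reduced homology of a
sphere of dimension `d - 1 - |F|`, that is, `R` in degree `d - 1 - |F|` and zero in all other
degrees. For an inclusion-maximal face `F` the link is `{∅}`, whose only nonzero reduced homology
is in degree `-1`; so the condition forces every maximal face to have exactly `d` vertices. -/
def PreAbstractSimplicialComplex.IsHomologySphere (R : Type*) [CommRing R] {V : Type*}
    [LinearOrder V] (K : PreAbstractSimplicialComplex V) (d : ℕ) : Prop :=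
  K.faces.Finite ∧ ∀ F ∈ K.allFaces, ∀ k : ℕ,
    (k + F.card = d → Nonempty (reducedHomology R (K.linkFaces F) k ≃ₗ[R] R)) ∧
    (k + F.card ≠ d → Subsingleton (reducedHomology R (K.linkFaces F) k))

/-! Cyclic polytopes -/

/-- The moment curve `t ↦ (t, t ^ 2, …, t ^ d)` in `ℝ ^ d`. -/
def momentCurve (d : ℕ) (t : ℝ) : Fin d → ℝ := fun i => t ^ ((i : ℕ) + 1)

/-- The cyclic polytope `C(n,d)` with parameters `t_1 < ⋯ < t_n`: the convex hull of `n` distinct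
points on the moment curve. -/
def cyclicPolytope (d : ℕ) {n : ℕ} (t : Fin n → ℝ) : Set (Fin d → ℝ) :=
  convexHull ℝ (Set.range fun k => momentCurve d (t k))

/-- The number of `i`-dimensional faces of a convex polytope `P`. A nonempty face is the set of
maximizers over `P` of some linear functional. -/
noncomputable def polytopeFNumber {E : Type*} [AddCommGroup E] [Module ℝ E] [TopologicalSpace E]
    (P : Set E) (i : ℕ) : ℕ :=
  {F : Set E | F.Nonempty ∧ IsExposed ℝ P F ∧ Module.finrank ℝ (vectorSpan ℝ F) = i}.ncard

/-! Write f_j for the number of faces with j vertices. The Euler relations in all links give the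
Dehn–Sommerville equations, so that f_j is the sum over l ≤ d/2 of g_l M(l, d-j) with M = `gCoeff`,
both for Δ and for C(n,d). Let c_l be the g-number of C(n,d) minus that of Δ. Since C(n,d) is
neighborly, its g-numbers are binomial coefficients, and the m-sequence condition, applied downwards
from the last index k with c_k < 0, gives c_i ≤ 0 for all 1 ≤ i ≤ k; moreover c_0 = 0. Thus c
changes sign at most once, from nonpositive to nonnegative. The two-by-two minors of adjacent
columns of M have a constant sign (`gCoeff_minor`), so nonnegativity of the sum of c_l M(l, d-j)
passes to j+1 (`gCoeff_comparison`), provided that M(k, d-j) > 0. Otherwise all terms of the sum are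
nonpositive, hence zero; then c_1 = 0, so Δ has exactly n vertices and the upper bound theorem
applies (`IsEulerian.le_succ_of_le`).

The cyclic polytope. Its faces correspond to the zero sets, among the parameters, of polynomials of
degree at most d that are nonnegative at all parameters. The least possible degree obeys a
recursion, from which the face polynomial is shown to have the symmetry X ↦ -1-X that encodes the
Euler relations.

The upper bound theorem (`IsSphereComplex.hVector_le`). Over an infinite field, consider chains
whose coefficient on a face F is a polynomial in the vertices of F. In each multidegree this complex
is the chain complex of a star, so it is exact below the top; the depth then grows by one at each
step, and d linear forms with Vandermonde coefficients are a regular sequence on the top cycles.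
These cycles are the multiples of one fundamental cycle, a copy of the face ring. Dividing by the d
forms leaves a Hilbert function equal to the h-vector, and the quotient is spanned by monomials in
the vertices outside one facet.

The coefficient ring R is replaced by an infinite field by transporting contracting homotopies along
the ring map (`IsSphereComplex.map`). -/

/-! ### The matrix relating the `g`-vector and the `f`-vector -/

/-- The coefficient of `g_l` in the number of faces with `d - b` vertices. -/
def gCoeff (d l b : ℕ) : ℤ := ∑ m ∈ Finset.Icc l (d - l), (m.choose b : ℤ)

theorem gCoeff_nonneg (d l b : ℕ) : 0 ≤ gCoeff d l b :=
  Finset.sum_nonneg fun _ _ => by positivity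

theorem gCoeff_pos {d l b : ℕ} (hl : 2 * l ≤ d) (hb : b + l ≤ d) : 0 < gCoeff d l b := by
  refine Finset.sum_pos' (fun _ _ => by positivity) ⟨d - l, ?_, ?_⟩
  · simp only [Finset.mem_Icc]; omega
  · exact_mod_cast Nat.choose_pos (by omega)

theorem gCoeff_eq_zero {d l b : ℕ} (hb : d < b + l) : gCoeff d l b = 0 := by
  refine Finset.sum_eq_zero fun m hm => ?_
  rw [Finset.mem_Icc] at hm
  exact_mod_cast Nat.choose_eq_zero_of_lt (by omega)

theorem succ_mul_choose_succ_int (n k : ℕ) :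
    ((k : ℤ) + 1) * (n.choose (k + 1) : ℤ) = ((n : ℤ) - k) * (n.choose k : ℤ) := by
  rcases le_or_gt k n with h | h
  · have := Nat.choose_succ_right_eq n k
    zify [h] at this
    linarith
  · rw [Nat.choose_eq_zero_of_lt h, Nat.choose_eq_zero_of_lt (by omega)]
    simp

/-- After multiplication by b+1, each (b+1) binom(m, b+1) becomes (m-b) binom(m, b). With capitals
for the binomials over b, the difference of the two sides is (y'-y)(XX'-YY') + (x'-y)(XY'-YX'), and
Y ≤ Y' ≤ X' ≤ X. -/
theorem choose_add_choose_minor {y y' x' x : ℕ} (b : ℕ) (h1 : y ≤ y') (h2 : y' ≤ x')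
    (h3 : x + y = x' + y') :
    ((y.choose b : ℤ) + x.choose b) * (y'.choose (b + 1) + x'.choose (b + 1)) ≤
      ((y.choose (b + 1) : ℤ) + x.choose (b + 1)) * (y'.choose b + x'.choose b) := by
  have ey := succ_mul_choose_succ_int y b
  have ey' := succ_mul_choose_succ_int y' b
  have ex := succ_mul_choose_succ_int x b
  have ex' := succ_mul_choose_succ_int x' b
  have m1 : (y.choose b : ℤ) ≤ y'.choose b := by exact_mod_cast Nat.choose_le_choose b h1
  have m2 : (y'.choose b : ℤ) ≤ x'.choose b := by exact_mod_cast Nat.choose_le_choose b h2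
  have m3 : (x'.choose b : ℤ) ≤ x.choose b := by
    exact_mod_cast Nat.choose_le_choose b (by omega)
  have m0 : (0 : ℤ) ≤ y.choose b := by positivity
  have hb : (0 : ℤ) < (b : ℤ) + 1 := by positivity
  refine le_of_mul_le_mul_left ?_ hb
  have h3' : (x : ℤ) = x' + y' - y := by
    have : (x : ℤ) + y = x' + y' := by exact_mod_cast h3
    linarith
  have e1 : (0 : ℤ) ≤ (y' : ℤ) - y := by
    have : (y : ℤ) ≤ y' := by exact_mod_cast h1
    linarith
  have e2 : (0 : ℤ) ≤ (x' : ℤ) - y := by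
    have : (y : ℤ) ≤ x' := by exact_mod_cast h1.trans h2
    linarith
  generalize (y.choose b : ℤ) = Y at *
  generalize (y'.choose b : ℤ) = Y' at *
  generalize (x'.choose b : ℤ) = X' at *
  generalize (x.choose b : ℤ) = X at *
  have p1 : 0 ≤ X * X' - Y * Y' := by
    have := mul_le_mul (m1.trans (m2.trans m3)) m2 (m0.trans m1)
      (m0.trans (m1.trans (m2.trans m3)))
    linarith
  have p2 : 0 ≤ X * Y' - Y * X' := by
    have := mul_le_mul m3 m1 m0 (m0.trans (m1.trans (m2.trans m3)))
    linarith
  have q1 := mul_nonneg e1 p1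
  have q2 := mul_nonneg e2 p2
  calc _ = (Y + X) * (((b : ℤ) + 1) * (y'.choose (b + 1)) + ((b : ℤ) + 1) * x'.choose (b + 1)) := by
        ring
    _ ≤ (((b : ℤ) + 1) * (y.choose (b + 1)) + ((b : ℤ) + 1) * x.choose (b + 1)) * (Y' + X') := by
        rw [ey, ey', ex, ex', h3']
        linarith
    _ = _ := by ring

/-- The reflection m ↦ d-m preserves the interval of summation. It arranges the terms in pairs with
index sum d, the shape required by `choose_add_choose_minor`. -/
theorem two_mul_gCoeff {d l : ℕ} (hl : l ≤ d) (b : ℕ) :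
    2 * gCoeff d l b =
      ∑ m ∈ Finset.Icc l (d - l), ((m.choose b : ℤ) + ((d - m).choose b : ℤ)) := by
  rw [Finset.sum_add_distrib, two_mul]
  refine congrArg _ ?_
  refine Finset.sum_nbij' (fun m => d - m) (fun m => d - m) ?_ ?_ ?_ ?_ ?_ <;>
    simp only [Finset.mem_Icc] <;> intro m hm
  · omega
  · omega
  · omega
  · omega
  · rw [Nat.sub_sub_self (by omega)]

theorem gCoeff_eq_add {d l : ℕ} (hl : 2 * l < d) (b : ℕ) :
    gCoeff d l b = ((l.choose b : ℤ) + (d - l).choose b) + gCoeff d (l + 1) b := by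
  have : Finset.Icc l (d - l) = insert l (insert (d - l) (Finset.Icc (l + 1) (d - (l + 1)))) := by
    ext m; simp only [Finset.mem_Icc, Finset.mem_insert]; omega
  rw [gCoeff, this, Finset.sum_insert, Finset.sum_insert, gCoeff, add_assoc]
  · simp only [Finset.mem_Icc]; omega
  · simp only [Finset.mem_Icc, Finset.mem_insert]; omega

/-- The two-by-two minors of adjacent columns are nonnegative. -/
theorem gCoeff_minor {d i k : ℕ} (b : ℕ) (hik : i ≤ k) (hk : 2 * k ≤ d) :
    gCoeff d i b * gCoeff d k (b + 1) ≤ gCoeff d i (b + 1) * gCoeff d k b := by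
  induction hn : k - i generalizing i with
  | zero =>
    obtain rfl : i = k := by omega
    exact (mul_comm _ _).le
  | succ n ih =>
    have h1 := ih (i := i + 1) (by omega) (by omega)
    rw [gCoeff_eq_add (l := i) (by omega), gCoeff_eq_add (l := i) (by omega), add_mul (_ + _ : ℤ), add_mul (_ + _ : ℤ)]
    refine add_le_add ?_ h1
    -- The outermost pair (i, d-i) split off from row i is compared with each pair (m, d-m) of row
    -- k. The factor 2 pays for symmetrizing row k.
    refine le_of_mul_le_mul_left ?_ (two_pos (α := ℤ))
    rw [mul_left_comm, two_mul_gCoeff (l := k) (by omega), mul_left_comm,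
      two_mul_gCoeff (l := k) (by omega), Finset.mul_sum, Finset.mul_sum]
    refine Finset.sum_le_sum fun m hm => ?_
    rw [Finset.mem_Icc] at hm
    rcases le_total m (d - m) with h | h
    · exact choose_add_choose_minor b (by omega) h (by omega)
    · rw [add_comm (m.choose _ : ℤ), add_comm (m.choose _ : ℤ)]
      exact choose_add_choose_minor b (by omega) h (by omega)

/-- If the sequence `c` changes sign once, from nonpositive to nonnegative, then nonnegativity of
the combination of the rows propagates to the next column. -/
theorem gCoeff_comparison {d k b : ℕ} {c : ℕ → ℤ} (hk : 2 * k ≤ d)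
    (hneg : ∀ j ≤ k, c j ≤ 0) (hpos : ∀ j, k < j → j ≤ d / 2 → 0 ≤ c j)
    (hM : 0 < gCoeff d k (b + 1))
    (h : 0 ≤ ∑ l ∈ Finset.range (d / 2 + 1), c l * gCoeff d l (b + 1)) :
    0 ≤ ∑ l ∈ Finset.range (d / 2 + 1), c l * gCoeff d l b := by
  -- The sum multiplied by M(k, b+1) is compared term by term with the known sum multiplied by M(k,
  -- b). The difference of the l-th terms is c_l times a minor of rows l and k, and both factors
  -- change sign at l = k.
  refine nonneg_of_mul_nonneg_right (?_ : 0 ≤ gCoeff d k (b + 1) * _) hM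
  refine (mul_nonneg (gCoeff_nonneg d k b) h).trans ?_
  rw [Finset.mul_sum, Finset.mul_sum]
  refine Finset.sum_le_sum fun l hl => ?_
  rw [Finset.mem_range] at hl
  rcases le_or_gt l k with hlk | hlk
  · have := mul_le_mul_of_nonpos_left (gCoeff_minor b hlk hk) (hneg l hlk)
    linarith
  · have := mul_le_mul_of_nonneg_left (gCoeff_minor (i := k) b hlk.le (by omega : 2 * l ≤ d))
      (hpos l hlk (by omega))
    linarith

/-! ### Face numbers and `h`-numbers -/

/-- The `h`-numbers of a sequence `f` of face numbers, `f j` counting the faces with `j`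
vertices. -/
noncomputable def hVector (d : ℕ) (f : ℕ → ℤ) (i : ℕ) : ℤ :=
  (∑ j ∈ Finset.range (d + 1), Polynomial.C (f j) *
    ((Polynomial.X : Polynomial ℤ) - 1) ^ (d - j)).coeff (d - i)

theorem sum_hVector (d : ℕ) (f : ℕ → ℤ) :
    ∑ i ∈ Finset.range (d + 1), Polynomial.C (f i) * (Polynomial.X : Polynomial ℤ) ^ (d - i) =
      ∑ i ∈ Finset.range (d + 1), Polynomial.C (hVector d f i) *
        ((Polynomial.X : Polynomial ℤ) + 1) ^ (d - i) := by
  set p : Polynomial ℤ := ∑ j ∈ Finset.range (d + 1), Polynomial.C (f j) *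
    ((Polynomial.X : Polynomial ℤ) - 1) ^ (d - j) with hp
  have hdeg : p.natDegree < d + 1 := by
    refine Nat.lt_succ_of_le (Polynomial.natDegree_sum_le_of_forall_le _ _ fun j _ => ?_)
    refine (Polynomial.natDegree_C_mul_le _ _).trans (Polynomial.natDegree_pow_le.trans ?_)
    have h1 : ((Polynomial.X : Polynomial ℤ) - 1).natDegree ≤ 1 := by
      simpa using Polynomial.natDegree_X_sub_C_le (1 : ℤ)
    calc (d - j) * ((Polynomial.X : Polynomial ℤ) - 1).natDegree ≤ (d - j) * 1 :=
          Nat.mul_le_mul_left _ h1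
      _ ≤ d := by omega
  have hcomp := congrArg (fun q : Polynomial ℤ => q.comp (Polynomial.X + 1))
    (Polynomial.as_sum_range_C_mul_X_pow' p hdeg)
  rw [← Finset.sum_range_reflect] at hcomp
  simp only [hp, Polynomial.sum_comp, Polynomial.mul_comp, Polynomial.C_comp,
    Polynomial.pow_comp, Polynomial.sub_comp, Polynomial.X_comp, Polynomial.one_comp,
    add_sub_cancel_right] at hcomp
  rw [hcomp]
  refine Finset.sum_congr rfl fun i _ => ?_
  simp [hVector]

theorem eq_sum_hVector_mul_choose {d j : ℕ} (f : ℕ → ℤ) (hj : j ≤ d) :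
    f j = ∑ i ∈ Finset.range (d + 1), hVector d f i * ((d - i).choose (d - j) : ℤ) := by
  have h := congrArg (fun q : Polynomial ℤ => q.coeff (d - j)) (sum_hVector d f)
  simp only [Polynomial.finsetSum_coeff, Polynomial.coeff_C_mul, Polynomial.coeff_X_pow,
    Polynomial.coeff_X_add_one_pow] at h
  rw [← h, Finset.sum_eq_single j]
  · simp
  · intro b hb hbj
    rw [Finset.mem_range] at hb
    rw [if_neg (by omega), mul_zero]
  · intro h'
    simp only [Finset.mem_range] at h'
    omega

/-- The system is unitriangular: binom(d-l, d-j) is 0 for l > j and 1 for l = j. Hence its first J+1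
equations already determine the first J+1 unknowns. -/
theorem eq_hVector_of_eq_sum {d J : ℕ} {f a : ℕ → ℤ} (hJ : J ≤ d)
    (h : ∀ j ≤ J, f j = ∑ i ∈ Finset.range (d + 1), a i * ((d - i).choose (d - j) : ℤ))
    {i : ℕ} (hi : i ≤ J) : a i = hVector d f i := by
  induction i using Nat.strong_induction_on with
  | _ i ih =>
    have key : ∀ b : ℕ → ℤ, ∑ l ∈ Finset.range (d + 1), b l * ((d - l).choose (d - i) : ℤ) =
        ∑ l ∈ Finset.range i, b l * ((d - l).choose (d - i) : ℤ) + b i := by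
      intro b
      rw [← Finset.sum_subset (Finset.range_mono (show i + 1 ≤ d + 1 by omega)),
        Finset.sum_range_succ]
      · simp
      · intro x hx hx'
        simp only [Finset.mem_range] at hx hx'
        rw [Nat.choose_eq_zero_of_lt (by omega)]
        simp
    have h1 := h i hi
    have h2 := eq_sum_hVector_mul_choose f (hi.trans hJ)
    rw [h1, key, key] at h2
    have : ∑ l ∈ Finset.range i, a l * ((d - l).choose (d - i) : ℤ) =
        ∑ l ∈ Finset.range i, hVector d f l * ((d - l).choose (d - i) : ℤ) :=
      Finset.sum_congr rfl fun l hl => by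
        rw [Finset.mem_range] at hl
        rw [ih l hl (by omega)]
    linarith

/-- Expand X^a (1+X)^(d-a) in powers of 1+X by writing X = -1 + (1+X), and compare coefficients of
X^j. -/
theorem sum_neg_one_pow_mul_choose_mul_choose {a d j : ℕ} (ha : a ≤ d) (hj : j ≤ d) :
    ∑ m ∈ Finset.range (d + 1), (-1 : ℤ) ^ m * ((a.choose (d - m) : ℤ) * (m.choose j : ℤ)) =
      (-1) ^ d * ((d - a).choose (d - j) : ℤ) := by
  have h1 : (Polynomial.X : Polynomial ℤ) ^ a * (1 + Polynomial.X) ^ (d - a) =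
      ∑ p ∈ Finset.range (a + 1), Polynomial.C ((-1 : ℤ) ^ p * (a.choose p : ℤ)) *
        (1 + Polynomial.X) ^ (d - p) := by
    have : (Polynomial.X : Polynomial ℤ) = -1 + (1 + Polynomial.X) := by ring
    conv_lhs => rw [this]
    rw [add_pow, Finset.sum_mul, ← this]
    refine Finset.sum_congr rfl fun p hp => ?_
    rw [Finset.mem_range] at hp
    rw [show d - p = (a - p) + (d - a) by omega, pow_add]
    simp only [map_mul, map_pow, map_neg, map_one, map_natCast]
    ring
  have h2 := congrArg (fun q : Polynomial ℤ => q.coeff j) h1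
  simp only [Polynomial.finsetSum_coeff, Polynomial.coeff_C_mul,
    Polynomial.coeff_one_add_X_pow, Polynomial.coeff_X_pow_mul'] at h2
  have h3 : (if a ≤ j then (((d - a).choose (j - a) : ℕ) : ℤ) else 0) =
      ((d - a).choose (d - j) : ℤ) := by
    split_ifs with h
    · rw [← Nat.choose_symm (by omega : j - a ≤ d - a)]
      congr 2
      omega
    · rw [Nat.choose_eq_zero_of_lt (by omega)]
      rfl
  rw [← h3, h2, ← Finset.sum_range_reflect, Finset.mul_sum]
  rw [← Finset.sum_subset (Finset.range_mono (show a + 1 ≤ d + 1 by omega))]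
  · refine Finset.sum_congr rfl fun p hp => ?_
    rw [Finset.mem_range] at hp
    rw [show d + 1 - 1 - p = d - p by omega, Nat.sub_sub_self (by omega)]
    have : (-1 : ℤ) ^ (d - p) = (-1) ^ d * (-1) ^ p := by
      rw [show d = (d - p) + p by omega, pow_add, Nat.add_sub_cancel, mul_assoc, ← pow_add,
        Even.neg_one_pow ⟨p, rfl⟩, mul_one]
    rw [this]
    ring
  · intro x hx hx'
    simp only [Finset.mem_range] at hx hx'
    rw [show d + 1 - 1 - x = d - x by omega, Nat.sub_sub_self (by omega),
      Nat.choose_eq_zero_of_lt (by omega : a < x)]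
    simp

/-- The Euler relations summed over the faces with a given number of vertices. -/
def IsEulerian (d : ℕ) (f : ℕ → ℤ) : Prop :=
  ∀ j ≤ d, ∑ m ∈ Finset.range (d + 1), (-1 : ℤ) ^ m * (f m * (m.choose j : ℤ)) = (-1) ^ d * f j

/-- The Dehn–Sommerville equations. -/
theorem IsEulerian.hVector_symm {d : ℕ} {f : ℕ → ℤ} (hf : IsEulerian d f) {i : ℕ} (hi : i ≤ d) :
    hVector d f (d - i) = hVector d f i := by
  -- The Euler relations say that the reversed h-vector solves the same triangular system, so
  -- uniqueness of the solution gives the symmetry.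
  refine eq_hVector_of_eq_sum (a := fun i => hVector d f (d - i)) le_rfl (fun j hj => ?_) hi
  rw [← Finset.sum_range_reflect]
  have h1 : (-1 : ℤ) ^ d * f j = (-1) ^ d * ∑ l ∈ Finset.range (d + 1),
      hVector d f l * (l.choose (d - j) : ℤ) := by
    rw [← hf j hj]
    calc _ = ∑ m ∈ Finset.range (d + 1), ∑ l ∈ Finset.range (d + 1), hVector d f l *
          ((-1 : ℤ) ^ m * (((d - l).choose (d - m) : ℤ) * (m.choose j : ℤ))) := by
          refine Finset.sum_congr rfl fun m hm => ?_
          rw [Finset.mem_range] at hm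
          rw [eq_sum_hVector_mul_choose f (Nat.lt_succ_iff.1 hm), Finset.sum_mul, Finset.mul_sum]
          exact Finset.sum_congr rfl fun l _ => by ring
      _ = _ := by
          rw [Finset.sum_comm, Finset.mul_sum]
          refine Finset.sum_congr rfl fun l hl => ?_
          rw [Finset.mem_range] at hl
          rw [← Finset.mul_sum, sum_neg_one_pow_mul_choose_mul_choose (by omega) hj,
            Nat.sub_sub_self (by omega)]
          ring
  rw [mul_left_cancel₀ (pow_ne_zero d (by norm_num)) h1]
  refine Finset.sum_congr rfl fun l hl => ?_
  rw [Finset.mem_range] at hl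
  rw [show d + 1 - 1 - l = d - l by omega, Nat.sub_sub_self (by omega)]

/-- Coefficient of x^j in (1-x)^(-(m+1)) (1-x)^(-(q+1)) = (1-x)^(-(m+q+2)). -/
theorem sum_antidiagonal_choose_mul_choose (m q j : ℕ) :
    ∑ x ∈ Finset.HasAntidiagonal.antidiagonal j, (m + x.1).choose m * (q + x.2).choose q =
      (m + q + 1 + j).choose (m + q + 1) := by
  have h := PowerSeries.invOneSubPow_add ℤ (m + 1) (q + 1)
  have h' := congrArg (fun u : (PowerSeries ℤ)ˣ => PowerSeries.coeff j (u : PowerSeries ℤ)) h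
  rw [show m + 1 + (q + 1) = (m + q + 1) + 1 by ring] at h'
  simp only [Units.val_mul, PowerSeries.invOneSubPow_val_succ_eq_mk_add_choose,
    PowerSeries.coeff_mk, PowerSeries.coeff_mul] at h'
  exact_mod_cast h'.symm

/-- The `h`-numbers of a sequence that begins like that of a neighborly complex. -/
theorem hVector_of_neighborly {d n J : ℕ} {f : ℕ → ℤ} (hn : d < n) (hJ : J ≤ d)
    (h : ∀ j ≤ J, f j = (n.choose j : ℤ)) {i : ℕ} (hi : i ≤ J) :
    hVector d f i = ((n - d - 1 + i).choose i : ℤ) := by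
  refine (eq_hVector_of_eq_sum (a := fun i => ((n - d - 1 + i).choose i : ℤ)) hJ
    (fun j hj => ?_) hi).symm
  have key := sum_antidiagonal_choose_mul_choose (n - d - 1) (d - j) j
  rw [Finset.Nat.sum_antidiagonal_eq_sum_range_succ_mk] at key
  rw [h j hj, ← Finset.sum_subset (Finset.range_mono (show j + 1 ≤ d + 1 by omega))]
  · have e1 : n.choose j = (n - d - 1 + (d - j) + 1 + j).choose (n - d - 1 + (d - j) + 1) := by
      rw [← Nat.choose_symm (by omega : j ≤ n)]
      congr 1 <;> omega
    rw [e1, ← key]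
    push_cast
    refine Finset.sum_congr rfl fun l hl => ?_
    rw [Finset.mem_range] at hl
    rw [show d - j + (j - l) = d - l by omega, Nat.choose_symm_add]
  · intro x hx hx'
    simp only [Finset.mem_range] at hx hx'
    rw [Nat.choose_eq_zero_of_lt (by omega : d - x < d - j)]
    simp

/-- The `g`-numbers of a sequence `f` of face numbers. -/
noncomputable def gVector (d : ℕ) (f : ℕ → ℤ) : ℕ → ℤ
  | 0 => hVector d f 0
  | i + 1 => hVector d f (i + 1) - hVector d f i

theorem sum_gVector (d : ℕ) (f : ℕ → ℤ) (i : ℕ) :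
    ∑ l ∈ Finset.range (i + 1), gVector d f l = hVector d f i := by
  induction i with
  | zero => simp [gVector]
  | succ i ih => rw [Finset.sum_range_succ, ih, gVector]; ring

/-- By symmetry h_i is the sum of g_l over l ≤ min(i, d-i), that is, over those l for which i lies
in [l, d-l]. Interchanging the two summations collects the binomials into `gCoeff`. -/
theorem IsEulerian.eq_sum_gVector {d j : ℕ} {f : ℕ → ℤ} (hf : IsEulerian d f) (hj : j ≤ d) :
    f j = ∑ l ∈ Finset.range (d / 2 + 1), gVector d f l * gCoeff d l (d - j) := by
  have h1 : ∀ i ∈ Finset.range (d + 1), hVector d f i =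
      ∑ l ∈ Finset.range (d / 2 + 1), if i ∈ Finset.Icc l (d - l) then gVector d f l else 0 := by
    intro i hi
    rw [Finset.mem_range] at hi
    have h2 : hVector d f i = hVector d f (min i (d - i)) := by
      rcases min_choice i (d - i) with h | h
      · rw [h]
      · rw [h, hf.hVector_symm (by omega)]
    rw [h2, ← sum_gVector, ← Finset.sum_filter]
    refine Finset.sum_congr ?_ fun _ _ => rfl
    ext l
    simp only [Finset.mem_range, Finset.mem_filter, Finset.mem_Icc]
    omega
  rw [eq_sum_hVector_mul_choose f hj, ← Finset.sum_range_reflect]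
  calc _ = ∑ i ∈ Finset.range (d + 1), hVector d f i * (i.choose (d - j) : ℤ) := by
        refine Finset.sum_congr rfl fun i hi => ?_
        rw [Finset.mem_range] at hi
        rw [show d + 1 - 1 - i = d - i by omega, Nat.sub_sub_self (by omega),
          hf.hVector_symm (by omega)]
    _ = ∑ i ∈ Finset.range (d + 1), ∑ l ∈ Finset.range (d / 2 + 1),
          if i ∈ Finset.Icc l (d - l) then gVector d f l * (i.choose (d - j) : ℤ) else 0 := by
        refine Finset.sum_congr rfl fun i hi => ?_
        rw [h1 i hi, Finset.sum_mul]
        exact Finset.sum_congr rfl fun l _ => by rw [ite_mul, zero_mul]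
    _ = _ := by
        rw [Finset.sum_comm]
        refine Finset.sum_congr rfl fun l hl => ?_
        rw [gCoeff, Finset.mul_sum, ← Finset.sum_filter]
        refine Finset.sum_congr ?_ fun _ _ => rfl
        ext i
        simp only [Finset.mem_range, Finset.mem_filter, Finset.mem_Icc]
        omega

/-! ### Gale's evenness condition -/

/-- The least degree of a polynomial that is nonnegative on `n` increasing real points, positive
to the right of them, and whose zeros among them are the points with index in `W`. -/
def ballCost (W : Finset ℕ) : ℕ → ℕ
  | 0 => 0
  | 1 => if 0 ∈ W then 1 else 0
  | n + 2 => if n + 1 ∈ W then 2 + ballCost W n else ballCost W (n + 1)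

/-- The least degree of a nonzero polynomial that is nonnegative on `n` increasing real points
and whose zeros among them are the points with index in `W`. -/
def sphereCost (W : Finset ℕ) : ℕ → ℕ
  | 0 => 0
  | n + 1 => if n ∈ W then 1 + sphereCost W n else ballCost W n

theorem ballCost_insert (W : Finset ℕ) (m : ℕ) :
    ∀ n ≤ m, ballCost (insert m W) n = ballCost W n
  | 0, _ => rfl
  | 1, h => by simp [ballCost, show (0 : ℕ) ≠ m by omega]
  | n + 2, h => by
    simp only [ballCost, Finset.mem_insert, show n + 1 ≠ m by omega, false_or]
    rw [ballCost_insert W m n (by omega), ballCost_insert W m (n + 1) (by omega)]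

theorem sphereCost_insert (W : Finset ℕ) (m : ℕ) :
    ∀ n ≤ m, sphereCost (insert m W) n = sphereCost W n
  | 0, _ => rfl
  | n + 1, h => by
    simp only [sphereCost, Finset.mem_insert, show n ≠ m by omega, false_or]
    rw [sphereCost_insert W m n (by omega), ballCost_insert W m n (by omega)]

theorem ballCost_le_two_mul (W : Finset ℕ) :
    ∀ n, ballCost W n ≤ 2 * (W ∩ Finset.range n).card
  | 0 => by simp [ballCost]
  | 1 => by
    simp only [ballCost]
    split_ifs with h
    · have : 0 < (W ∩ Finset.range 1).card := Finset.card_pos.2 ⟨0, by simp [h]⟩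
      omega
    · omega
  | n + 2 => by
    have h1 := ballCost_le_two_mul W n
    have h2 := ballCost_le_two_mul W (n + 1)
    simp only [ballCost]
    split_ifs with h
    · have : (insert (n + 1) (W ∩ Finset.range n)).card ≤ (W ∩ Finset.range (n + 2)).card := by
        refine Finset.card_le_card fun x => ?_
        simp only [Finset.mem_insert, Finset.mem_inter, Finset.mem_range]
        rintro (rfl | ⟨h3, h4⟩)
        · exact ⟨h, by omega⟩
        · exact ⟨h3, by omega⟩
      rw [Finset.card_insert_of_notMem (by simp)] at this
      omega
    · refine h2.trans (Nat.mul_le_mul_left _ (Finset.card_le_card ?_))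
      exact Finset.inter_subset_inter_left (Finset.range_mono (by omega))

theorem sphereCost_le_two_mul (W : Finset ℕ) :
    ∀ n, sphereCost W n ≤ 2 * (W ∩ Finset.range n).card
  | 0 => by simp [sphereCost]
  | n + 1 => by
    have h1 := sphereCost_le_two_mul W n
    have h2 := ballCost_le_two_mul W n
    simp only [sphereCost]
    split_ifs with h
    · rw [Finset.range_add_one, Finset.inter_insert_of_mem h,
        Finset.card_insert_of_notMem (by simp)]
      omega
    · refine h2.trans (Nat.mul_le_mul_left _ (Finset.card_le_card ?_))
      exact Finset.inter_subset_inter_left (Finset.range_mono (by omega))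

theorem card_le_ballCost (W : Finset ℕ) : ∀ n, (W ∩ Finset.range n).card ≤ ballCost W n
  | 0 => by simp
  | 1 => by
    simp only [ballCost]
    split_ifs with h
    · exact (Finset.card_le_card Finset.inter_subset_right).trans (by simp)
    · simp [h]
  | n + 2 => by
    have h1 := card_le_ballCost W n
    have h2 := card_le_ballCost W (n + 1)
    simp only [ballCost]
    split_ifs with h
    · have : (W ∩ Finset.range (n + 2)).card ≤ (W ∩ Finset.range n ∪ {n, n + 1}).card := by
        refine Finset.card_le_card fun x => ?_
        simp only [Finset.mem_insert, Finset.mem_inter, Finset.mem_range, Finset.mem_union,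
          Finset.mem_singleton]
        rintro ⟨h3, h4⟩
        by_cases hx : x < n
        · exact Or.inl ⟨h3, hx⟩
        · omega
      have h3 := Finset.card_union_le (W ∩ Finset.range n) {n, n + 1}
      have h4 : ({n, n + 1} : Finset ℕ).card ≤ 2 := Finset.card_le_two
      omega
    · rw [Finset.range_add_one, Finset.inter_insert_of_notMem h]
      exact h2

/-- A nonzero polynomial has degree at least the number of its zeros. This bounds the number of
vertices of a proper face by d. -/
theorem card_le_sphereCost (W : Finset ℕ) : ∀ n, (W ∩ Finset.range n).card ≤ sphereCost W n
  | 0 => by simp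
  | n + 1 => by
    have h1 := card_le_sphereCost W n
    have h2 := card_le_ballCost W n
    simp only [sphereCost]
    split_ifs with h
    · rw [Finset.range_add_one, Finset.inter_insert_of_mem h,
        Finset.card_insert_of_notMem (by simp)]
      omega
    · rw [Finset.range_add_one, Finset.inter_insert_of_notMem h]
      exact h2

/-! ### Face polynomials of cyclic polytopes and their symmetry -/

section GalePolynomials

open Polynomial

/-- The face polynomial of the part of the boundary of a cyclic polytope that avoids its last
vertex. -/
noncomputable def ballPoly (n d : ℕ) : ℤ[X] :=
  ∑ W ∈ (Finset.range n).powerset, if ballCost W n ≤ d then X ^ W.card else 0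

/-- The face polynomial of the boundary of a cyclic polytope. -/
noncomputable def spherePoly (n d : ℕ) : ℤ[X] :=
  ∑ W ∈ (Finset.range n).powerset, if sphereCost W n ≤ d then X ^ W.card else 0

theorem sum_powerset_range_succ {M : Type*} [AddCommMonoid M] (n : ℕ) (F : Finset ℕ → M) :
    ∑ W ∈ (Finset.range (n + 1)).powerset, F W =
      ∑ W ∈ (Finset.range n).powerset, F W + ∑ W ∈ (Finset.range n).powerset, F (insert n W) := by
  rw [Finset.range_add_one, Finset.sum_powerset_insert (by simp)]

theorem notMem_of_mem_powerset_range {n m : ℕ} {W : Finset ℕ}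
    (hW : W ∈ (Finset.range n).powerset) (h : n ≤ m) : m ∉ W := fun hm => by
  have := Finset.mem_range.1 (Finset.mem_powerset.1 hW hm)
  omega

/-- Split according to whether the last index n+1 lies in W. If it does, the cost does not see the
index n, which may be added freely; this yields the factor X(1+X). -/
theorem ballPoly_add_two (n d : ℕ) : ballPoly (n + 2) d = ballPoly (n + 1) d +
    (X + X ^ 2) * ∑ W ∈ (Finset.range n).powerset,
      if 2 + ballCost W n ≤ d then X ^ W.card else 0 := by
  rw [ballPoly, sum_powerset_range_succ]
  congr 1
  · refine Finset.sum_congr rfl fun W hW => ?_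
    rw [ballCost, if_neg (notMem_of_mem_powerset_range hW le_rfl)]
  · rw [sum_powerset_range_succ, add_mul, Finset.mul_sum, Finset.mul_sum]
    congr 1
    · refine Finset.sum_congr rfl fun W hW => ?_
      rw [ballCost, if_pos (Finset.mem_insert_self _ _), ballCost_insert _ _ _ (by omega),
        Finset.card_insert_of_notMem (notMem_of_mem_powerset_range hW (by omega))]
      split_ifs <;> ring
    · refine Finset.sum_congr rfl fun W hW => ?_
      rw [ballCost, if_pos (Finset.mem_insert_self _ _), ballCost_insert _ _ _ (by omega),
        ballCost_insert _ _ _ (by omega), Finset.card_insert_of_notMem,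
        Finset.card_insert_of_notMem (notMem_of_mem_powerset_range hW (by omega))]
      · split_ifs <;> ring
      · rw [Finset.mem_insert, not_or]
        exact ⟨by omega, notMem_of_mem_powerset_range hW (by omega)⟩

theorem ballPoly_add_two_add_two (n d : ℕ) :
    ballPoly (n + 2) (d + 2) = ballPoly (n + 1) (d + 2) + (X + X ^ 2) * ballPoly n d := by
  rw [ballPoly_add_two]
  simp only [show ∀ a : ℕ, 2 + a ≤ d + 2 ↔ a ≤ d by omega]
  rfl

theorem ballPoly_add_two_of_lt {d : ℕ} (hd : d < 2) (n : ℕ) :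
    ballPoly (n + 2) d = ballPoly (n + 1) d := by
  rw [ballPoly_add_two, Finset.sum_eq_zero, mul_zero, add_zero]
  intro W _
  rw [if_neg (by omega)]

theorem spherePoly_succ_zero (n : ℕ) : spherePoly (n + 1) 0 = ballPoly n 0 := by
  rw [spherePoly, sum_powerset_range_succ]
  refine (congrArg₂ (· + ·) (Finset.sum_congr rfl fun W hW => ?_)
    (Finset.sum_eq_zero fun W _ => ?_)).trans (add_zero (ballPoly n 0))
  · rw [sphereCost, if_neg (notMem_of_mem_powerset_range hW le_rfl)]
  · rw [sphereCost, if_pos (Finset.mem_insert_self _ _), if_neg (by omega)]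

/-- The faces through the last vertex form the cone over its link, and this link is counted as the
boundary of C(n,d). -/
theorem spherePoly_succ_succ (n d : ℕ) :
    spherePoly (n + 1) (d + 1) = ballPoly n (d + 1) + X * spherePoly n d := by
  rw [spherePoly, sum_powerset_range_succ]
  congr 1
  · refine Finset.sum_congr rfl fun W hW => ?_
    rw [sphereCost, if_neg (notMem_of_mem_powerset_range hW le_rfl)]
  · rw [spherePoly, Finset.mul_sum]
    refine Finset.sum_congr rfl fun W hW => ?_
    rw [sphereCost, if_pos (Finset.mem_insert_self _ _), sphereCost_insert _ _ _ le_rfl,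
      Finset.card_insert_of_notMem (notMem_of_mem_powerset_range hW le_rfl)]
    simp only [show 1 + sphereCost W n ≤ d + 1 ↔ sphereCost W n ≤ d by omega]
    split_ifs <;> ring

theorem ballPoly_zero_left (d : ℕ) : ballPoly 0 d = 1 := by simp [ballPoly, ballCost]

theorem ballPoly_one_zero : ballPoly 1 0 = 1 := by
  rw [ballPoly, sum_powerset_range_succ]; simp [ballCost]

theorem ballPoly_one_succ (d : ℕ) : ballPoly 1 (d + 1) = 1 + X := by
  rw [ballPoly, sum_powerset_range_succ]; simp [ballCost]

theorem spherePoly_zero_left (d : ℕ) : spherePoly 0 d = 1 := by simp [spherePoly, sphereCost]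

theorem ballPoly_zero_right : ∀ n, ballPoly n 0 = 1
  | 0 => ballPoly_zero_left 0
  | 1 => ballPoly_one_zero
  | n + 2 => by rw [ballPoly_add_two_of_lt (by omega), ballPoly_zero_right (n + 1)]

theorem ballPoly_succ_one : ∀ n, ballPoly (n + 1) 1 = 1 + X
  | 0 => ballPoly_one_succ 0
  | n + 1 => by rw [ballPoly_add_two_of_lt (by omega), ballPoly_succ_one n]

theorem spherePoly_zero_right : ∀ n, spherePoly n 0 = 1
  | 0 => spherePoly_zero_left 0
  | n + 1 => by rw [spherePoly_succ_zero, ballPoly_zero_right]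

theorem ballPoly_of_le : ∀ {n d : ℕ}, n ≤ d → ballPoly n d = (1 + X) ^ n
  | 0, d, _ => by rw [ballPoly_zero_left, pow_zero]
  | 1, d + 1, _ => by rw [ballPoly_one_succ, pow_one]
  | n + 2, d + 2, h => by
    rw [ballPoly_add_two_add_two, ballPoly_of_le (n := n + 1) (by omega),
      ballPoly_of_le (n := n) (by omega)]
    ring

theorem spherePoly_succ_self : ∀ d : ℕ, spherePoly (d + 1) d = (1 + X) ^ (d + 1) - X ^ (d + 1)
  | 0 => by rw [spherePoly_zero_right]; ring
  | d + 1 => by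
    rw [spherePoly_succ_succ, ballPoly_of_le le_rfl, spherePoly_succ_self d]
    ring

theorem spherePoly_add_two_one (n : ℕ) : spherePoly (n + 2) 1 = 1 + 2 * X := by
  rw [spherePoly_succ_succ, ballPoly_succ_one, spherePoly_zero_right]
  ring

/-- The ball recursion carries over to spheres: decompose all three spheres at the last vertex and
use induction on d for their links. -/
theorem spherePoly_add_two_add_two {n d : ℕ} (h : d + 2 ≤ n) :
    spherePoly (n + 2) (d + 2) = spherePoly (n + 1) (d + 2) + (X + X ^ 2) * spherePoly n d := by
  obtain ⟨m, rfl⟩ : ∃ m, n = m + 1 := ⟨n - 1, by omega⟩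
  induction d generalizing m with
  | zero =>
    obtain ⟨l, rfl⟩ : ∃ l, m = l + 1 := ⟨m - 1, by omega⟩
    have h1 := spherePoly_succ_succ (l + 3) 1
    have h2 := spherePoly_succ_succ (l + 2) 1
    rw [spherePoly_add_two_one] at h1 h2
    rw [spherePoly_zero_right]
    linear_combination h1 - h2 + ballPoly_add_two_add_two (l + 1) 0 +
      (X + X ^ 2) * ballPoly_zero_right (l + 1)
  | succ d ih =>
    obtain ⟨l, rfl⟩ : ∃ l, m = l + 1 := ⟨m - 1, by omega⟩
    linear_combination spherePoly_succ_succ (l + 3) (d + 2) - spherePoly_succ_succ (l + 2) (d + 2) +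
      ballPoly_add_two_add_two (l + 1) (d + 1) + X * ih l (by omega) -
      (X + X ^ 2) * spherePoly_succ_succ (l + 1) d

/-- Dehn–Sommerville relation for a ball: the defect of symmetry is the face polynomial of the
boundary sphere. Both sides obey the same recursion in n, because X + X² is invariant under X ↦
-1-X. -/
theorem ballPoly_sub_comp {n d : ℕ} (h : d + 1 ≤ n) :
    ballPoly n (d + 1) - (-1) ^ (d + 1) * (ballPoly n (d + 1)).comp (-1 - X) = spherePoly n d := by
  induction d using Nat.strong_induction_on generalizing n with
  | _ d ihd =>
  induction n, h using Nat.le_induction with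
  | base =>
    rw [ballPoly_of_le le_rfl, spherePoly_succ_self]
    have : (-1 : ℤ[X]) ^ (d + 1) * ((1 + X) ^ (d + 1) : ℤ[X]).comp (-1 - X) = X ^ (d + 1) := by
      simp only [pow_comp, add_comp, one_comp, X_comp]
      rw [← mul_pow]
      congr 1
      ring
    rw [this]
  | succ m hm ih =>
    match d, ihd, hm, ih with
    | 0, _, hm, ih =>
      obtain ⟨l, rfl⟩ : ∃ l, m = l + 1 := ⟨m - 1, by omega⟩
      rw [ballPoly_succ_one, spherePoly_zero_right]
      simp
    | 1, _, hm, ih =>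
      obtain ⟨l, rfl⟩ : ∃ l, m = l + 2 := ⟨m - 2, by omega⟩
      rw [spherePoly_add_two_one] at ih ⊢
      rw [ballPoly_add_two_add_two (l + 1) 0, ← ih, ballPoly_zero_right]
      simp only [add_comp, mul_comp, pow_comp, X_comp, one_comp]
      ring
    | d + 2, ihd, hm, ih =>
      obtain ⟨l, rfl⟩ : ∃ l, m = l + 1 := ⟨m - 1, by omega⟩
      have h1 := ihd d (by omega) (n := l) (by omega)
      rw [spherePoly_add_two_add_two (by omega), ballPoly_add_two_add_two l (d + 1), ← ih, ← h1]
      simp only [add_comp, mul_comp, pow_comp, X_comp]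
      ring

/-- A sphere is a ball together with the cone over the boundary of that ball. The defect of symmetry
of the ball is cancelled by that of the cone, which is known by induction on d. -/
theorem spherePoly_comp {n d : ℕ} (h : d < n) :
    (spherePoly n d).comp (-1 - X) = (-1) ^ d * spherePoly n d := by
  obtain ⟨n, rfl⟩ : ∃ m, n = m + 1 := ⟨n - 1, by omega⟩
  induction d generalizing n with
  | zero => rw [spherePoly_zero_right]; simp
  | succ d ih =>
    obtain ⟨m, rfl⟩ : ∃ m, n = m + 1 := ⟨n - 1, by omega⟩
    have h1 := ballPoly_sub_comp (n := m + 1) (d := d) (by omega)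
    have h2 := ih m (by omega)
    have h3 : (-1 : ℤ[X]) ^ d * (-1) ^ d = 1 := by rw [← mul_pow]; simp
    rw [spherePoly_succ_succ, add_comp, mul_comp, X_comp, h2]
    rw [pow_succ] at h1 ⊢
    linear_combination (-1 : ℤ[X]) ^ d * h1 -
      (ballPoly (m + 1) (d + 1)).comp (-1 - X) * h3

/-- The number of faces with `j` vertices of a cyclic polytope with `n` vertices. -/
def galeCount (n d j : ℕ) : ℕ :=
  ((Finset.range n).powerset.filter fun W => W.card = j ∧ sphereCost W n ≤ d).card

theorem coeff_spherePoly (n d j : ℕ) : (spherePoly n d).coeff j = galeCount n d j := by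
  rw [spherePoly, finsetSum_coeff, galeCount, Finset.card_filter]
  push_cast
  refine Finset.sum_congr rfl fun W _ => ?_
  by_cases h1 : sphereCost W n ≤ d
  · by_cases h2 : W.card = j
    · simp [h1, h2, coeff_X_pow]
    · simp [h1, h2, coeff_X_pow, Ne.symm h2]
  · simp [h1]

theorem galeCount_eq_zero {n d j : ℕ} (h : d < j) : galeCount n d j = 0 := by
  rw [galeCount, Finset.card_eq_zero, Finset.filter_eq_empty_iff]
  rintro W hW ⟨h1, h2⟩
  have := card_le_sphereCost W n
  rw [Finset.inter_eq_left.2 (Finset.mem_powerset.1 hW)] at this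
  omega

/-- Neighborliness: a product of squared linear factors, of degree 2j ≤ d, cuts out any j of the
points. -/
theorem galeCount_of_two_mul_le {n d j : ℕ} (h : 2 * j ≤ d) : galeCount n d j = n.choose j := by
  rw [galeCount]
  conv_rhs => rw [← Finset.card_range n, ← Finset.card_powersetCard]
  congr 1
  ext W
  simp only [Finset.mem_filter, Finset.mem_powerset, Finset.mem_powersetCard]
  refine ⟨fun h => ⟨h.1, h.2.1⟩, fun h1 => ⟨h1.1, h1.2, ?_⟩⟩
  have := sphereCost_le_two_mul W n
  rw [Finset.inter_eq_left.2 h1.1] at this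
  omega

theorem isEulerian_galeCount {n d : ℕ} (h : d < n) :
    IsEulerian d fun j => (galeCount n d j : ℤ) := by
  intro j hj
  have h1 : spherePoly n d = ∑ m ∈ Finset.range (d + 1), C (galeCount n d m : ℤ) * X ^ m := by
    ext i
    rw [coeff_spherePoly, finsetSum_coeff]
    simp only [coeff_C_mul, coeff_X_pow, mul_ite, mul_one, mul_zero]
    rw [Finset.sum_ite_eq (Finset.range (d + 1)) i]
    split_ifs with hi
    · rfl
    · rw [galeCount_eq_zero (by simpa using hi)]; rfl
  have h2 := congrArg (fun q : ℤ[X] => q.coeff j) (spherePoly_comp h)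
  rw [show ((-1 : ℤ[X]) ^ d * spherePoly n d) = C ((-1 : ℤ) ^ d) * spherePoly n d by simp,
    coeff_C_mul, coeff_spherePoly] at h2
  rw [← h2, h1, sum_comp, finsetSum_coeff]
  refine Finset.sum_congr rfl fun m _ => ?_
  have : (C (galeCount n d m : ℤ) * X ^ m).comp (-1 - X) =
      C ((-1 : ℤ) ^ m * galeCount n d m) * (1 + X) ^ m := by
    simp only [mul_comp, C_comp, pow_comp, X_comp]
    rw [show (-1 - X : ℤ[X]) = C (-1) * (1 + X) by simp; ring, mul_pow]
    simp only [map_mul, map_pow]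
    ring
  rw [this, coeff_C_mul, coeff_one_add_X_pow]
  ring

end GalePolynomials

/-! ### Faces of cyclic polytopes -/

section MomentCurve

open Polynomial

/-- A zero at the last point changes the sign, so a second zero c is needed. It is placed at t n
when n ∈ W, and strictly between the last two points otherwise; either way membership of n costs
nothing extra, and the remaining factor only has to be positive from t n on. -/
theorem exists_polynomial_natDegree_le_ballCost {t : ℕ → ℝ} (W : Finset ℕ) : ∀ {n : ℕ},
    (∀ i j, i < j → j < n → t i < t j) → ∀ {τ : ℝ}, (∀ i < n, t i < τ) →
    ∃ p : ℝ[X], p.natDegree ≤ ballCost W n ∧ (∀ x, τ ≤ x → 0 < p.eval x) ∧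
      ∀ k < n, 0 ≤ p.eval (t k) ∧ (p.eval (t k) = 0 ↔ k ∈ W)
  | 0, _, _, _ => ⟨1, by simp, by simp, by simp⟩
  | 1, _, τ, hτ => by
    by_cases h : 0 ∈ W
    · refine ⟨X - C (t 0), by simp [ballCost, h], fun x hx => ?_, fun k hk => ?_⟩
      · have := hτ 0 (by omega)
        simp only [eval_sub, eval_X, eval_C]
        linarith
      · obtain rfl : k = 0 := by omega
        simp [h]
    · refine ⟨1, by simp, by simp, fun k hk => ?_⟩
      obtain rfl : k = 0 := by omega
      simp [h]
  | n + 2, ht, τ, hτ => by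
    by_cases h : n + 1 ∈ W
    · obtain ⟨p, hp1, hp2, hp3⟩ := exists_polynomial_natDegree_le_ballCost W (n := n)
        (fun i j hij hj => ht i j hij (by omega)) (τ := t n) (fun i hi => ht i n hi (by omega))
      have hlt : t n < t (n + 1) := ht n (n + 1) (by omega) (by omega)
      obtain ⟨c, hc1, hc2, hc3⟩ : ∃ c, t n ≤ c ∧ c < t (n + 1) ∧ (t n = c ↔ n ∈ W) := by
        by_cases hn : n ∈ W
        · exact ⟨t n, le_rfl, hlt, by simp [hn]⟩
        · refine ⟨(t n + t (n + 1)) / 2, by linarith, by linarith, ?_⟩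
          simp only [hn, iff_false]
          intro h'
          linarith
      refine ⟨(X - C (t (n + 1))) * (X - C c) * p, ?_, fun x hx => ?_, fun k hk => ?_⟩
      · rw [ballCost, if_pos h]
        refine natDegree_mul_le.trans (add_le_add (natDegree_mul_le.trans ?_) hp1)
        simp
      · have h1 := hτ (n + 1) (by omega)
        simp only [eval_mul, eval_sub, eval_X, eval_C]
        exact mul_pos (mul_pos (by linarith) (by linarith)) (hp2 x (by linarith))
      · simp only [eval_mul, eval_sub, eval_X, eval_C]
        rcases lt_trichotomy k n with hkn | rfl | hkn
        · have h1 : t k < t n := ht k n hkn (by omega)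
          have h2 : 0 < (t k - t (n + 1)) * (t k - c) :=
            mul_pos_of_neg_of_neg (by linarith) (by linarith)
          refine ⟨mul_nonneg h2.le (hp3 k hkn).1, ?_⟩
          rw [mul_eq_zero, or_iff_right h2.ne', (hp3 k hkn).2]
        · have h1 := hp2 (t k) le_rfl
          refine ⟨mul_nonneg (mul_nonneg_of_nonpos_of_nonpos (by linarith) (by linarith)) h1.le, ?_⟩
          rw [mul_eq_zero, or_iff_left h1.ne', mul_eq_zero, or_iff_right (by linarith), sub_eq_zero,
            hc3]
        · obtain rfl : k = n + 1 := by omega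
          simp [h]
    · obtain ⟨p, hp1, hp2, hp3⟩ := exists_polynomial_natDegree_le_ballCost W (n := n + 1)
        (fun i j hij hj => ht i j hij (by omega)) (τ := t (n + 1))
        (fun i hi => ht i (n + 1) hi (by omega))
      refine ⟨p, ?_, fun x hx => hp2 x ?_, fun k hk => ?_⟩
      · rwa [ballCost, if_neg h]
      · have := hτ (n + 1) (by omega)
        linarith
      · rcases Nat.lt_succ_iff_lt_or_eq.1 hk with hk' | rfl
        · exact hp3 k hk'
        · have := hp2 _ le_rfl
          exact ⟨this.le, by simp [h, this.ne']⟩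

/-- Conversely, dividing by X - t (n+1) leaves a quotient that is positive at τ and nonpositive at t
n, hence has a root c in [t n, τ). Removing that root as well leaves a polynomial of the same kind
on the first n points, and two degrees have been used. -/
theorem ballCost_le_natDegree {t : ℕ → ℝ} (W : Finset ℕ) : ∀ {n : ℕ},
    (∀ i j, i < j → j < n → t i < t j) → ∀ {τ : ℝ}, (∀ i < n, t i < τ) → ∀ {p : ℝ[X]},
    0 < p.eval τ → (∀ k < n, 0 ≤ p.eval (t k) ∧ (p.eval (t k) = 0 ↔ k ∈ W)) →
    ballCost W n ≤ p.natDegree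
  | 0, _, _, _, _, _, _ => by simp [ballCost]
  | 1, _, τ, _, p, hp, hk => by
    rw [ballCost]
    split_ifs with h
    · by_contra h0
      have h1 := eq_C_of_natDegree_eq_zero (p := p) (by omega)
      have h2 := ((hk 0 (by omega)).2.2 h)
      rw [h1, eval_C] at h2
      rw [h1, eval_C] at hp
      exact hp.ne' h2
    · omega
  | n + 2, ht, τ, hτ, p, hp, hk => by
    rw [ballCost]
    split_ifs with h
    · obtain ⟨q, rfl⟩ := dvd_iff_isRoot.2 ((hk (n + 1) (by omega)).2.2 h)
      have hlt : t n < t (n + 1) := ht n (n + 1) (by omega) (by omega)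
      have hτ1 := hτ (n + 1) (by omega)
      have hkn := hk n (by omega)
      simp only [eval_mul, eval_sub, eval_X, eval_C] at hp hkn
      have hq : 0 < q.eval τ := pos_of_mul_pos_right hp (by linarith)
      obtain ⟨c, hc1, hc2, hc3⟩ : ∃ c, t n ≤ c ∧ c < τ ∧ q.eval c = 0 := by
        by_cases hn : n ∈ W
        · refine ⟨t n, le_rfl, by linarith, ?_⟩
          have := hkn.2.2 hn
          exact (mul_eq_zero.1 this).resolve_left (by linarith)
        · have h1 : (t n - t (n + 1)) * q.eval (t n) ≠ 0 := fun h' => hn (hkn.2.1 h')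
          have h2 : q.eval (t n) ≤ 0 := by
            by_contra h'
            push Not at h'
            have := mul_neg_of_neg_of_pos (show t n - t (n + 1) < 0 by linarith) h'
            linarith [hkn.1]
          obtain ⟨c, hc, hc'⟩ := intermediate_value_Icc (show t n ≤ τ by linarith)
            q.continuous.continuousOn ⟨h2, hq.le⟩
          refine ⟨c, hc.1, lt_of_le_of_ne hc.2 ?_, hc'⟩
          rintro rfl
          exact hq.ne' hc'
      obtain ⟨r, rfl⟩ := dvd_iff_isRoot.2 hc3
      simp only [eval_mul, eval_sub, eval_X, eval_C] at hq
      have hr : 0 < r.eval τ := pos_of_mul_pos_right hq (by linarith)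
      have hr0 : r ≠ 0 := by
        rintro rfl
        simp at hr
      have ih := ballCost_le_natDegree W (n := n) (fun i j hij hj => ht i j hij (by omega))
        (τ := τ) (fun i hi => hτ i (by omega)) hr (fun k hk' => by
          have h1 := hk k (by omega)
          have h2 : t k < t n := ht k n hk' (by omega)
          have h3 : 0 < (t k - t (n + 1)) * (t k - c) :=
            mul_pos_of_neg_of_neg (by linarith) (by linarith)
          simp only [eval_mul, eval_sub, eval_X, eval_C, ← mul_assoc] at h1
          rw [mul_eq_zero, or_iff_right h3.ne'] at h1
          exact ⟨nonneg_of_mul_nonneg_right h1.1 h3, h1.2⟩)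
      rw [natDegree_mul (X_sub_C_ne_zero _) (mul_ne_zero (X_sub_C_ne_zero _) hr0),
        natDegree_mul (X_sub_C_ne_zero _) hr0, natDegree_X_sub_C, natDegree_X_sub_C]
      omega
    · have h1 := hk (n + 1) (by omega)
      exact ballCost_le_natDegree W (fun i j hij hj => ht i j hij (by omega))
        (τ := t (n + 1)) (fun i hi => ht i (n + 1) hi (by omega))
        (lt_of_le_of_ne h1.1 fun h' => h (h1.2.1 h'.symm)) (fun k hk' => hk k (by omega))

/-- No sign is prescribed to the right of the last point, so a zero there costs only the factor t n
- X. If the last point is not a zero, the polynomial must be positive there, which is the ball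
problem with τ = t n. -/
theorem exists_polynomial_natDegree_le_sphereCost {t : ℕ → ℝ} (W : Finset ℕ) : ∀ {n : ℕ},
    (∀ i j, i < j → j < n → t i < t j) →
    ∃ p : ℝ[X], p.natDegree ≤ sphereCost W n ∧
      ∀ k < n, 0 ≤ p.eval (t k) ∧ (p.eval (t k) = 0 ↔ k ∈ W)
  | 0, _ => ⟨1, by simp, by simp⟩
  | n + 1, ht => by
    rw [sphereCost]
    split_ifs with h
    · obtain ⟨p, hp1, hp2⟩ := exists_polynomial_natDegree_le_sphereCost W (n := n)
        (fun i j hij hj => ht i j hij (by omega))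
      refine ⟨(C (t n) - X) * p, natDegree_mul_le.trans (add_le_add ?_ hp1), fun k hk => ?_⟩
      · rw [← neg_sub, natDegree_neg, natDegree_X_sub_C]
      · simp only [eval_mul, eval_sub, eval_X, eval_C]
        rcases Nat.lt_succ_iff_lt_or_eq.1 hk with hk' | rfl
        · have h1 : 0 < t n - t k := sub_pos.2 (ht k n hk' (by omega))
          refine ⟨mul_nonneg h1.le (hp2 k hk').1, ?_⟩
          rw [mul_eq_zero, or_iff_right h1.ne', (hp2 k hk').2]
        · simp [h]
    · obtain ⟨p, hp1, hp2, hp3⟩ := exists_polynomial_natDegree_le_ballCost W (n := n)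
        (fun i j hij hj => ht i j hij (by omega)) (τ := t n) (fun i hi => ht i n hi (by omega))
      refine ⟨p, hp1, fun k hk => ?_⟩
      rcases Nat.lt_succ_iff_lt_or_eq.1 hk with hk' | rfl
      · exact hp3 k hk'
      · have := hp2 _ le_rfl
        exact ⟨this.le, by simp [h, this.ne']⟩

theorem sphereCost_le_natDegree {t : ℕ → ℝ} (W : Finset ℕ) : ∀ {n : ℕ},
    (∀ i j, i < j → j < n → t i < t j) → ∀ {p : ℝ[X]}, p ≠ 0 →
    (∀ k < n, 0 ≤ p.eval (t k) ∧ (p.eval (t k) = 0 ↔ k ∈ W)) → sphereCost W n ≤ p.natDegree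
  | 0, _, _, _, _ => by simp [sphereCost]
  | n + 1, ht, p, hp, hk => by
    rw [sphereCost]
    split_ifs with h
    · obtain ⟨q, rfl⟩ := dvd_iff_isRoot.2 ((hk n (by omega)).2.2 h)
      have hq : q ≠ 0 := right_ne_zero_of_mul hp
      have ih := sphereCost_le_natDegree W (n := n) (fun i j hij hj => ht i j hij (by omega))
        (p := -q) (neg_ne_zero.2 hq) (fun k hk' => by
          have h1 := hk k (by omega)
          have h2 : t k - t n < 0 := sub_neg.2 (ht k n hk' (by omega))
          simp only [eval_mul, eval_sub, eval_X, eval_C] at h1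
          rw [mul_eq_zero, or_iff_right h2.ne] at h1
          rw [eval_neg, neg_eq_zero, neg_nonneg]
          exact ⟨nonpos_of_mul_nonneg_right h1.1 h2, h1.2⟩)
      rw [natDegree_mul (X_sub_C_ne_zero _) hq, natDegree_X_sub_C]
      rwa [natDegree_neg, ← add_le_add_iff_left 1] at ih
    · have h1 := hk n (by omega)
      exact ballCost_le_natDegree W (fun i j hij hj => ht i j hij (by omega))
        (τ := t n) (fun i hi => ht i n hi (by omega))
        (lt_of_le_of_ne h1.1 fun h' => h (h1.2.1 h'.symm)) (fun k hk' => hk k (by omega))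

/-- Polynomials of degree at most d are affine functionals restricted to the moment curve;
`exists_polynomial_eval_eq` gives the converse. -/
theorem eval_eq_sum_momentCurve {d : ℕ} {p : ℝ[X]} (hp : p.natDegree ≤ d) (t : ℝ) :
    p.eval t = p.coeff 0 + ∑ i : Fin d, p.coeff (i + 1) * momentCurve d t i := by
  rw [eval_eq_sum_range' (Nat.lt_succ_of_le hp), Finset.sum_range_succ', add_comm,
    Finset.sum_range]
  simp [momentCurve]

theorem sum_mul_eval_eq_zero {ι : Type*} {d : ℕ} {s : Finset ι} {w t : ι → ℝ}
    (h0 : ∑ k ∈ s, w k = 0) (h1 : ∑ k ∈ s, w k • momentCurve d (t k) = 0) {p : ℝ[X]}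
    (hp : p.natDegree ≤ d) : ∑ k ∈ s, w k * p.eval (t k) = 0 := by
  simp only [eval_eq_sum_momentCurve hp, mul_add, Finset.sum_add_distrib, Finset.mul_sum]
  rw [← Finset.sum_mul, h0, zero_mul, zero_add, Finset.sum_comm]
  refine Finset.sum_eq_zero fun i _ => ?_
  have := congrFun h1 i
  simp only [Finset.sum_apply, Pi.smul_apply, smul_eq_mul, Pi.zero_apply] at this
  rw [← mul_zero (p.coeff (i + 1)), ← this, Finset.mul_sum]
  exact Finset.sum_congr rfl fun k _ => by ring

/-- Test an affine dependence against the product of X - t j over all indices j but one. Its degree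
is at most d, so the dependence annihilates it, and only one weight survives. -/
theorem affineIndependent_momentCurve {ι : Type*} [Fintype ι] {d : ℕ} {t : ι → ℝ}
    (ht : Function.Injective t) (hc : Fintype.card ι ≤ d + 1) :
    AffineIndependent ℝ fun k => momentCurve d (t k) := by
  classical
  rw [affineIndependent_iff]
  intro s w h0 h1 k hk
  have hdeg : (∏ j ∈ s.erase k, (X - C (t j))).natDegree ≤ d := by
    rw [natDegree_prod_of_monic _ _ fun j _ => monic_X_sub_C _]
    simp only [natDegree_X_sub_C, Finset.sum_const, smul_eq_mul, mul_one]
    rw [Finset.card_erase_of_mem hk]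
    have := Finset.card_le_univ s
    omega
  have h2 := sum_mul_eval_eq_zero h0 h1 hdeg
  rw [Finset.sum_eq_single k] at h2
  · refine (mul_eq_zero.1 h2).resolve_right ?_
    rw [eval_prod]
    refine Finset.prod_ne_zero_iff.2 ?_
    intro j hj h'
    rw [eval_sub, eval_X, eval_C, sub_eq_zero] at h'
    exact (Finset.mem_erase.1 hj).1 (ht h').symm
  · intro j hj hjk
    rw [eval_prod, Finset.prod_eq_zero (Finset.mem_erase.2 ⟨hjk, hj⟩), mul_zero]
    simp
  · exact fun h' => absurd hk h'

theorem finrank_vectorSpan_momentCurve {d : ℕ} {t : ℕ → ℝ} {W : Finset ℕ}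
    (ht : Set.InjOn t W) (hW : W.Nonempty) (hc : W.card ≤ d + 1) :
    Module.finrank ℝ (vectorSpan ℝ ((fun k => momentCurve d (t k)) '' (W : Set ℕ))) =
      W.card - 1 := by
  have h1 : AffineIndependent ℝ fun k : W => momentCurve d (t k) :=
    affineIndependent_momentCurve (ht.injective) (by simpa using hc)
  have h2 := h1.finrank_vectorSpan (n := W.card - 1) (by
    have := hW.card_pos
    simp only [Fintype.card_coe]
    omega)
  rw [← h2, Set.image_eq_range]
  rfl

theorem vectorSpan_convexHull_eq {E : Type*} [AddCommGroup E] [Module ℝ E] (s : Set E) :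
    vectorSpan ℝ (convexHull ℝ s) = vectorSpan ℝ s := by
  rw [← direction_affineSpan, affineSpan_convexHull, direction_affineSpan]

/-- In a convex combination on which the functional attains its maximum, the points with a smaller
value must have weight zero. -/
theorem setOf_isMax_convexHull {E : Type*} [AddCommGroup E] [Module ℝ E] (S : Finset E)
    (l : E →ₗ[ℝ] ℝ) {M : ℝ} (hle : ∀ x ∈ S, l x ≤ M) (hM : ∃ x ∈ S, l x = M) :
    {y ∈ convexHull ℝ (S : Set E) | ∀ z ∈ convexHull ℝ (S : Set E), l z ≤ l y} =
      convexHull ℝ {x | x ∈ S ∧ l x = M} := by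
  classical
  have hle' : ∀ z ∈ convexHull ℝ (S : Set E), l z ≤ M := fun z hz =>
    convexHull_min (t := {z | l z ≤ M}) hle (convex_halfSpace_le l.isLinear M) hz
  ext y
  constructor
  · rintro ⟨hy, hmax⟩
    have hyM : l y = M := by
      obtain ⟨x, hx, hxM⟩ := hM
      exact le_antisymm (hle' y hy) (hxM ▸ hmax x (subset_convexHull ℝ _ hx))
    obtain ⟨w, hw0, hw1, rfl⟩ := Finset.mem_convexHull'.1 hy
    have hz : ∀ x ∈ S, l x ≠ M → w x = 0 := by
      have h1 : ∑ x ∈ S, w x * (M - l x) = 0 := by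
        simp only [mul_sub, Finset.sum_sub_distrib, ← Finset.sum_mul, hw1]
        rw [map_sum] at hyM
        simp only [map_smul, smul_eq_mul] at hyM
        linarith
      have h2 := (Finset.sum_eq_zero_iff_of_nonneg fun x hx =>
        mul_nonneg (hw0 x hx) (sub_nonneg.2 (hle x hx))).1 h1
      intro x hx hxM
      exact (mul_eq_zero.1 (h2 x hx)).resolve_right (sub_ne_zero.2 hxM.symm)
    rw [← Finset.sum_filter_of_ne (p := fun x => l x = M)] at hw1 ⊢
    · exact (convex_convexHull ℝ _).sum_mem (fun x hx => hw0 x (Finset.mem_filter.1 hx).1) hw1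
        fun x hx => subset_convexHull ℝ _ (Finset.mem_filter.1 hx)
    · intro x hx h
      by_contra h'
      exact h (by rw [hz x hx h', zero_smul])
    · intro x hx h
      by_contra h'
      exact h (hz x hx h')
  · intro hy
    have hyM : l y = M := convexHull_min (t := {z | l z = M}) (fun x hx => hx.2)
      (convex_hyperplane l.isLinear M) hy
    exact ⟨convexHull_mono (fun x hx => hx.1) hy, fun z hz => (hle' z hz).trans hyM.ge⟩

/-- The functional whose value at a point of the moment curve is `p(0) - p(t)`. -/
noncomputable def coeffFunctional (d : ℕ) (p : ℝ[X]) : StrongDual ℝ (Fin d → ℝ) :=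
  -∑ i : Fin d, p.coeff (i + 1) • ContinuousLinearMap.proj (R := ℝ) i

theorem coeffFunctional_momentCurve {d : ℕ} {p : ℝ[X]} (hp : p.natDegree ≤ d) (t : ℝ) :
    coeffFunctional d p (momentCurve d t) = p.coeff 0 - p.eval t := by
  rw [eval_eq_sum_momentCurve hp]
  simp [coeffFunctional]

theorem exists_polynomial_eval_eq {d : ℕ} (l : StrongDual ℝ (Fin d → ℝ)) (M : ℝ) :
    ∃ p : ℝ[X], p.natDegree ≤ d ∧ ∀ t, p.eval t = M - l (momentCurve d t) := by
  refine ⟨C M - ∑ i : Fin d, C (l (Pi.single i 1)) * X ^ ((i : ℕ) + 1), ?_, fun t => ?_⟩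
  · refine (natDegree_sub_le _ _).trans (max_le (by simp) ?_)
    refine natDegree_sum_le_of_forall_le _ _ fun i _ => ?_
    exact (natDegree_C_mul_X_pow_le _ _).trans i.2
  · have h1 : momentCurve d t = ∑ i : Fin d, (t ^ ((i : ℕ) + 1)) • Pi.single i (1 : ℝ) := by
      ext j
      simp [momentCurve, Finset.sum_apply, Pi.single_apply]
    rw [h1, map_sum]
    simp only [eval_sub, eval_C, eval_finsetSum, eval_mul, eval_pow, eval_X, map_smul, smul_eq_mul]
    congr 1
    exact Finset.sum_congr rfl fun i _ => mul_comm _ _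

section Faces

variable {d n : ℕ} {t : ℕ → ℝ}

theorem setOf_isMax_momentCurve {W : Finset ℕ} (hW : W ⊆ Finset.range n)
    (hne : W.Nonempty) (l : StrongDual ℝ (Fin d → ℝ)) {M : ℝ}
    (hl : ∀ k < n, l (momentCurve d (t k)) ≤ M ∧ (l (momentCurve d (t k)) = M ↔ k ∈ W)) :
    {y ∈ convexHull ℝ ((fun k => momentCurve d (t k)) '' (Finset.range n : Set ℕ)) |
        ∀ z ∈ convexHull ℝ ((fun k => momentCurve d (t k)) '' (Finset.range n : Set ℕ)),
          l z ≤ l y} =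
      convexHull ℝ ((fun k => momentCurve d (t k)) '' (W : Set ℕ)) := by
  classical
  have h := setOf_isMax_convexHull ((Finset.range n).image fun k => momentCurve d (t k))
    l.toLinearMap (M := M) (by
      intro x hx
      obtain ⟨k, hk, rfl⟩ := Finset.mem_image.1 hx
      exact (hl k (Finset.mem_range.1 hk)).1) (by
      obtain ⟨k, hk⟩ := hne
      exact ⟨_, Finset.mem_image_of_mem _ (hW hk),
        (hl k (Finset.mem_range.1 (hW hk))).2.2 hk⟩)
  rw [Finset.coe_image] at h
  refine h.trans (congrArg _ ?_)
  ext x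
  simp only [Finset.mem_image, Set.mem_ofPred_eq, Set.mem_image, Finset.mem_coe]
  constructor
  · rintro ⟨⟨k, hk, rfl⟩, hx⟩
    exact ⟨k, (hl k (Finset.mem_range.1 hk)).2.1 hx, rfl⟩
  · rintro ⟨k, hk, rfl⟩
    exact ⟨⟨k, hW hk, rfl⟩, (hl k (Finset.mem_range.1 (hW hk))).2.2 hk⟩

theorem exists_functional_of_sphereCost_le (ht : ∀ i j, i < j → j < n → t i < t j)
    {W : Finset ℕ} (hW : sphereCost W n ≤ d) :
    ∃ (l : StrongDual ℝ (Fin d → ℝ)) (M : ℝ),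
      ∀ k < n, l (momentCurve d (t k)) ≤ M ∧ (l (momentCurve d (t k)) = M ↔ k ∈ W) := by
  obtain ⟨p, hp1, hp2⟩ := exists_polynomial_natDegree_le_sphereCost W ht
  refine ⟨coeffFunctional d p, p.coeff 0, fun k hk => ?_⟩
  rw [coeffFunctional_momentCurve (hp1.trans hW), ← (hp2 k hk).2]
  exact ⟨by linarith [(hp2 k hk).1], by constructor <;> intro h <;> linarith⟩

/-- Faces correspond to index sets W through the convex hull of the points indexed by W. A
supporting functional with maximum M becomes the polynomial M - l on the curve, and affine
independence turns dimension s into s+1 vertices. -/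
theorem polytopeFNumber_momentCurve (ht : ∀ i j, i < j → j < n → t i < t j) (hn : d < n) {s : ℕ}
    (hs : s < d) :
    polytopeFNumber (convexHull ℝ ((fun k => momentCurve d (t k)) '' (Finset.range n : Set ℕ))) s =
      galeCount n d (s + 1) := by
  classical
  have htinj : ∀ W ⊆ Finset.range n, Set.InjOn t W := by
    intro W hW i hi j hj hij
    have hi' := Finset.mem_range.1 (hW hi)
    have hj' := Finset.mem_range.1 (hW hj)
    rcases lt_trichotomy i j with h | h | h
    · exact absurd hij (ht i j h hj').ne
    · exact h
    · exact absurd hij (ht j i h hi').ne'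
  set Φ : Finset ℕ → Set (Fin d → ℝ) := fun W =>
    convexHull ℝ ((fun k => momentCurve d (t k)) '' (W : Set ℕ)) with hΦ
  set A := (Finset.range n).powerset.filter fun W => W.card = s + 1 ∧ sphereCost W n ≤ d with hA
  have hmem : ∀ W ∈ A, W ⊆ Finset.range n ∧ W.card = s + 1 ∧ sphereCost W n ≤ d := by
    intro W hW
    rw [hA, Finset.mem_filter, Finset.mem_powerset] at hW
    exact hW
  have hinj : Set.InjOn Φ (A : Set (Finset ℕ)) := by
    -- The functional exposing the face of W separates it from all other points, so W is recovered
    -- as the set of indices whose points lie in the face.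
    have key : ∀ W ∈ A, ∀ k < n, momentCurve d (t k) ∈ Φ W → k ∈ W := by
      intro W hW k hk hx
      obtain ⟨l, M, hl⟩ := exists_functional_of_sphereCost_le ht (hmem W hW).2.2
      have h1 : Φ W ⊆ {x | l x = M} := convexHull_min (by
        rintro _ ⟨k, hk, rfl⟩
        exact (hl k (Finset.mem_range.1 ((hmem W hW).1 hk))).2.2 hk)
        (convex_hyperplane l.toLinearMap.isLinear M)
      exact (hl k hk).2.1 (h1 hx)
    have key' : ∀ W ∈ A, ∀ W' ∈ A, Φ W = Φ W' → W ⊆ W' := by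
      intro W hW W' hW' h k hk
      refine key W' hW' k (Finset.mem_range.1 ((hmem W hW).1 hk)) (h ▸ ?_)
      exact subset_convexHull ℝ _ ⟨k, hk, rfl⟩
    intro W hW W' hW' h
    exact Finset.Subset.antisymm (key' W hW W' hW' h) (key' W' hW' W hW h.symm)
  have himage : {F : Set (Fin d → ℝ) | F.Nonempty ∧ IsExposed ℝ (convexHull ℝ
      ((fun k => momentCurve d (t k)) '' (Finset.range n : Set ℕ))) F ∧
      Module.finrank ℝ (vectorSpan ℝ F) = s} = Φ '' (A : Set (Finset ℕ)) := by
    ext F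
    constructor
    · rintro ⟨hF, hexp, hrank⟩
      obtain ⟨l, rfl⟩ := hexp hF
      obtain ⟨k₀, hk₀, hmax⟩ := Finset.exists_max_image (Finset.range n)
        (fun k => l (momentCurve d (t k))) ⟨0, Finset.mem_range.2 (by omega)⟩
      set M := l (momentCurve d (t k₀)) with hM
      set W := (Finset.range n).filter fun k => l (momentCurve d (t k)) = M with hW
      have hWn : W ⊆ Finset.range n := Finset.filter_subset _ _
      have hWne : W.Nonempty := ⟨k₀, Finset.mem_filter.2 ⟨hk₀, rfl⟩⟩
      have hl : ∀ k < n, l (momentCurve d (t k)) ≤ M ∧ (l (momentCurve d (t k)) = M ↔ k ∈ W) :=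
        fun k hk => ⟨hmax k (Finset.mem_range.2 hk), by simp [hW, hk]⟩
      rw [setOf_isMax_momentCurve hWn hWne l hl, vectorSpan_convexHull_eq] at hrank
      rw [setOf_isMax_momentCurve hWn hWne l hl]
      have hcard : W.card = s + 1 := by
        have hpos := hWne.card_pos
        rcases le_or_gt W.card (d + 1) with h | h
        · rw [finrank_vectorSpan_momentCurve (htinj W hWn) hWne h] at hrank
          omega
        -- Any d+1 of the points already span dimension d, which exceeds s.
        · obtain ⟨W', hW', hc'⟩ := Finset.exists_subset_card_eq h.le
          have h1 := finrank_vectorSpan_momentCurve (d := d) (htinj W' (hW'.trans hWn))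
            (Finset.card_pos.1 (by omega)) hc'.le
          have h2 := Submodule.finrank_mono (vectorSpan_mono ℝ
            (Set.image_mono (f := fun k => momentCurve d (t k)) (Finset.coe_subset.2 hW')))
          omega
      refine ⟨W, ?_, rfl⟩
      rw [Finset.mem_coe, hA, Finset.mem_filter, Finset.mem_powerset]
      refine ⟨hWn, hcard, ?_⟩
      obtain ⟨p, hp1, hp2⟩ := exists_polynomial_eval_eq l M
      refine (sphereCost_le_natDegree W ht (p := p) ?_ fun k hk => ?_).trans hp1
      -- A zero polynomial would put all n points on the face, but it carries s+1 ≤ d < n of them.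
      · rintro rfl
        have : Finset.range n ⊆ W := fun k hk => by
          have := hp2 (t k)
          rw [eval_zero] at this
          exact (hl k (Finset.mem_range.1 hk)).2.1 (by linarith)
        have := Finset.card_le_card this
        rw [Finset.card_range] at this
        omega
      · rw [hp2, ← (hl k hk).2]
        exact ⟨by linarith [(hl k hk).1], by constructor <;> intro h <;> linarith⟩
    · rintro ⟨W, hW, rfl⟩
      obtain ⟨h1, h2, h3⟩ := hmem W hW
      have hne : W.Nonempty := Finset.card_pos.1 (by omega)
      obtain ⟨l, M, hl⟩ := exists_functional_of_sphereCost_le ht h3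
      refine ⟨?_, fun _ => ⟨l, (setOf_isMax_momentCurve h1 hne l hl).symm⟩, ?_⟩
      · obtain ⟨k, hk⟩ := hne
        exact ⟨_, subset_convexHull ℝ _ ⟨k, hk, rfl⟩⟩
      · rw [hΦ, vectorSpan_convexHull_eq, finrank_vectorSpan_momentCurve (htinj W h1) hne (by omega)]
        omega
  rw [polytopeFNumber, himage, hinj.ncard_image, Set.ncard_coe_finset, galeCount]

end Faces

theorem polytopeFNumber_cyclicPolytope {d n : ℕ} {t : Fin n → ℝ} (ht : StrictMono t) (hn : d < n)
    {s : ℕ} (hs : s < d) :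
    polytopeFNumber (cyclicPolytope d t) s = galeCount n d (s + 1) := by
  -- The parameters are extended to all natural numbers by the irrelevant value 0; only indices
  -- below n are ever used.
  rw [← polytopeFNumber_momentCurve (t := fun k => if h : k < n then t ⟨k, h⟩ else 0) ?_ hn hs]
  · congr 1
    rw [cyclicPolytope]
    congr 1
    ext x
    simp only [Set.mem_range, Set.mem_image, Finset.coe_range, Set.mem_Iio]
    constructor
    · rintro ⟨k, rfl⟩
      exact ⟨k, k.2, by simp⟩
    · rintro ⟨k, hk, rfl⟩
      exact ⟨⟨k, hk⟩, by simp [hk]⟩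
  · intro i j hij hj
    simp only [hj, hij.trans hj, dif_pos]
    exact ht hij

end MomentCurve

/-! ### Contractions of truncated complexes and change of coefficients -/

section Contraction

variable {ι R k : Type*} [CommRing R] [CommRing k]

theorem forall_mem_supported {S : Set ι} (p : Submodule R (ι →₀ R))
    (h : ∀ x ∈ S, Finsupp.single x 1 ∈ p) : Finsupp.supported R R S ≤ p := by
  rw [Finsupp.supported_eq_span_single, Submodule.span_le]
  rintro _ ⟨x, hx, rfl⟩
  exact h x hx

/-- Freeness of the chain modules allows a contracting homotopy to be chosen on basis elements, one
degree at a time. Unlike exactness, such a homotopy survives any change of coefficients. -/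
theorem exists_contraction (D : (ι →₀ R) →ₗ[R] (ι →₀ R)) (S : ℕ → Set ι)
    (hS : ∀ i j x, x ∈ S i → x ∈ S j → i = j)
    (hD : ∀ j, ∀ c ∈ Finsupp.supported R R (S (j + 1)), D c ∈ Finsupp.supported R R (S j))
    (hD0 : ∀ c ∈ Finsupp.supported R R (S 0), D c = 0) (hDD : ∀ c, D (D c) = 0) (d : ℕ)
    (hex : ∀ j < d, ∀ c ∈ Finsupp.supported R R (S j), D c = 0 →
      ∃ b ∈ Finsupp.supported R R (S (j + 1)), D b = c) :
    ∃ s : (ι →₀ R) →ₗ[R] (ι →₀ R), ∀ j < d, ∀ c ∈ Finsupp.supported R R (S j),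
      s c ∈ Finsupp.supported R R (S (j + 1)) ∧ D (s c) + s (D c) = c := by
  classical
  induction d with
  | zero => exact ⟨0, fun j hj => absurd hj (by omega)⟩
  | succ d ih =>
    obtain ⟨s, hs⟩ := ih fun j hj => hex j (by omega)
    have hstep : ∀ x : ι, ∃ b : ι →₀ R, x ∈ S d →
        b ∈ Finsupp.supported R R (S (d + 1)) ∧
          D b + s (D (Finsupp.single x 1)) = Finsupp.single x 1 := by
      intro x
      by_cases hx : x ∈ S d
      · have hx1 : Finsupp.single x (1 : R) ∈ Finsupp.supported R R (S d) :=
          Finsupp.single_mem_supported R 1 hx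
        -- The part of x not yet reached by the homotopy is a cycle: D(sDx) = Dx by the previous
        -- degree and D² = 0. In degree zero Dx itself vanishes.
        have hy : Finsupp.single x 1 - s (D (Finsupp.single x 1)) ∈
            Finsupp.supported R R (S d) ∧
            D (Finsupp.single x 1 - s (D (Finsupp.single x 1))) = 0 := by
          rcases Nat.eq_zero_or_pos d with rfl | hd
          · rw [hD0 _ hx1, map_zero, sub_zero]
            exact ⟨hx1, hD0 _ hx1⟩
          · obtain ⟨e, rfl⟩ : ∃ e, d = e + 1 := ⟨d - 1, by omega⟩
            obtain ⟨h1, h2⟩ := hs e (by omega) _ (hD e _ hx1)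
            rw [hDD, map_zero, add_zero] at h2
            exact ⟨sub_mem hx1 h1, by rw [map_sub, h2, sub_self]⟩
        obtain ⟨b, hb1, hb2⟩ := hex d (by omega) _ hy.1 hy.2
        exact ⟨b, fun _ => ⟨hb1, by rw [hb2, sub_add_cancel]⟩⟩
      · exact ⟨0, fun h => absurd h hx⟩
    choose b hb using hstep
    let s' : (ι →₀ R) →ₗ[R] (ι →₀ R) := Finsupp.linearCombination R fun x =>
      if x ∈ S d then b x else s (Finsupp.single x 1)
    have hs'd : ∀ x ∈ S d, s' (Finsupp.single x 1) = b x := fun x hx => by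
      simp [s', hx]
    have hs's : ∀ j, j ≠ d → ∀ c ∈ Finsupp.supported R R (S j), s' c = s c := by
      intro j hj c hc
      refine forall_mem_supported (LinearMap.eqLocus s' s) (fun x hx => ?_) hc
      have : x ∉ S d := fun h => hj (hS _ _ _ hx h)
      simp [LinearMap.mem_eqLocus, s', this]
    have hs'D : ∀ c ∈ Finsupp.supported R R (S d), s' (D c) = s (D c) := by
      intro c hc
      rcases Nat.eq_zero_or_pos d with rfl | hd
      · rw [hD0 c hc, map_zero, map_zero]
      · obtain ⟨e, rfl⟩ : ∃ e, d = e + 1 := ⟨d - 1, by omega⟩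
        exact hs's e (by omega) _ (hD e c hc)
    refine ⟨s', fun j hj c hc => ?_⟩
    rcases Nat.lt_succ_iff_lt_or_eq.1 hj with hjd | rfl
    · rw [hs's j hjd.ne c hc]
      have h1 := hs j hjd c hc
      refine ⟨h1.1, ?_⟩
      rcases Nat.eq_zero_or_pos j with rfl | hj0
      · rw [hD0 c hc, map_zero]
        rw [hD0 c hc, map_zero] at h1
        exact h1.2
      · obtain ⟨e, rfl⟩ : ∃ e, j = e + 1 := ⟨j - 1, by omega⟩
        rw [hs's e (by omega) _ (hD e c hc)]
        exact h1.2
    · constructor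
      · refine forall_mem_supported
          ((Finsupp.supported R R (S (j + 1))).comap s') (fun x hx => ?_) hc
        rw [Submodule.mem_comap, hs'd x hx]
        exact (hb x hx).1
      · refine forall_mem_supported
          (LinearMap.eqLocus (D.comp s' + s'.comp D) LinearMap.id) (fun x hx => ?_) hc
        simp only [LinearMap.mem_eqLocus, LinearMap.add_apply, LinearMap.comp_apply,
          LinearMap.id_apply]
        rw [hs'd x hx, hs'D _ (Finsupp.single_mem_supported R 1 hx)]
        exact (hb x hx).2

/-- Extension of scalars for finitely supported functions. -/
noncomputable def mapCoeff (ι : Type*) (f : R →+* k) : (ι →₀ R) →+ (ι →₀ k) :=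
  Finsupp.mapRange.addMonoidHom f.toAddMonoidHom

theorem mapCoeff_apply (f : R →+* k) (c : ι →₀ R) (x : ι) : mapCoeff ι f c x = f (c x) := rfl

theorem mapCoeff_single (f : R →+* k) (x : ι) (r : R) :
    mapCoeff ι f (Finsupp.single x r) = Finsupp.single x (f r) :=
  Finsupp.mapRange_single (hf := f.map_zero)

theorem mapCoeff_smul (f : R →+* k) (r : R) (c : ι →₀ R) :
    mapCoeff ι f (r • c) = f r • mapCoeff ι f c := by
  ext x
  simp [mapCoeff_apply]

theorem mapCoeff_mem_supported (f : R →+* k) {S : Set ι} {c : ι →₀ R}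
    (hc : c ∈ Finsupp.supported R R S) : mapCoeff ι f c ∈ Finsupp.supported k k S := by
  rw [Finsupp.mem_supported'] at hc ⊢
  intro x hx
  rw [mapCoeff_apply, hc x hx, map_zero]

theorem map_mapCoeff (f : R →+* k) {D : (ι →₀ R) →ₗ[R] (ι →₀ R)}
    {D' : (ι →₀ k) →ₗ[k] (ι →₀ k)}
    (h : ∀ x, D' (Finsupp.single x 1) = mapCoeff ι f (D (Finsupp.single x 1))) (c : ι →₀ R) :
    D' (mapCoeff ι f c) = mapCoeff ι f (D c) := by
  induction c using Finsupp.induction_linear with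
  | zero => simp
  | add a b ha hb => simp only [map_add, ha, hb]
  | single x r =>
    have : Finsupp.single x r = r • Finsupp.single x (1 : R) := by simp
    rw [this, mapCoeff_smul, mapCoeff_single, map_one, map_smul, map_smul, mapCoeff_smul, h]

variable {D : (ι →₀ R) →ₗ[R] (ι →₀ R)} {D' : (ι →₀ k) →ₗ[k] (ι →₀ k)} {S : ℕ → Set ι}
  {s : (ι →₀ R) →ₗ[R] (ι →₀ R)} {d : ℕ}

theorem exists_contraction_mapCoeff (f : R →+* k)
    (h : ∀ x, D' (Finsupp.single x 1) = mapCoeff ι f (D (Finsupp.single x 1)))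
    (hs : ∀ j < d, ∀ c ∈ Finsupp.supported R R (S j),
      s c ∈ Finsupp.supported R R (S (j + 1)) ∧ D (s c) + s (D c) = c) :
    ∃ s' : (ι →₀ k) →ₗ[k] (ι →₀ k),
      (∀ x, s' (Finsupp.single x 1) = mapCoeff ι f (s (Finsupp.single x 1))) ∧
      ∀ j < d, ∀ c ∈ Finsupp.supported k k (S j),
        s' c ∈ Finsupp.supported k k (S (j + 1)) ∧ D' (s' c) + s' (D' c) = c := by
  let s' : (ι →₀ k) →ₗ[k] (ι →₀ k) := Finsupp.linearCombination k fun x =>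
    mapCoeff ι f (s (Finsupp.single x 1))
  have hs' : ∀ x, s' (Finsupp.single x 1) = mapCoeff ι f (s (Finsupp.single x 1)) := fun x => by
    simp [s']
  refine ⟨s', hs', fun j hj c hc => ⟨?_, ?_⟩⟩
  · refine forall_mem_supported ((Finsupp.supported k k (S (j + 1))).comap s') (fun x hx => ?_) hc
    rw [Submodule.mem_comap, hs' x]
    exact mapCoeff_mem_supported f (hs j hj _ (Finsupp.single_mem_supported R 1 hx)).1
  · refine forall_mem_supported
      (LinearMap.eqLocus (D'.comp s' + s'.comp D') LinearMap.id) (fun x hx => ?_) hc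
    simp only [LinearMap.mem_eqLocus, LinearMap.add_apply, LinearMap.comp_apply,
      LinearMap.id_apply]
    rw [hs', h, map_mapCoeff f h, map_mapCoeff f hs', ← map_add,
      (hs j hj _ (Finsupp.single_mem_supported R 1 hx)).2, mapCoeff_single, map_one]

/-- A free rank one module of top cycles stays so after a change of coefficients. -/
theorem top_cycles_mapCoeff [Nontrivial k] (f : R →+* k)
    (h : ∀ x, D' (Finsupp.single x 1) = mapCoeff ι f (D (Finsupp.single x 1)))
    (hD : ∀ c ∈ Finsupp.supported R R (S (d + 1)), D c ∈ Finsupp.supported R R (S d))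
    (hDD : ∀ c, D (D c) = 0)
    (hs : ∀ j < d + 1, ∀ c ∈ Finsupp.supported R R (S j),
      s c ∈ Finsupp.supported R R (S (j + 1)) ∧ D (s c) + s (D c) = c) {z : ι →₀ R}
    (hz : z ∈ Finsupp.supported R R (S (d + 1))) (hz0 : D z = 0)
    (hgen : ∀ c ∈ Finsupp.supported R R (S (d + 1)), D c = 0 → ∃ r : R, c = r • z)
    (hfree : ∀ r : R, r • z = 0 → r = 0) :
    mapCoeff ι f z ≠ 0 ∧ ∀ c ∈ Finsupp.supported k k (S (d + 1)), D' c = 0 →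
      ∃ r : k, c = r • mapCoeff ι f z := by
  obtain ⟨s', hs'1, -⟩ := exists_contraction_mapCoeff f h hs
  -- In top degree id - sD maps to cycles, hence to multiples of z; the scalars on basis elements
  -- define a functional a with c - sDc = a(c) z.
  have hcoef : ∀ x : ι, ∃ r : R, x ∈ S (d + 1) →
      Finsupp.single x 1 - s (D (Finsupp.single x 1)) = r • z := by
    intro x
    by_cases hx : x ∈ S (d + 1)
    · have hx1 : Finsupp.single x (1 : R) ∈ Finsupp.supported R R (S (d + 1)) :=
        Finsupp.single_mem_supported R 1 hx
      obtain ⟨h1, h2⟩ := hs d (by omega) _ (hD _ hx1)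
      rw [hDD, map_zero, add_zero] at h2
      obtain ⟨r, hr⟩ := hgen _ (sub_mem hx1 h1) (by rw [map_sub, h2, sub_self])
      exact ⟨r, fun _ => hr⟩
    · exact ⟨0, fun h' => absurd h' hx⟩
  choose a ha using hcoef
  have hproj : ∀ c ∈ Finsupp.supported R R (S (d + 1)),
      c - s (D c) = Finsupp.linearCombination R a c • z := by
    intro c hc
    refine forall_mem_supported (LinearMap.eqLocus (LinearMap.id - s.comp D)
      ((Finsupp.linearCombination R a).smulRight z)) (fun x hx => ?_) hc
    simpa [LinearMap.mem_eqLocus] using ha x hx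
  constructor
  -- Applied to z itself the projection gives a(z) = 1, so the coefficients of z generate the unit
  -- ideal and cannot all die under f.
  · intro hzero
    have h1 := hproj z hz
    rw [hz0, map_zero, sub_zero] at h1
    have h2 := hfree (1 - Finsupp.linearCombination R a z) (by
      rw [sub_smul, one_smul, ← h1, sub_self])
    have h3 : f (Finsupp.linearCombination R a z) = 0 := by
      rw [Finsupp.linearCombination_apply, Finsupp.sum, map_sum]
      refine Finset.sum_eq_zero fun x _ => ?_
      have : f (z x) = 0 := DFunLike.congr_fun hzero x
      rw [smul_eq_mul, map_mul, this, zero_mul]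
    rw [← sub_eq_zero.1 h2, map_one] at h3
    exact one_ne_zero h3
  · intro c hc hc0
    have h1 : c - s' (D' c) ∈ Submodule.span k {mapCoeff ι f z} := by
      refine forall_mem_supported ((Submodule.span k {mapCoeff ι f z}).comap
        (LinearMap.id - s'.comp D')) (fun x hx => ?_) hc
      rw [Submodule.mem_comap, LinearMap.sub_apply, LinearMap.id_apply, LinearMap.comp_apply, h,
        map_mapCoeff f hs'1]
      have := congrArg (mapCoeff ι f) (ha x hx)
      rw [map_sub, mapCoeff_single, map_one, mapCoeff_smul] at this
      rw [this]
      exact Submodule.smul_mem _ _ (Submodule.mem_span_singleton_self _)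
    rw [hc0, map_zero, sub_zero] at h1
    obtain ⟨r, hr⟩ := Submodule.mem_span_singleton.1 h1
    exact ⟨r, hr.symm⟩

end Contraction

/-! ### The complex of the faces containing a given face -/

section Star

variable {V : Type*} [LinearOrder V] (A : Type*) [CommRing A]

/-- The sign with which `F \ {v}` occurs in the boundary of `F`. -/
def boundarySign (F : Finset V) (v : V) : A := (-1) ^ (F.filter (fun w => w < v)).card

/-- The boundary map of the complex of the faces containing `G`: only vertices outside `G` are
dropped. -/
noncomputable def starBoundary (G : Finset V) : (Finset V →₀ A) →ₗ[A] (Finset V →₀ A) :=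
  Finsupp.linearCombination A fun F : Finset V =>
    ∑ v ∈ F \ G, Finsupp.single (F.erase v) (boundarySign A F v)

theorem starBoundary_empty : starBoundary A (∅ : Finset V) = simplicialBoundary A V := by
  simp [starBoundary, simplicialBoundary, boundarySign]

variable {A}

theorem boundarySign_mul_self (F : Finset V) (v : V) :
    boundarySign A F v * boundarySign A F v = 1 := by
  rw [boundarySign, ← mul_pow, neg_one_mul, neg_neg, one_pow]

theorem starBoundary_single (G F : Finset V) (a : A) :
    starBoundary A G (Finsupp.single F a) =
      ∑ v ∈ F \ G, Finsupp.single (F.erase v) (a * boundarySign A F v) := by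
  simp [starBoundary, Finset.smul_sum]

/-- Removing the smaller vertex shifts the position of the larger one by one, whereas removing the
larger leaves the position of the smaller unchanged. -/
theorem boundarySign_erase_add {F : Finset V} {v w : V} (hv : v ∈ F) (hw : w ∈ F) (hvw : v ≠ w) :
    boundarySign A F v * boundarySign A (F.erase v) w +
      boundarySign A F w * boundarySign A (F.erase w) v = 0 := by
  wlog hlt : v < w generalizing v w
  · rw [add_comm]
    exact this hw hv hvw.symm (lt_of_le_of_ne (not_lt.1 hlt) hvw.symm)
  have h1 : (F.erase w).filter (fun u => u < v) = F.filter (fun u => u < v) := by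
    ext u
    simp only [Finset.mem_filter, Finset.mem_erase]
    constructor
    · exact fun h => ⟨h.1.2, h.2⟩
    · exact fun h => ⟨⟨(h.2.trans hlt).ne, h.1⟩, h.2⟩
  have h2 : ((F.erase v).filter (fun u => u < w)).card + 1 =
      (F.filter (fun u => u < w)).card := by
    rw [Finset.filter_erase]
    exact Finset.card_erase_add_one (Finset.mem_filter.2 ⟨hv, hlt⟩)
  simp only [boundarySign, h1, ← h2, pow_succ]
  ring

theorem starBoundary_starBoundary (G : Finset V) (c : Finset V →₀ A) :
    starBoundary A G (starBoundary A G c) = 0 := by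
  induction c using Finsupp.induction_linear with
  | zero => simp
  | add a b ha hb => rw [map_add, map_add, ha, hb, add_zero]
  | single F a =>
    rw [starBoundary_single, map_sum]
    simp only [starBoundary_single]
    rw [Finset.sum_sigma']
    refine Finset.sum_involution (fun x _ => ⟨x.2, x.1⟩) ?_ ?_ ?_ ?_
    · rintro ⟨v, w⟩ h
      simp only [Finset.mem_sigma, Finset.mem_sdiff, Finset.mem_erase] at h
      rw [Finset.erase_right_comm (a := w), ← Finsupp.single_add, mul_assoc, mul_assoc, ← mul_add,
        boundarySign_erase_add h.1.1 h.2.1.2 (Ne.symm h.2.1.1), mul_zero, Finsupp.single_zero]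
    · rintro ⟨v, w⟩ h _ heq
      simp only [Finset.mem_sigma, Finset.mem_sdiff, Finset.mem_erase] at h
      simp only [Sigma.mk.injEq] at heq
      exact h.2.1.1 heq.1
    · rintro ⟨v, w⟩ h
      simp only [Finset.mem_sigma, Finset.mem_sdiff, Finset.mem_erase] at h ⊢
      exact ⟨⟨h.2.1.2, h.2.2⟩, ⟨Ne.symm h.2.1.1, h.1.1⟩, h.1.2⟩
    · rintro ⟨v, w⟩ h
      rfl

/-- The members of `L` with `j` elements that contain `G`. -/
def starFaces {V : Type*} (L : Set (Finset V)) (G : Finset V) (j : ℕ) : Set (Finset V) :=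
  {F | F ∈ L ∧ G ⊆ F ∧ F.card = j}

theorem starFaces_eq_empty {V : Type*} (L : Set (Finset V)) {G : Finset V} {j : ℕ} (h : j < G.card) :
    starFaces L G j = ∅ := by
  rw [Set.eq_empty_iff_forall_notMem]
  rintro F ⟨-, h1, h2⟩
  have := Finset.card_le_card h1
  omega

theorem starBoundary_mem_supported {L : Set (Finset V)} (hL : IsLowerSet L) (G : Finset V) (j : ℕ)
    (c : Finset V →₀ A) (hc : c ∈ Finsupp.supported A A (starFaces L G (j + 1))) :
    starBoundary A G c ∈ Finsupp.supported A A (starFaces L G j) := by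
  refine forall_mem_supported
    ((Finsupp.supported A A (starFaces L G j)).comap (starBoundary A G)) (fun F hF => ?_) hc
  rw [Submodule.mem_comap, starBoundary_single]
  refine Submodule.sum_mem _ fun v hv => Finsupp.single_mem_supported A _ ?_
  rw [Finset.mem_sdiff] at hv
  refine ⟨hL (Finset.erase_subset v F) hF.1, Finset.subset_erase.2 ⟨hF.2.1, hv.2⟩, ?_⟩
  rw [Finset.card_erase_of_mem hv.1, hF.2.2, Nat.add_sub_cancel]

theorem starBoundary_eq_zero (L : Set (Finset V)) (G : Finset V)
    (c : Finset V →₀ A) (hc : c ∈ Finsupp.supported A A (starFaces L G 0)) :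
    starBoundary A G c = 0 := by
  refine forall_mem_supported (LinearMap.ker (starBoundary A G)) (fun F hF => ?_) hc
  rw [LinearMap.mem_ker, starBoundary_single, Finset.card_eq_zero.1 hF.2.2]
  simp

theorem starBoundary_single_mapCoeff {R : Type*} [CommRing R] (f : R →+* A) (G F : Finset V) :
    starBoundary A G (Finsupp.single F 1) =
      mapCoeff (Finset V) f (starBoundary R G (Finsupp.single F 1)) := by
  rw [starBoundary_single, starBoundary_single, map_sum]
  simp only [mapCoeff_single, boundarySign, one_mul, map_pow, map_neg, map_one]

/-- The chain complexes of the stars of a complex `L` have the homology of a sphere. -/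
structure IsSphereComplex (A : Type*) [CommRing A] (L : Set (Finset V)) (d : ℕ) : Prop where
  finite : L.Finite
  isLowerSet : IsLowerSet L
  empty_mem : ∅ ∈ L
  card_le : ∀ F ∈ L, F.card ≤ d
  exact : ∀ G ∈ L, ∀ j < d, ∀ c ∈ Finsupp.supported A A (starFaces L G j),
    starBoundary A G c = 0 →
      ∃ b ∈ Finsupp.supported A A (starFaces L G (j + 1)), starBoundary A G b = c
  top : ∀ G ∈ L, ∃ z ∈ Finsupp.supported A A (starFaces L G d), starBoundary A G z = 0 ∧
    (∀ c ∈ Finsupp.supported A A (starFaces L G d), starBoundary A G c = 0 → ∃ r : A, c = r • z) ∧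
    ∀ r : A, r • z = 0 → r = 0

/-- The ring map need not be flat, so exactness is carried over by contractions. The dimension is
written d+1 because the top cycles are controlled by the homotopy one degree below. -/
theorem IsSphereComplex.map {R k : Type*} [CommRing R] [Field k] {L : Set (Finset V)} {d : ℕ}
    (h : IsSphereComplex R L (d + 1)) (f : R →+* k) : IsSphereComplex k L (d + 1) := by
  have hcontr : ∀ G ∈ L, ∃ s : (Finset V →₀ R) →ₗ[R] (Finset V →₀ R), ∀ j < d + 1,
      ∀ c ∈ Finsupp.supported R R (starFaces L G j),
        s c ∈ Finsupp.supported R R (starFaces L G (j + 1)) ∧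
          starBoundary R G (s c) + s (starBoundary R G c) = c := fun G hG =>
    exists_contraction (starBoundary R G) (starFaces L G)
      (fun i j F hi hj => hi.2.2.symm.trans hj.2.2) (starBoundary_mem_supported h.isLowerSet G)
      (starBoundary_eq_zero L G) (starBoundary_starBoundary G) (d + 1) (h.exact G hG)
  refine ⟨h.finite, h.isLowerSet, h.empty_mem, h.card_le, fun G hG j hj c hc hc0 => ?_,
    fun G hG => ?_⟩
  · obtain ⟨s, hs⟩ := hcontr G hG
    obtain ⟨s', -, hs'⟩ := exists_contraction_mapCoeff f (starBoundary_single_mapCoeff f G) hs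
    have h1 := hs' j hj c hc
    rw [hc0, map_zero, add_zero] at h1
    exact ⟨s' c, h1⟩
  · obtain ⟨s, hs⟩ := hcontr G hG
    obtain ⟨z, hz, hz0, hgen, hfree⟩ := h.top G hG
    have h1 := top_cycles_mapCoeff f (starBoundary_single_mapCoeff f G)
      (starBoundary_mem_supported h.isLowerSet G d) (starBoundary_starBoundary G) hs hz hz0 hgen
      hfree
    refine ⟨mapCoeff _ f z, mapCoeff_mem_supported f hz, ?_, h1.2, fun r hr => ?_⟩
    · rw [map_mapCoeff f (starBoundary_single_mapCoeff f G), hz0, map_zero]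
    · exact (smul_eq_zero.1 hr).resolve_right h1.1

end Star

/-! ### Links and stars -/

section Link

variable {V : Type*} [LinearOrder V] {R : Type*} [CommRing R]

/-- The sign comparing the orientation of `G ∪ H` with that of `H`. -/
def joinSign (R : Type*) [CommRing R] (G H : Finset V) : R := ∏ v ∈ H, boundarySign R G v

theorem joinSign_mul_self (G H : Finset V) : joinSign R G H * joinSign R G H = 1 := by
  rw [joinSign, ← Finset.prod_mul_distrib]
  exact Finset.prod_eq_one fun v _ => boundarySign_mul_self G v

theorem boundarySign_union {G H : Finset V} (h : Disjoint G H) (v : V) :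
    boundarySign R (G ∪ H) v = boundarySign R G v * boundarySign R H v := by
  rw [boundarySign, Finset.filter_union, Finset.card_union_of_disjoint, pow_add]
  · rfl
  · exact Finset.disjoint_filter_filter h

/-- Positions in a disjoint union add, and the resulting factor for G cancels the one that v
contributes to the product. This is what makes `linkToStar` and `starToLink` commute with the
boundaries. -/
theorem joinSign_mul_boundarySign {G H : Finset V} (h : Disjoint G H) {v : V} (hv : v ∈ H) :
    joinSign R G H * boundarySign R (G ∪ H) v =
      joinSign R G (H.erase v) * boundarySign R H v := by
  rw [joinSign, ← Finset.prod_erase_mul _ _ hv, boundarySign_union h, mul_assoc, ← mul_assoc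
    (boundarySign R G v), boundarySign_mul_self, one_mul]
  rfl

/-- From chains of the link of `G` to chains of the star of `G`. -/
noncomputable def linkToStar (R : Type*) [CommRing R] (G : Finset V) :
    (Finset V →₀ R) →ₗ[R] (Finset V →₀ R) :=
  Finsupp.linearCombination R fun H => Finsupp.single (G ∪ H) (joinSign R G H)

/-- From chains of the star of `G` to chains of the link of `G`. -/
noncomputable def starToLink (R : Type*) [CommRing R] (G : Finset V) :
    (Finset V →₀ R) →ₗ[R] (Finset V →₀ R) :=
  Finsupp.linearCombination R fun F => Finsupp.single (F \ G) (joinSign R G (F \ G))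

theorem linkToStar_single (G H : Finset V) (a : R) :
    linkToStar R G (Finsupp.single H a) = Finsupp.single (G ∪ H) (a * joinSign R G H) := by
  simp [linkToStar]

theorem starToLink_single (G F : Finset V) (a : R) :
    starToLink R G (Finsupp.single F a) =
      Finsupp.single (F \ G) (a * joinSign R G (F \ G)) := by
  simp [starToLink]

theorem simplicialBoundary_single (F : Finset V) (a : R) :
    simplicialBoundary R V (Finsupp.single F a) =
      ∑ v ∈ F, Finsupp.single (F.erase v) (a * boundarySign R F v) := by
  rw [← starBoundary_empty, starBoundary_single, Finset.sdiff_empty]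

theorem starBoundary_linkToStar {G : Finset V} {c : Finset V →₀ R}
    (hc : c ∈ Finsupp.supported R R {H | Disjoint G H}) :
    starBoundary R G (linkToStar R G c) = linkToStar R G (simplicialBoundary R V c) := by
  refine forall_mem_supported (LinearMap.eqLocus ((starBoundary R G).comp (linkToStar R G))
    ((linkToStar R G).comp (simplicialBoundary R V))) (fun H hH => ?_) hc
  have hH' : Disjoint G H := hH
  rw [LinearMap.mem_eqLocus, LinearMap.comp_apply, LinearMap.comp_apply, linkToStar_single,
    starBoundary_single, simplicialBoundary_single, map_sum, Finset.union_sdiff_cancel_left hH']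
  refine Finset.sum_congr rfl fun v hv => ?_
  rw [linkToStar_single, one_mul, one_mul, joinSign_mul_boundarySign hH' hv, mul_comm,
    Finset.erase_union_distrib,
    Finset.erase_eq_of_notMem fun hvG => Finset.disjoint_left.1 hH' hvG hv]

theorem simplicialBoundary_starToLink {G : Finset V} {c : Finset V →₀ R}
    (hc : c ∈ Finsupp.supported R R {F | G ⊆ F}) :
    simplicialBoundary R V (starToLink R G c) = starToLink R G (starBoundary R G c) := by
  refine forall_mem_supported (LinearMap.eqLocus ((simplicialBoundary R V).comp (starToLink R G))
    ((starToLink R G).comp (starBoundary R G))) (fun F hF => ?_) hc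
  have hF' : G ∪ F \ G = F := Finset.union_sdiff_of_subset hF
  rw [LinearMap.mem_eqLocus, LinearMap.comp_apply, LinearMap.comp_apply, starToLink_single,
    starBoundary_single, simplicialBoundary_single, map_sum]
  refine Finset.sum_congr rfl fun v hv => ?_
  have h1 := joinSign_mul_boundarySign (R := R) (Finset.disjoint_sdiff (s := G) (t := F)) hv
  rw [hF'] at h1
  have h2 : boundarySign R (F \ G) v = boundarySign R F v * joinSign R G (F \ G) *
      joinSign R G ((F \ G).erase v) := by
    rw [mul_comm (boundarySign R F v), h1]
    linear_combination (-boundarySign R (F \ G) v) *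
      joinSign_mul_self (R := R) G ((F \ G).erase v)
  rw [starToLink_single, one_mul, one_mul, Finset.erase_sdiff_comm, h2]
  congr 1
  linear_combination (boundarySign R F v * joinSign R G ((F \ G).erase v)) *
    joinSign_mul_self (R := R) G (F \ G)

theorem linkToStar_starToLink {G : Finset V} {c : Finset V →₀ R}
    (hc : c ∈ Finsupp.supported R R {F | G ⊆ F}) : linkToStar R G (starToLink R G c) = c := by
  refine forall_mem_supported (LinearMap.eqLocus ((linkToStar R G).comp (starToLink R G))
    LinearMap.id) (fun F hF => ?_) hc
  rw [LinearMap.mem_eqLocus, LinearMap.comp_apply, starToLink_single, linkToStar_single, one_mul,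
    joinSign_mul_self, Finset.union_sdiff_of_subset hF, LinearMap.id_apply]

theorem starToLink_linkToStar {G : Finset V} {c : Finset V →₀ R}
    (hc : c ∈ Finsupp.supported R R {H | Disjoint G H}) :
    starToLink R G (linkToStar R G c) = c := by
  refine forall_mem_supported (LinearMap.eqLocus ((starToLink R G).comp (linkToStar R G))
    LinearMap.id) (fun H hH => ?_) hc
  have hH' : Disjoint G H := hH
  rw [LinearMap.mem_eqLocus, LinearMap.comp_apply, linkToStar_single, starToLink_single, one_mul,
    Finset.union_sdiff_cancel_left hH', joinSign_mul_self, LinearMap.id_apply]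

theorem simplicialBoundaries_eq_bot {L : Set (Finset V)} {k : ℕ}
    (h : ∀ H ∈ L, H.card ≠ k + 1) : simplicialBoundaries R L k = ⊥ := by
  have : {F | F ∈ L ∧ F.card = k + 1} = ∅ :=
    Set.eq_empty_iff_forall_notMem.2 fun H hH => h H hH.1 hH.2
  rw [simplicialBoundaries, simplicialChains, this, Finsupp.supported_empty, Submodule.map_bot]

variable {K : PreAbstractSimplicialComplex V}

theorem PreAbstractSimplicialComplex.isLowerSet_allFaces {V : Type*}
    {K : PreAbstractSimplicialComplex V} : IsLowerSet K.allFaces := by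
  rintro F F' hle (rfl | hF)
  · exact Or.inl (Finset.subset_empty.1 hle)
  · rcases F'.eq_empty_or_nonempty with rfl | hne
    · exact Or.inl rfl
    · exact Or.inr ((K.isRelLowerSet_faces hF).2 hle hne)

theorem starToLink_mem {G : Finset V} {k : ℕ} {c : Finset V →₀ R}
    (hc : c ∈ Finsupp.supported R R (starFaces K.allFaces G (k + G.card))) :
    starToLink R G c ∈ simplicialChains R (K.linkFaces G) k := by
  refine forall_mem_supported ((simplicialChains R (K.linkFaces G) k).comap (starToLink R G))
    (fun F hF => ?_) hc
  rw [Submodule.mem_comap, starToLink_single]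
  refine Finsupp.single_mem_supported R _ ⟨⟨Finset.disjoint_sdiff, ?_⟩, ?_⟩
  · rw [Finset.union_sdiff_of_subset hF.2.1]
    exact hF.1
  · rw [Finset.card_sdiff_of_subset hF.2.1, hF.2.2, Nat.add_sub_cancel]

theorem linkToStar_mem {G : Finset V} {k : ℕ} {c : Finset V →₀ R}
    (hc : c ∈ simplicialChains R (K.linkFaces G) k) :
    linkToStar R G c ∈ Finsupp.supported R R (starFaces K.allFaces G (k + G.card)) := by
  refine forall_mem_supported ((Finsupp.supported R R (starFaces K.allFaces G
    (k + G.card))).comap (linkToStar R G)) (fun H hH => ?_) hc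
  rw [Submodule.mem_comap, linkToStar_single]
  refine Finsupp.single_mem_supported R _ ⟨hH.1.2, Finset.subset_union_left, ?_⟩
  rw [Finset.card_union_of_disjoint hH.1.1, hH.2, add_comm]

theorem simplicialChains_le_disjoint (G : Finset V) (k : ℕ) :
    simplicialChains R (K.linkFaces G) k ≤ Finsupp.supported R R {H | Disjoint G H} :=
  Finsupp.supported_mono fun _ h => h.1.1

theorem supported_starFaces_le {V : Type*} (L : Set (Finset V)) (G : Finset V) (j : ℕ) :
    Finsupp.supported R R (starFaces L G j) ≤ Finsupp.supported R R {F | G ⊆ F} :=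
  Finsupp.supported_mono fun _ h => h.2.1

/-- The link of a maximal face is {∅}, which has nonzero homology in degree -1. Hence every maximal
face has exactly d vertices. -/
theorem PreAbstractSimplicialComplex.IsHomologySphere.card_le [Nontrivial R] {d : ℕ}
    (hK : K.IsHomologySphere R d) {F : Finset V} (hF : F ∈ K.allFaces) : F.card ≤ d := by
  have hfin : K.allFaces.Finite := hK.1.insert ∅
  obtain ⟨M, hFM, hM⟩ := hfin.exists_le_maximal hF
  refine (Finset.card_le_card hFM).trans (le_of_eq ?_)
  by_contra hne
  have hsub := (hK.2 M hM.1 0).2 (by rwa [zero_add])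
  have hlink : ∀ H ∈ K.linkFaces M, H = ∅ := fun H hH => by
    have := hM.2 hH.2 Finset.subset_union_left
    exact Finset.disjoint_self_iff_empty H |>.1 (hH.1.mono_left
      (Finset.subset_union_right.trans this))
  have hz : Finsupp.single (∅ : Finset V) (1 : R) ∈ simplicialCycles R (K.linkFaces M) 0 := by
    refine ⟨Finsupp.single_mem_supported R _ ⟨⟨Finset.disjoint_empty_right M, ?_⟩, rfl⟩, ?_⟩
    · rw [Finset.union_empty]
      exact hM.1
    · rw [SetLike.mem_coe, LinearMap.mem_ker, simplicialBoundary_single, Finset.sum_empty]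
  have hb : simplicialBoundaries R (K.linkFaces M) 0 = ⊥ := by
    refine simplicialBoundaries_eq_bot fun H h1 h2 => ?_
    rw [hlink H h1] at h2
    simp at h2
  have h0 := congrArg Subtype.val (Subsingleton.elim
    (⟨_, Submodule.mem_map_of_mem hz⟩ : reducedHomology R (K.linkFaces M) 0) 0)
  simp only [Submodule.mkQ_apply, ZeroMemClass.coe_zero, Submodule.Quotient.mk_eq_zero] at h0
  rw [hb, Submodule.mem_bot, Finsupp.single_eq_zero] at h0
  exact one_ne_zero h0

/-- The chain complex of the star of G is that of its link, shifted by the number of vertices of G;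
the two sign-twisted maps between them are mutually inverse. -/
theorem PreAbstractSimplicialComplex.IsHomologySphere.isSphereComplex [Nontrivial R] {d : ℕ}
    (hK : K.IsHomologySphere R d) : IsSphereComplex R K.allFaces d where
  finite := hK.1.insert ∅
  isLowerSet := K.isLowerSet_allFaces
  empty_mem := Set.mem_insert _ _
  card_le _ hF := hK.card_le hF
  exact G hG j hj c hc hc0 := by
    rcases lt_or_ge j G.card with h | h
    · rw [starFaces_eq_empty _ h, Finsupp.supported_empty, Submodule.mem_bot] at hc
      exact ⟨0, zero_mem _, by rw [hc, map_zero]⟩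
    obtain ⟨k, rfl⟩ : ∃ k, j = k + G.card := ⟨j - G.card, by omega⟩
    have hsub := (hK.2 G hG k).2 hj.ne
    have hcs := supported_starFaces_le _ _ _ hc
    have hz : starToLink R G c ∈ simplicialCycles R (K.linkFaces G) k :=
      ⟨starToLink_mem hc, by
        rw [SetLike.mem_coe, LinearMap.mem_ker, simplicialBoundary_starToLink hcs, hc0, map_zero]⟩
    have h0 := congrArg Subtype.val (Subsingleton.elim
      (⟨_, Submodule.mem_map_of_mem hz⟩ : reducedHomology R (K.linkFaces G) k) 0)
    simp only [Submodule.mkQ_apply, ZeroMemClass.coe_zero, Submodule.Quotient.mk_eq_zero] at h0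
    obtain ⟨b, hb, hbc⟩ := h0
    refine ⟨linkToStar R G b, ?_, ?_⟩
    · have := linkToStar_mem hb
      rwa [add_right_comm] at this
    · rw [starBoundary_linkToStar (simplicialChains_le_disjoint _ _ hb), hbc,
        linkToStar_starToLink hcs]
  top G hG := by
    obtain ⟨k, hk⟩ : ∃ k, k + G.card = d := ⟨d - G.card, Nat.sub_add_cancel (hK.card_le hG)⟩
    obtain ⟨e⟩ := (hK.2 G hG k).1 hk
    -- There are no faces with more than d vertices, so top homology is the module of top cycles
    -- itself.
    have hb : simplicialBoundaries R (K.linkFaces G) k = ⊥ := by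
      refine simplicialBoundaries_eq_bot fun H h1 h2 => ?_
      have := hK.card_le h1.2
      rw [Finset.card_union_of_disjoint h1.1, h2] at this
      omega
    obtain ⟨z, hz, hzu⟩ := (e.symm 1).2
    have hgen : ∀ c ∈ simplicialCycles R (K.linkFaces G) k, ∃ r : R, c = r • z := by
      intro c hc
      refine ⟨e ⟨_, Submodule.mem_map_of_mem hc⟩, ?_⟩
      set r := e ⟨_, Submodule.mem_map_of_mem hc⟩ with hr
      have h1 : r • e.symm 1 = ⟨_, Submodule.mem_map_of_mem hc⟩ := by
        rw [← map_smul, smul_eq_mul, mul_one, hr, e.symm_apply_apply]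
      have h2 := congrArg Subtype.val h1
      rw [Submodule.coe_smul, ← hzu, ← map_smul] at h2
      have h3 := (Submodule.Quotient.eq _).1 h2
      rw [hb, Submodule.mem_bot, sub_eq_zero] at h3
      exact h3.symm
    have hfree : ∀ r : R, r • z = 0 → r = 0 := by
      intro r hr
      have h1 : r • e.symm 1 = 0 := by
        apply Subtype.ext
        rw [Submodule.coe_smul, ← hzu, ← map_smul, hr, map_zero]
        rfl
      have h2 := congrArg e h1
      rwa [map_smul, e.apply_symm_apply, smul_eq_mul, mul_one, map_zero] at h2
    have hzd := simplicialChains_le_disjoint _ _ hz.1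
    subst hk
    refine ⟨linkToStar R G z, linkToStar_mem hz.1, ?_, fun c hc hc0 => ?_, fun r hr => ?_⟩
    · rw [starBoundary_linkToStar hzd, LinearMap.mem_ker.1 hz.2, map_zero]
    · have hcs := supported_starFaces_le _ _ _ hc
      obtain ⟨r, hr⟩ := hgen (starToLink R G c) ⟨starToLink_mem hc, by
        rw [SetLike.mem_coe, LinearMap.mem_ker, simplicialBoundary_starToLink hcs, hc0, map_zero]⟩
      exact ⟨r, by rw [← map_smul, ← hr, linkToStar_starToLink hcs]⟩
    · refine hfree r ?_
      rw [← starToLink_linkToStar hzd, ← map_smul, ← map_smul, map_smul, hr, map_zero]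

end Link

/-! ### Euler relations and the fundamental cycle -/

section SphereComplex

variable {V : Type*} [LinearOrder V] {k : Type*} [Field k] {L : Set (Finset V)} {d : ℕ}

/-- The cycles of the star of `G` carried by faces with `j` vertices. -/
noncomputable def starCycles (k : Type*) [Field k] (L : Set (Finset V)) (G : Finset V) (j : ℕ) :
    Submodule k (Finset V →₀ k) :=
  Finsupp.supported k k (starFaces L G j) ⊓ LinearMap.ker (starBoundary k G)

theorem finrank_map_add_finrank_inf_ker {E E' : Type*} [AddCommGroup E] [Module k E]
    [AddCommGroup E'] [Module k E'] (f : E →ₗ[k] E') (p : Submodule k E)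
    [FiniteDimensional k p] :
    Module.finrank k (p.map f) + Module.finrank k (p ⊓ LinearMap.ker f : Submodule k E) =
      Module.finrank k p := by
  have h : LinearMap.ker (f.domRestrict p) = (p ⊓ LinearMap.ker f).comap p.subtype := by
    ext c
    simp
  rw [← LinearMap.finrank_range_add_finrank_ker (f.domRestrict p), LinearMap.range_domRestrict, h,
    (Submodule.comapSubtypeEquivOfLe (inf_le_left : p ⊓ LinearMap.ker f ≤ p)).finrank_eq]

theorem finrank_supported {ι : Type*} (S : Set ι) :
    Module.finrank k (Finsupp.supported k k S) = S.ncard := by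
  rw [(Finsupp.supportedEquivFinsupp (M := k) (R := k) S).finrank_eq]
  rcases S.finite_or_infinite with hS | hS
  · have := hS.fintype
    rw [Module.finrank_finsupp_self, ← Nat.card_eq_fintype_card, Nat.card_coe_set_eq]
  · rw [hS.ncard]
    have := hS.to_subtype
    exact Module.finrank_of_infinite_dimensional fun h =>
      not_finite_iff_infinite.2 this
        ((Module.finite_finsupp_self_iff (R := k)).1 h |>.resolve_left (not_subsingleton k))

theorem finiteDimensional_supported {ι : Type*} {S : Set ι} (hS : S.Finite) :
    FiniteDimensional k (Finsupp.supported k k S) := by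
  have := hS.to_subtype
  exact Module.Finite.equiv (Finsupp.supportedEquivFinsupp (M := k) (R := k) S).symm

theorem IsSphereComplex.finite_starFaces (h : IsSphereComplex k L d) (G : Finset V) (j : ℕ) :
    (starFaces L G j).Finite :=
  h.finite.subset fun _ hF => hF.1

theorem IsSphereComplex.map_supported_starFaces (h : IsSphereComplex k L d) {G : Finset V}
    (hG : G ∈ L) {j : ℕ} (hj : j < d) :
    (Finsupp.supported k k (starFaces L G (j + 1))).map (starBoundary k G) =
      starCycles k L G j := by
  refine le_antisymm ?_ fun c hc => ?_
  · rintro _ ⟨b, hb, rfl⟩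
    exact ⟨starBoundary_mem_supported h.isLowerSet G j b hb, starBoundary_starBoundary G b⟩
  · exact h.exact G hG j hj c hc.1 hc.2

theorem IsSphereComplex.finrank_starCycles_succ (h : IsSphereComplex k L d) {G : Finset V}
    (hG : G ∈ L) {j : ℕ} (hj : j < d) :
    Module.finrank k (starCycles k L G j) + Module.finrank k (starCycles k L G (j + 1)) =
      (starFaces L G (j + 1)).ncard := by
  have := finiteDimensional_supported (k := k) (h.finite_starFaces G (j + 1))
  rw [← h.map_supported_starFaces hG hj, ← finrank_supported (k := k)]
  exact finrank_map_add_finrank_inf_ker _ _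

theorem IsSphereComplex.finrank_starCycles_top (h : IsSphereComplex k L d) {G : Finset V}
    (hG : G ∈ L) : Module.finrank k (starCycles k L G d) = 1 := by
  obtain ⟨z, hz, hz0, hgen, hfree⟩ := h.top G hG
  refine finrank_eq_one (⟨z, hz, hz0⟩ : starCycles k L G d) ?_ ?_
  · intro hzero
    have hzero' : z = 0 := congrArg Subtype.val hzero
    exact one_ne_zero (hfree 1 (by rw [hzero', smul_zero]))
  · rintro ⟨c, hc, hc0⟩
    obtain ⟨r, hr⟩ := hgen c hc hc0
    exact ⟨r, Subtype.ext hr.symm⟩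

/-- Exactness makes the number of faces the sum of two consecutive cycle dimensions, so the
alternating sum telescopes to the one-dimensional space of top cycles. -/
theorem IsSphereComplex.sum_ncard_starFaces (h : IsSphereComplex k L d) {G : Finset V}
    (hG : G ∈ L) :
    ∑ j ∈ Finset.range (d + 1), (-1 : ℤ) ^ j * ((starFaces L G j).ncard : ℤ) = (-1) ^ d := by
  have key : ∀ m ≤ d, ∑ j ∈ Finset.range (m + 1), (-1 : ℤ) ^ j * ((starFaces L G j).ncard : ℤ) =
      (-1) ^ m * (Module.finrank k (starCycles k L G m) : ℤ) := by
    intro m hm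
    induction m with
    | zero =>
      have : starCycles k L G 0 = Finsupp.supported k k (starFaces L G 0) :=
        inf_eq_left.2 fun c hc => starBoundary_eq_zero L G c hc
      rw [this, finrank_supported]
      simp
    | succ m ih =>
      rw [Finset.sum_range_succ, ih (by omega), ← h.finrank_starCycles_succ hG (by omega)]
      push_cast
      ring
  rw [key d le_rfl, h.finrank_starCycles_top hG]
  simp

/-- The number of members of `L` with `j` elements. -/
noncomputable def faceCount (L : Set (Finset V)) (j : ℕ) : ℕ := {F | F ∈ L ∧ F.card = j}.ncard

theorem IsSphereComplex.faceCount_eq (h : IsSphereComplex k L d) (j : ℕ) :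
    faceCount L j = (h.finite.toFinset.filter fun F => F.card = j).card := by
  rw [faceCount, ← Set.ncard_coe_finset]
  congr 1
  ext F
  simp

/-- Sum the Euler relation of the star of G over all G with j vertices; a face F is counted once for
each of its binom(|F|, j) subsets of size j. -/
theorem IsSphereComplex.isEulerian (h : IsSphereComplex k L d) :
    IsEulerian d fun j => (faceCount L j : ℤ) := by
  classical
  intro j _
  set Λ := h.finite.toFinset with hΛ
  have hmem : ∀ F, F ∈ Λ ↔ F ∈ L := fun F => by simp [hΛ]
  have hmaps : ∀ F ∈ Λ, F.card ∈ Finset.range (d + 1) := fun F hF => by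
    have := h.card_le F ((hmem F).1 hF)
    rw [Finset.mem_range]
    omega
  have h1 : ∀ G ∈ Λ, ∑ F ∈ Λ with G ⊆ F, (-1 : ℤ) ^ F.card = (-1) ^ d := by
    intro G hG
    rw [← h.sum_ncard_starFaces ((hmem G).1 hG),
      ← Finset.sum_fiberwise_of_maps_to (g := Finset.card) (t := Finset.range (d + 1))
        fun F hF => hmaps F (Finset.mem_filter.1 hF).1]
    refine Finset.sum_congr rfl fun m _ => ?_
    rw [Finset.sum_congr rfl fun F hF => by rw [(Finset.mem_filter.1 hF).2], Finset.sum_const,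
      nsmul_eq_mul, mul_comm, ← Set.ncard_coe_finset]
    congr 3
    ext F
    simp [starFaces, hmem, and_assoc]
  have h2 : ∑ m ∈ Finset.range (d + 1), (-1 : ℤ) ^ m * ((faceCount L m : ℤ) * (m.choose j : ℤ)) =
      ∑ F ∈ Λ, (-1 : ℤ) ^ F.card * (F.card.choose j : ℤ) := by
    rw [← Finset.sum_fiberwise_of_maps_to hmaps]
    refine Finset.sum_congr rfl fun m _ => ?_
    rw [Finset.sum_congr rfl fun F hF => by rw [(Finset.mem_filter.1 hF).2], Finset.sum_const,
      nsmul_eq_mul, h.faceCount_eq]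
    ring
  have h3 : ∀ F ∈ Λ, (-1 : ℤ) ^ F.card * (F.card.choose j : ℤ) =
      ∑ G ∈ Λ with G.card = j, if G ⊆ F then (-1 : ℤ) ^ F.card else 0 := by
    intro F hF
    rw [← Finset.sum_filter, Finset.sum_const, nsmul_eq_mul, mul_comm, ← Finset.card_powersetCard]
    congr 3
    ext G
    simp only [Finset.mem_powersetCard, Finset.mem_filter, hmem]
    refine ⟨fun hG => ⟨⟨h.isLowerSet hG.1 ((hmem F).1 hF), hG.2⟩, hG.1⟩,
      fun hG => ⟨hG.2, hG.1.2⟩⟩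
  change _ = (-1) ^ d * (faceCount L j : ℤ)
  rw [h2, Finset.sum_congr rfl h3, Finset.sum_comm, h.faceCount_eq, ← hΛ]
  rw [Finset.sum_congr rfl fun G hG => by
    rw [← Finset.sum_filter, h1 G (Finset.mem_filter.1 hG).1], Finset.sum_const, nsmul_eq_mul,
    mul_comm]

/-- Discarding the faces that do not contain G' is a chain map between stars: dropping a vertex of
G' leaves a face that is discarded anyway. -/
theorem starBoundary_filter {G G' : Finset V} (hG : G ⊆ G') (c : Finset V →₀ k) :
    starBoundary k G' (c.filter fun F => G' ⊆ F) =
      (starBoundary k G c).filter fun F => G' ⊆ F := by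
  induction c using Finsupp.induction_linear with
  | zero => rw [Finsupp.filter_zero, map_zero, map_zero, Finsupp.filter_zero]
  | add a b ha hb => rw [Finsupp.filter_add, map_add, map_add, Finsupp.filter_add, ha, hb]
  | single F a =>
    rw [starBoundary_single]
    change _ = Finsupp.filterAddHom _ _
    rw [map_sum]
    change _ = ∑ v ∈ F \ G, Finsupp.filter _ _
    by_cases hF : G' ⊆ F
    · rw [Finsupp.filter_single_of_pos _ hF, starBoundary_single]
      rw [← Finset.sum_subset (Finset.sdiff_subset_sdiff (Finset.Subset.refl F) hG)]
      · refine Finset.sum_congr rfl fun v hv => ?_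
        rw [Finset.mem_sdiff] at hv
        rw [Finsupp.filter_single_of_pos]
        exact Finset.subset_erase.2 ⟨hF, hv.2⟩
      · intro v hv hv'
        rw [Finset.mem_sdiff] at hv hv'
        rw [Finsupp.filter_single_of_neg]
        intro h'
        exact hv' ⟨hv.1, (Finset.subset_erase.1 h').2⟩
    · rw [Finsupp.filter_single_of_neg _ hF, map_zero]
      refine (Finset.sum_eq_zero fun v _ => ?_).symm
      rw [Finsupp.filter_single_of_neg]
      exact fun h' => hF (h'.trans (Finset.erase_subset _ _))

theorem filter_mem_starCycles {G G' : Finset V} (hG : G ⊆ G') {j : ℕ} {c : Finset V →₀ k}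
    (hc : c ∈ starCycles k L G j) :
    (c.filter fun F => G' ⊆ F) ∈ starCycles k L G' j := by
  refine ⟨?_, ?_⟩
  · refine (Finsupp.mem_supported' _ _).2 fun F hF => ?_
    rw [Finsupp.filter_apply]
    split_ifs with h
    · refine (Finsupp.mem_supported' _ _).1 hc.1 F fun h' => hF ⟨h'.1, h, h'.2.2⟩
    · rfl
  · have h0 : starBoundary k G c = 0 := hc.2
    rw [SetLike.mem_coe, LinearMap.mem_ker, starBoundary_filter hG, h0, Finsupp.filter_zero]

theorem exists_ne_zero_of_mem_starCycles {G : Finset V} {j : ℕ} {c : Finset V →₀ k}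
    (hc : c ∈ starCycles k L G j) (hc0 : c ≠ 0) : ∃ F ∈ starFaces L G j, c F ≠ 0 := by
  by_contra! h'
  refine hc0 (Finsupp.ext fun F => ?_)
  by_cases hF : F ∈ starFaces L G j
  · exact h' F hF
  · exact (Finsupp.mem_supported' _ _).1 hc.1 F hF

/-- The difference of the two points `u`, `w` of the link of `G`, as a cycle. -/
theorem edge_mem_starCycles {G : Finset V} {u w : V} (hu : u ∉ G) (hw : w ∉ G)
    (huL : insert u G ∈ L) (hwL : insert w G ∈ L) :
    Finsupp.single (insert u G) (boundarySign k (insert u G) u) -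
      Finsupp.single (insert w G) (boundarySign k (insert w G) w) ∈
        starCycles k L G (G.card + 1) := by
  have key : ∀ x : V, x ∉ G → starBoundary k G (Finsupp.single (insert x G)
      (boundarySign k (insert x G) x)) = Finsupp.single G 1 := by
    intro x hx
    rw [starBoundary_single, Finset.insert_sdiff_of_notMem _ hx, Finset.sdiff_self,
      insert_empty_eq, Finset.sum_singleton, boundarySign_mul_self, Finset.erase_insert hx]
  refine ⟨sub_mem ?_ ?_, ?_⟩
  · exact Finsupp.single_mem_supported k _
      ⟨huL, Finset.subset_insert _ _, Finset.card_insert_of_notMem hu⟩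
  · exact Finsupp.single_mem_supported k _
      ⟨hwL, Finset.subset_insert _ _, Finset.card_insert_of_notMem hw⟩
  · rw [SetLike.mem_coe, LinearMap.mem_ker, map_sub, key u hu, key w hw, sub_self]

theorem boundarySign_ne_zero (F : Finset V) (v : V) : boundarySign k F v ≠ 0 :=
  left_ne_zero_of_mul_eq_one (boundarySign_mul_self F v)

/-- If the support of a chain is not met by the vertices of a union of components of the link
of `G`, then an edge leaving that union is not a boundary. -/
theorem edge_ne_starBoundary {G : Finset V} (A : Set V)
    (hA : ∀ F ∈ starFaces L G (G.card + 2), ∀ x ∈ F \ G, ∀ y ∈ F \ G, x ∈ A → y ∈ A)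
    {u w : V} (hu : u ∉ G) (hw : w ∉ G) (huA : u ∉ A) (hwA : w ∈ A) {b : Finset V →₀ k}
    (hb : b ∈ Finsupp.supported k k (starFaces L G (G.card + 2))) :
    starBoundary k G b ≠ Finsupp.single (insert u G) (boundarySign k (insert u G) u) -
      Finsupp.single (insert w G) (boundarySign k (insert w G) w) := by
  classical
  intro heq
  -- This functional counts, with signs, the points lying in A. On the boundary of an edge with both
  -- ends in A, or both outside, it vanishes; on the prescribed difference it equals -1.
  let ψ : (Finset V →₀ k) →ₗ[k] k := Finsupp.linearCombination k fun F =>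
    ∑ x ∈ F \ G, if x ∈ A then boundarySign k F x else 0
  have hψ : ∀ F : Finset V, ∀ a : k, ψ (Finsupp.single F a) =
      a * ∑ x ∈ F \ G, if x ∈ A then boundarySign k F x else 0 := fun F a => by
    simp only [ψ, Finsupp.linearCombination_single, smul_eq_mul]
  have hψb : ψ (starBoundary k G b) = 0 := by
    refine forall_mem_supported (LinearMap.ker (ψ.comp (starBoundary k G))) (fun F hF => ?_) hb
    rw [LinearMap.mem_ker, LinearMap.comp_apply, starBoundary_single, map_sum]
    have hcard : (F \ G).card = 2 := by
      rw [Finset.card_sdiff_of_subset hF.2.1, hF.2.2, Nat.add_sub_cancel_left]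
    obtain ⟨x, y, hxy, hFG⟩ := Finset.card_eq_two.1 hcard
    have hx : x ∈ F \ G := by rw [hFG]; simp
    have hy : y ∈ F \ G := by rw [hFG]; simp
    have hxF := (Finset.mem_sdiff.1 hx).1
    have hyF := (Finset.mem_sdiff.1 hy).1
    have ex : F.erase x \ G = {y} := by
      rw [Finset.erase_sdiff_comm, hFG, Finset.erase_insert (by simpa using hxy)]
    have ey : F.erase y \ G = {x} := by
      rw [Finset.erase_sdiff_comm, hFG, Finset.pair_comm, Finset.erase_insert (by simpa using hxy.symm)]
    rw [hFG, Finset.sum_pair hxy, hψ, hψ, ex, ey, Finset.sum_singleton, Finset.sum_singleton]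
    by_cases hxA : x ∈ A
    · rw [if_pos hxA, if_pos (hA F hF x hx y hy hxA), one_mul, one_mul]
      exact boundarySign_erase_add hxF hyF hxy
    · rw [if_neg hxA, if_neg fun h' => hxA (hA F hF y hy x hx h')]
      simp
  rw [heq, map_sub, hψ, hψ, Finset.insert_sdiff_of_notMem _ hu, Finset.insert_sdiff_of_notMem _ hw,
    Finset.sdiff_self] at hψb
  simp [huA, hwA, boundarySign_mul_self] at hψb

/-- A nonzero top cycle of a star reaches every vertex of the link. By induction on the dimension,
applied to larger faces, the set of vertices reached is closed under adjacency; a link of positive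
dimension is connected, so nothing is missed. -/
theorem IsSphereComplex.exists_mem_and_ne_zero (h : IsSphereComplex k L d) (m : ℕ) :
    ∀ G ∈ L, G.card + m = d → ∀ c ∈ starCycles k L G d, c ≠ 0 → ∀ v ∉ G, insert v G ∈ L →
      ∃ F, v ∈ F ∧ c F ≠ 0 := by
  induction m with
  | zero =>
    intro G _ hGd c _ _ v hv hvL
    have := h.card_le _ hvL
    rw [Finset.card_insert_of_notMem hv] at this
    omega
  | succ m ih =>
    intro G hG hGd c hc hc0 v hv hvL
    by_contra! hcv
    obtain ⟨F₀, hF₀, hcF₀⟩ := exists_ne_zero_of_mem_starCycles hc hc0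
    obtain ⟨w, hw⟩ : (F₀ \ G).Nonempty := by
      rw [← Finset.card_pos, Finset.card_sdiff_of_subset hF₀.2.1, hF₀.2.2]
      omega
    rw [Finset.mem_sdiff] at hw
    have hwL : insert w G ∈ L :=
      h.isLowerSet (Finset.insert_subset hw.1 hF₀.2.1) hF₀.1
    have hedge := edge_mem_starCycles (k := k) hv hw.2 hvL hwL
    -- For a zero-dimensional link connectedness fails. There the difference of two points is itself
    -- a top cycle, hence proportional to the same generator as c, although it does not vanish at v.
    rcases Nat.eq_zero_or_pos m with rfl | hm
    · have hvw : v ≠ w := by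
        rintro rfl
        exact hcF₀ (hcv F₀ hw.1)
      obtain ⟨z, hz, hz0, hgen, -⟩ := h.top G hG
      obtain ⟨a, ha⟩ := hgen c hc.1 hc.2
      rw [show G.card + 1 = d by omega] at hedge
      obtain ⟨b, hb⟩ := hgen _ hedge.1 hedge.2
      have h1 := hcv (insert v G) (Finset.mem_insert_self _ _)
      have h2 := DFunLike.congr_fun hb (insert v G)
      have hne : insert w G ≠ insert v G := fun h' => by
        have : v ∈ insert w G := h' ▸ Finset.mem_insert_self v G
        exact (Finset.mem_insert.1 this).elim hvw hv
      rw [Finsupp.sub_apply, Finsupp.single_eq_same, Finsupp.single_eq_of_ne hne.symm, sub_zero,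
        Finsupp.smul_apply, smul_eq_mul] at h2
      rw [ha, Finsupp.smul_apply, smul_eq_mul, mul_eq_zero] at h1
      rcases h1 with h1 | h1
      · exact hc0 (by rw [ha, h1, zero_smul])
      · rw [h1, mul_zero] at h2
        exact boundarySign_ne_zero _ _ h2
    · obtain ⟨b, hb, hbe⟩ := h.exact G hG (G.card + 1) (by omega) _ hedge.1 hedge.2
      refine edge_ne_starBoundary {x | ∃ F, x ∈ F ∧ c F ≠ 0} ?_ hv hw.2 ?_ ?_ hb hbe
      · rintro F hF x hx y hy ⟨F', hxF', hcF'⟩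
        rw [Finset.mem_sdiff] at hx hy
        by_cases hxy : y = x
        · exact ⟨F', hxy ▸ hxF', hcF'⟩
        have hxL : insert x G ∈ L := h.isLowerSet (Finset.insert_subset hx.1 hF.2.1) hF.1
        have hyL : insert y (insert x G) ∈ L := h.isLowerSet
          (Finset.insert_subset hy.1 (Finset.insert_subset hx.1 hF.2.1)) hF.1
        have hF'G : F' ∈ starFaces L G d := by
          by_contra h'
          exact hcF' ((Finsupp.mem_supported' _ _).1 hc.1 F' h')
        obtain ⟨F'', h1, h2⟩ := ih (insert x G) hxL
          (by rw [Finset.card_insert_of_notMem hx.2]; omega)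
          (c.filter fun F => insert x G ⊆ F) (filter_mem_starCycles (Finset.subset_insert _ _) hc)
          (fun h' => hcF' (by
            rw [← Finsupp.filter_apply_pos (fun F => insert x G ⊆ F) c
              (Finset.insert_subset hxF' hF'G.2.1), h', Finsupp.zero_apply]))
          y (by simp [hxy, hy.2]) hyL
        refine ⟨F'', h1, fun h' => h2 ?_⟩
        rw [Finsupp.filter_apply, h', ite_self]
      · rintro ⟨F, h1, h2⟩
        exact h2 (hcv F h1)
      · exact ⟨F₀, hw.1, hcF₀⟩

theorem IsSphereComplex.filter_ne_zero (h : IsSphereComplex k L d) {z : Finset V →₀ k}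
    (hz : z ∈ starCycles k L ∅ d) (hz0 : z ≠ 0) {G : Finset V} (hG : G ∈ L) :
    (z.filter fun F => G ⊆ F) ≠ 0 := by
  induction G using Finset.induction_on with
  | empty =>
    rwa [(Finsupp.filter_eq_self_iff _ _).2 fun _ _ => Finset.empty_subset _]
  | insert v G hv ih =>
    have hGL : G ∈ L := h.isLowerSet (Finset.subset_insert v G) hG
    have hle := h.card_le G hGL
    obtain ⟨F, hvF, hF⟩ := h.exists_mem_and_ne_zero (d - G.card) G hGL (by omega) _
      (filter_mem_starCycles (Finset.empty_subset G) hz) (ih hGL) v hv hG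
    rw [Finsupp.filter_apply] at hF
    split_ifs at hF with hGF
    · intro h'
      rw [← Finsupp.filter_apply_pos (fun F => insert v G ⊆ F) z
        (Finset.insert_subset hvF hGF), h'] at hF
      exact hF rfl
    · exact absurd rfl hF

/-- A fundamental cycle restricts to generators of the top cycles of all stars. -/
theorem IsSphereComplex.exists_fundamental_cycle (h : IsSphereComplex k L d) :
    ∃ z ∈ starCycles k L ∅ d, ∀ G ∈ L, (z.filter fun F => G ⊆ F) ≠ 0 ∧
      ∀ c ∈ starCycles k L G d, ∃ r : k, c = r • z.filter fun F => G ⊆ F := by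
  obtain ⟨z, hz, hzb, -, hfree⟩ := h.top ∅ h.empty_mem
  have hz0 : z ≠ 0 := by
    rintro rfl
    exact one_ne_zero (hfree 1 (smul_zero 1))
  refine ⟨z, ⟨hz, hzb⟩, fun G hG => ?_⟩
  have hne := h.filter_ne_zero ⟨hz, hzb⟩ hz0 hG
  refine ⟨hne, fun c hc => ?_⟩
  obtain ⟨y, -, -, hgen, -⟩ := h.top G hG
  have hzG := filter_mem_starCycles (Finset.empty_subset G) (⟨hz, hzb⟩ : z ∈ starCycles k L ∅ d)
  obtain ⟨a, ha⟩ := hgen _ hzG.1 hzG.2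
  obtain ⟨b, hb⟩ := hgen c hc.1 hc.2
  have ha0 : a ≠ 0 := by
    rintro rfl
    exact hne (by rw [ha, zero_smul])
  exact ⟨b / a, by rw [ha, smul_smul, div_mul_cancel₀ _ ha0, hb]⟩

end SphereComplex

/-! ### Regular sequences of operators -/

section RegularSequence

variable {k E : Type*} [Field k] [AddCommGroup E] [Module k E] (t : ℕ → E →ₗ[k] E)

/-- The sum of the images of `N` under the first `l` operators. -/
def seqSpan (N : Submodule k E) : ℕ → Submodule k E
  | 0 => ⊥
  | l + 1 => seqSpan N l ⊔ N.map (t l)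

/-- Each of the first `m` operators is injective on `N` modulo the images of the previous ones. -/
def IsRegularSeq (N : Submodule k E) (m : ℕ) : Prop :=
  ∀ l < m, ∀ x ∈ N, t l x ∈ seqSpan t N l → x ∈ seqSpan t N l

variable {t}

theorem seqSpan_mono {N N' : Submodule k E} (h : N ≤ N') (l : ℕ) :
    seqSpan t N l ≤ seqSpan t N' l := by
  induction l with
  | zero => exact le_rfl
  | succ l ih => exact sup_le_sup ih (Submodule.map_mono h)

theorem seqSpan_le {N : Submodule k E} (hN : ∀ i, ∀ x ∈ N, t i x ∈ N) (l : ℕ) :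
    seqSpan t N l ≤ N := by
  induction l with
  | zero => exact bot_le
  | succ l ih =>
    refine sup_le ih ?_
    rintro _ ⟨x, hx, rfl⟩
    exact hN l x hx

theorem apply_mem_seqSpan (ht : ∀ i j x, t i (t j x) = t j (t i x)) {N : Submodule k E}
    (hN : ∀ i, ∀ x ∈ N, t i x ∈ N) (i : ℕ) {l : ℕ} {x : E} (hx : x ∈ seqSpan t N l) :
    t i x ∈ seqSpan t N l := by
  induction l generalizing x with
  | zero =>
    rw [seqSpan, Submodule.mem_bot] at hx ⊢
    rw [hx, map_zero]
  | succ l ih =>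
    obtain ⟨p, hp, _, ⟨b, hb, rfl⟩, rfl⟩ := Submodule.mem_sup.1 hx
    rw [map_add, ht]
    exact Submodule.add_mem_sup (ih hp) ⟨t i b, hN i b hb, rfl⟩

theorem apply_mem_seqSpan_of_lt {N : Submodule k E} {i l : ℕ} (h : i < l) {x : E} (hx : x ∈ N) :
    t i x ∈ seqSpan t N l := by
  induction l with
  | zero => omega
  | succ l ih =>
    rcases Nat.lt_succ_iff_lt_or_eq.1 h with h' | rfl
    · exact Submodule.mem_sup_left (ih h')
    · exact Submodule.mem_sup_right ⟨x, hx, rfl⟩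

theorem seqSpan_map {f : E →ₗ[k] E} (hf : ∀ i x, f (t i x) = t i (f x)) (N : Submodule k E)
    (l : ℕ) : seqSpan t (N.map f) l = (seqSpan t N l).map f := by
  induction l with
  | zero => rw [seqSpan, seqSpan, Submodule.map_bot]
  | succ l ih =>
    rw [seqSpan, seqSpan, Submodule.map_sup, ih, ← Submodule.map_comp, ← Submodule.map_comp]
    congr 2
    ext x
    exact (hf l x).symm

/-- A depth lemma: the kernel of a map is one step more regular than its image. -/
theorem IsRegularSeq.inf_ker (ht : ∀ i j x, t i (t j x) = t j (t i x)) {f : E →ₗ[k] E}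
    (hf : ∀ i x, f (t i x) = t i (f x)) {N : Submodule k E} (hN : ∀ i, ∀ x ∈ N, t i x ∈ N) {m : ℕ}
    (h1 : IsRegularSeq t N (m + 1)) (h2 : IsRegularSeq t (N.map f) m) :
    IsRegularSeq t (N ⊓ LinearMap.ker f) (m + 1) := by
  -- For x = p + t_l b with f x = 0, regularity on the image yields p' in the span with f p' = f b.
  -- Replacing b by b - p', which lies in the kernel, moves the correction into the span of the
  -- earlier operators.
  have key : ∀ l ≤ m, ∀ x ∈ seqSpan t N l, f x = 0 →
      x ∈ seqSpan t (N ⊓ LinearMap.ker f) l := by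
    intro l hl
    induction l with
    | zero => exact fun x hx _ => hx
    | succ l ih =>
      intro x hx hfx
      obtain ⟨p, hp, _, ⟨b, hb, rfl⟩, rfl⟩ := Submodule.mem_sup.1 hx
      rw [map_add, hf] at hfx
      have h3 : t l (f b) ∈ seqSpan t (N.map f) l := by
        rw [seqSpan_map hf, eq_neg_of_add_eq_zero_right hfx]
        exact neg_mem ⟨p, hp, rfl⟩
      have h4 := h2 l (by omega) (f b) ⟨b, hb, rfl⟩ h3
      rw [seqSpan_map hf] at h4
      obtain ⟨p', hp', hp'b⟩ := h4
      have h5 : b - p' ∈ N ⊓ LinearMap.ker f :=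
        ⟨sub_mem hb (seqSpan_le hN l hp'), by
          rw [SetLike.mem_coe, LinearMap.mem_ker, map_sub, hp'b, sub_self]⟩
      have h6 : p + t l b = (p + t l p') + t l (b - p') := by
        rw [map_sub]
        abel
      rw [h6]
      refine Submodule.add_mem_sup (ih (by omega) _ ?_ ?_) ⟨b - p', h5, rfl⟩
      · exact add_mem hp (apply_mem_seqSpan ht hN l hp')
      · rw [map_add, hf, hp'b, hfx]
  intro l hl x hx htx
  exact key l (by omega) x (h1 l hl x hx.1 (seqSpan_mono inf_le_left l htx)) hx.2

end RegularSequence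

/-! ### Polynomials on faces -/

section PolynomialChains

variable {V : Type*} [LinearOrder V] {k : Type*} [Field k]

/-- Setting the variables outside `F` equal to zero. -/
noncomputable def restrictVars (k : Type*) [Field k] (F : Finset V) :
    MvPolynomial V k →ₐ[k] MvPolynomial V k :=
  MvPolynomial.aeval fun v => if v ∈ F then MvPolynomial.X v else 0

theorem restrictVars_X (F : Finset V) (v : V) :
    restrictVars k F (MvPolynomial.X v) = if v ∈ F then MvPolynomial.X v else 0 := by
  rw [restrictVars, MvPolynomial.aeval_X]

theorem restrictVars_monomial (F : Finset V) (a : V →₀ ℕ) (r : k) :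
    restrictVars k F (MvPolynomial.monomial a r) =
      if a.support ⊆ F then MvPolynomial.monomial a r else 0 := by
  rw [restrictVars, MvPolynomial.aeval_monomial]
  split_ifs with h
  · rw [MvPolynomial.monomial_eq, MvPolynomial.algebraMap_eq]
    congr 1
    refine Finset.prod_congr rfl fun v hv => ?_
    simp only [if_pos (h hv)]
  · obtain ⟨v, hv, hvF⟩ := Finset.not_subset.1 h
    rw [Finsupp.prod, Finset.prod_eq_zero hv, mul_zero]
    rw [if_neg hvF, zero_pow (Finsupp.mem_support_iff.1 hv)]

theorem coeff_restrictVars (F : Finset V) (p : MvPolynomial V k) (a : V →₀ ℕ) :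
    MvPolynomial.coeff a (restrictVars k F p) =
      if a.support ⊆ F then MvPolynomial.coeff a p else 0 := by
  induction p using MvPolynomial.induction_on' with
  | monomial u r =>
    rw [restrictVars_monomial]
    by_cases hau : u = a
    · subst hau
      split_ifs <;> simp
    · split_ifs <;> simp [MvPolynomial.coeff_monomial, hau]
  | add p q hp hq =>
    rw [map_add, MvPolynomial.coeff_add, hp, hq, MvPolynomial.coeff_add]
    split_ifs <;> simp

theorem restrictVars_restrictVars {F F' : Finset V} (h : F ⊆ F') (p : MvPolynomial V k) :
    restrictVars k F (restrictVars k F' p) = restrictVars k F p := by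
  ext a
  simp only [coeff_restrictVars]
  split_ifs with h1 h2 <;> first | rfl | exact absurd (h1.trans h) h2

/-- Chains with polynomial coefficients. -/
abbrev PolyChain (V k : Type*) [Field k] := Finset V →₀ MvPolynomial V k

/-- The boundary map of the chains with polynomial coefficients. -/
noncomputable def polyBoundary (V k : Type*) [LinearOrder V] [Field k] :
    PolyChain V k →ₗ[k] PolyChain V k :=
  Finsupp.lsum k fun F => ∑ v ∈ F, boundarySign k F v •
    (Finsupp.lsingle (F.erase v)).comp (restrictVars k (F.erase v)).toLinearMap

theorem polyBoundary_single (F : Finset V) (p : MvPolynomial V k) :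
    polyBoundary V k (Finsupp.single F p) = ∑ v ∈ F,
      Finsupp.single (F.erase v) (boundarySign k F v • restrictVars k (F.erase v) p) := by
  rw [polyBoundary, Finsupp.lsum_single]
  simp

/-- Multiplication by the restrictions of a polynomial to the faces. -/
noncomputable def faceMul (q : MvPolynomial V k) : PolyChain V k →ₗ[k] PolyChain V k :=
  Finsupp.lsum k fun F => (Finsupp.lsingle F).comp (LinearMap.mulLeft k (restrictVars k F q))

theorem faceMul_single (q : MvPolynomial V k) (F : Finset V) (p : MvPolynomial V k) :
    faceMul q (Finsupp.single F p) = Finsupp.single F (restrictVars k F q * p) := by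
  rw [faceMul, Finsupp.lsum_single]
  simp

theorem faceMul_apply (q : MvPolynomial V k) (φ : PolyChain V k) (F : Finset V) :
    faceMul q φ F = restrictVars k F q * φ F := by
  induction φ using Finsupp.induction_linear with
  | zero => simp
  | add a b ha hb => rw [map_add, Finsupp.add_apply, Finsupp.add_apply, ha, hb, mul_add]
  | single F' p =>
    rw [faceMul_single]
    by_cases h : F' = F
    · subst h
      rw [Finsupp.single_eq_same, Finsupp.single_eq_same]
    · rw [Finsupp.single_eq_of_ne (Ne.symm h), Finsupp.single_eq_of_ne (Ne.symm h), mul_zero]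

theorem faceMul_comm (q q' : MvPolynomial V k) (φ : PolyChain V k) :
    faceMul q (faceMul q' φ) = faceMul q' (faceMul q φ) := by
  ext1 F
  simp only [faceMul_apply]
  ring

theorem polyBoundary_faceMul (q : MvPolynomial V k) (φ : PolyChain V k) :
    polyBoundary V k (faceMul q φ) = faceMul q (polyBoundary V k φ) := by
  induction φ using Finsupp.induction_linear with
  | zero => simp
  | add a b ha hb => simp only [map_add, ha, hb]
  | single F p =>
    rw [faceMul_single, polyBoundary_single, polyBoundary_single, map_sum]
    refine Finset.sum_congr rfl fun v _ => ?_
    rw [faceMul_single, map_mul, restrictVars_restrictVars (Finset.erase_subset v F),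
      mul_smul_comm]

/-- The chains with polynomial coefficients carried by the faces with `j` vertices, the
coefficient of a face involving only its vertices. -/
def polyChains (k : Type*) [Field k] (L : Set (Finset V)) (j : ℕ) : Submodule k (PolyChain V k) where
  carrier := {φ | ∀ F, restrictVars k F (φ F) = φ F ∧ (φ F ≠ 0 → F ∈ L ∧ F.card = j)}
  zero_mem' F := by simp
  add_mem' {φ ψ} hφ hψ F := by
    refine ⟨by rw [Finsupp.add_apply, map_add, (hφ F).1, (hψ F).1], fun h => ?_⟩
    by_cases h0 : φ F = 0
    · exact (hψ F).2 fun h1 => h (by rw [Finsupp.add_apply, h0, h1, add_zero])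
    · exact (hφ F).2 h0
  smul_mem' r φ hφ F := by
    refine ⟨by rw [Finsupp.smul_apply, map_smul, (hφ F).1], fun h => ?_⟩
    exact (hφ F).2 fun h1 => h (by rw [Finsupp.smul_apply, h1, smul_zero])

variable {L : Set (Finset V)}

theorem single_mem_polyChains {F : Finset V} (hF : F ∈ L) {p : MvPolynomial V k}
    (hp : restrictVars k F p = p) : Finsupp.single F p ∈ polyChains k L F.card := by
  intro F'
  by_cases h : F = F'
  · subst h
    rw [Finsupp.single_eq_same]
    exact ⟨hp, fun _ => ⟨hF, rfl⟩⟩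
  · rw [Finsupp.single_eq_of_ne (Ne.symm h)]
    exact ⟨map_zero _, fun h' => absurd rfl h'⟩

theorem polyChains_le {j : ℕ} {N : Submodule k (PolyChain V k)}
    (h : ∀ F ∈ L, F.card = j → ∀ p, restrictVars k F p = p → Finsupp.single F p ∈ N) :
    polyChains k L j ≤ N := by
  intro φ hφ
  rw [← Finsupp.sum_single φ]
  refine Submodule.sum_mem _ fun F hF => ?_
  have h1 := (hφ F).2 (Finsupp.mem_support_iff.1 hF)
  exact h F h1.1 h1.2 _ (hφ F).1

theorem faceMul_mem_polyChains (q : MvPolynomial V k) {j : ℕ} {φ : PolyChain V k}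
    (hφ : φ ∈ polyChains k L j) : faceMul q φ ∈ polyChains k L j := by
  intro F
  rw [faceMul_apply, map_mul, restrictVars_restrictVars (Finset.Subset.refl F), (hφ F).1]
  exact ⟨rfl, fun h => (hφ F).2 (right_ne_zero_of_mul h)⟩

/-- The coefficients of a monomial. -/
noncomputable def coeffChain (a : V →₀ ℕ) : PolyChain V k →ₗ[k] (Finset V →₀ k) :=
  Finsupp.mapRange.linearMap (MvPolynomial.lcoeff k a)

theorem coeffChain_apply (a : V →₀ ℕ) (φ : PolyChain V k) (F : Finset V) :
    coeffChain a φ F = MvPolynomial.coeff a (φ F) := rfl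

theorem coeffChain_single (a : V →₀ ℕ) (F : Finset V) (p : MvPolynomial V k) :
    coeffChain a (Finsupp.single F p) = Finsupp.single F (MvPolynomial.coeff a p) := by
  rw [coeffChain, Finsupp.mapRange.linearMap_apply, Finsupp.mapRange_single]
  rfl

/-- Multiplication of a chain by a monomial. -/
noncomputable def monomialChain (a : V →₀ ℕ) : (Finset V →₀ k) →ₗ[k] PolyChain V k :=
  Finsupp.mapRange.linearMap (MvPolynomial.monomial a)

theorem monomialChain_apply (a : V →₀ ℕ) (c : Finset V →₀ k) (F : Finset V) :
    monomialChain a c F = MvPolynomial.monomial a (c F) := rfl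

theorem monomialChain_single (a : V →₀ ℕ) (F : Finset V) (r : k) :
    monomialChain a (Finsupp.single F r) = Finsupp.single F (MvPolynomial.monomial a r) := by
  rw [monomialChain, Finsupp.mapRange.linearMap_apply, Finsupp.mapRange_single]

theorem coeffChain_mem_supported (a : V →₀ ℕ) {j : ℕ} {φ : PolyChain V k}
    (hφ : φ ∈ polyChains k L j) :
    coeffChain a φ ∈ Finsupp.supported k k (starFaces L a.support j) := by
  refine (Finsupp.mem_supported' _ _).2 fun F hF => ?_
  rw [coeffChain_apply]
  by_contra h
  have h1 : φ F ≠ 0 := fun h' => h (by rw [h', MvPolynomial.coeff_zero])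
  rw [← (hφ F).1, coeff_restrictVars] at h
  split_ifs at h with h2
  · exact hF ⟨((hφ F).2 h1).1, h2, ((hφ F).2 h1).2⟩
  · exact h rfl

theorem monomialChain_mem_polyChains {a : V →₀ ℕ} {j : ℕ} {c : Finset V →₀ k}
    (hc : c ∈ Finsupp.supported k k (starFaces L a.support j)) :
    monomialChain a c ∈ polyChains k L j := by
  refine forall_mem_supported ((polyChains k L j).comap (monomialChain a)) (fun F hF => ?_) hc
  rw [Submodule.mem_comap, monomialChain_single, ← hF.2.2]
  exact single_mem_polyChains hF.1 (by rw [restrictVars_monomial, if_pos hF.2.1])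

/-- The monomial survives restriction to F without v exactly when v is not in its support. So the
part of multidegree a is the chain complex of the star of the support of a. -/
theorem polyBoundary_monomialChain {a : V →₀ ℕ} {c : Finset V →₀ k}
    (hc : c ∈ Finsupp.supported k k {F | a.support ⊆ F}) :
    polyBoundary V k (monomialChain a c) = monomialChain a (starBoundary k a.support c) := by
  refine forall_mem_supported (LinearMap.eqLocus ((polyBoundary V k).comp (monomialChain a))
    ((monomialChain a).comp (starBoundary k a.support))) (fun F hF => ?_) hc
  rw [LinearMap.mem_eqLocus, LinearMap.comp_apply, LinearMap.comp_apply, monomialChain_single,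
    polyBoundary_single, starBoundary_single, map_sum]
  rw [← Finset.sum_subset (Finset.sdiff_subset (s := F) (t := a.support))]
  · refine Finset.sum_congr rfl fun v hv => ?_
    rw [Finset.mem_sdiff] at hv
    rw [monomialChain_single, restrictVars_monomial,
      if_pos (Finset.subset_erase.2 ⟨hF, hv.2⟩), MvPolynomial.smul_monomial, one_mul,
      smul_eq_mul, mul_one]
  · intro v hv hv'
    rw [restrictVars_monomial, if_neg, smul_zero, Finsupp.single_zero]
    intro h
    exact hv' (Finset.mem_sdiff.2 ⟨hv, (Finset.subset_erase.1 h).2⟩)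

theorem coeffChain_polyBoundary (a : V →₀ ℕ) {j : ℕ} {φ : PolyChain V k}
    (hφ : φ ∈ polyChains k L j) :
    coeffChain a (polyBoundary V k φ) = starBoundary k a.support (coeffChain a φ) := by
  refine polyChains_le (N := LinearMap.eqLocus ((coeffChain a).comp (polyBoundary V k))
    ((starBoundary k a.support).comp (coeffChain a))) (fun F _ _ p hp => ?_) hφ
  rw [LinearMap.mem_eqLocus, LinearMap.comp_apply, LinearMap.comp_apply, coeffChain_single,
    polyBoundary_single, starBoundary_single, map_sum]
  simp only [coeffChain_single, MvPolynomial.coeff_smul, coeff_restrictVars]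
  rw [← Finset.sum_subset (Finset.sdiff_subset (s := F) (t := a.support))]
  · refine Finset.sum_congr rfl fun v hv => ?_
    rw [Finset.mem_sdiff] at hv
    by_cases h : a.support ⊆ F
    · rw [if_pos (Finset.subset_erase.2 ⟨h, hv.2⟩), smul_eq_mul, mul_comm]
    · rw [if_neg fun h' => h (h'.trans (Finset.erase_subset _ _)), ← hp, coeff_restrictVars,
        if_neg h, smul_zero, zero_mul]
  · intro v hv hv'
    rw [if_neg, smul_zero, Finsupp.single_zero]
    intro h
    exact hv' (Finset.mem_sdiff.2 ⟨hv, (Finset.subset_erase.1 h).2⟩)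

theorem sum_monomialChain_coeffChain (φ : PolyChain V k) :
    ∃ A : Finset (V →₀ ℕ), (∀ a ∈ A, ∃ F, φ F ≠ 0 ∧ MvPolynomial.coeff a (φ F) ≠ 0) ∧
      φ = ∑ a ∈ A, monomialChain a (coeffChain a φ) := by
  classical
  refine ⟨φ.support.biUnion fun F => (φ F).support, fun a ha => ?_, ?_⟩
  · obtain ⟨F, hF, haF⟩ := Finset.mem_biUnion.1 ha
    exact ⟨F, Finsupp.mem_support_iff.1 hF, MvPolynomial.mem_support_iff.1 haF⟩
  · ext1 F
    rw [Finsupp.finsetSum_apply]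
    simp only [monomialChain_apply, coeffChain_apply]
    conv_lhs => rw [MvPolynomial.as_sum (φ F)]
    by_cases hF : φ F = 0
    · simp [hF]
    · refine Finset.sum_subset (fun a ha => ?_) fun a _ ha => ?_
      · exact Finset.mem_biUnion.2 ⟨F, Finsupp.mem_support_iff.2 hF, ha⟩
      · rw [MvPolynomial.notMem_support_iff.1 ha, MvPolynomial.monomial_zero]

theorem support_mem_of_coeff_ne_zero (hL : IsLowerSet L) {j : ℕ} {φ : PolyChain V k}
    (hφ : φ ∈ polyChains k L j) {a : V →₀ ℕ} {F : Finset V}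
    (h : MvPolynomial.coeff a (φ F) ≠ 0) : a.support ∈ L := by
  by_contra h'
  have h1 := (Finsupp.mem_supported' _ _).1 (coeffChain_mem_supported a hφ) F
    (fun hF => h' (hL hF.2.1 hF.1))
  exact h h1

variable {d : ℕ}

/-- Exactness is checked one monomial at a time, where it is exactness of the star of the support.
-/
theorem IsSphereComplex.map_polyChains (h : IsSphereComplex k L d) {j : ℕ} (hj : j < d) :
    (polyChains k L (j + 1)).map (polyBoundary V k) =
      polyChains k L j ⊓ LinearMap.ker (polyBoundary V k) := by
  refine le_antisymm ?_ ?_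
  · rintro _ ⟨φ, hφ, rfl⟩
    obtain ⟨A, -, hA⟩ := sum_monomialChain_coeffChain φ
    rw [hA, map_sum]
    refine Submodule.sum_mem _ fun a _ => ?_
    have h1 := coeffChain_mem_supported a hφ
    have h2 := starBoundary_mem_supported h.isLowerSet a.support j _ h1
    rw [polyBoundary_monomialChain (supported_starFaces_le _ _ _ h1)]
    refine ⟨monomialChain_mem_polyChains h2, ?_⟩
    rw [SetLike.mem_coe, LinearMap.mem_ker,
      polyBoundary_monomialChain (supported_starFaces_le _ _ _ h2), starBoundary_starBoundary,
      map_zero]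
  · rintro φ ⟨hφ, hφ0⟩
    obtain ⟨A, hA1, hA⟩ := sum_monomialChain_coeffChain φ
    rw [hA]
    refine Submodule.sum_mem _ fun a ha => ?_
    obtain ⟨F, -, hF⟩ := hA1 a ha
    have h1 := coeffChain_polyBoundary a hφ
    rw [LinearMap.mem_ker.1 hφ0, map_zero] at h1
    obtain ⟨b, hb, hb'⟩ := h.exact a.support (support_mem_of_coeff_ne_zero h.isLowerSet hφ hF) j hj
      _ (coeffChain_mem_supported a hφ) h1.symm
    refine ⟨monomialChain a b, monomialChain_mem_polyChains hb, ?_⟩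
    rw [polyBoundary_monomialChain (supported_starFaces_le _ _ _ hb), hb']

/-! ### A linear system of parameters -/

/-- The linear form with coefficients `τ v ^ l`. -/
noncomputable def powerForm (τ : V → k) (X : Finset V) (l : ℕ) : MvPolynomial V k :=
  ∑ v ∈ X, MvPolynomial.C (τ v ^ l) * MvPolynomial.X v

theorem restrictVars_powerForm (τ : V → k) {X F : Finset V} (hF : F ⊆ X) (l : ℕ) :
    restrictVars k F (powerForm τ X l) = powerForm τ F l := by
  rw [powerForm, map_sum, powerForm, ← Finset.sum_subset hF]
  · refine Finset.sum_congr rfl fun v hv => ?_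
    rw [map_mul, restrictVars_X, if_pos hv, ← MvPolynomial.algebraMap_eq, AlgHom.commutes]
  · intro v _ hv
    rw [map_mul, restrictVars_X, if_neg hv, mul_zero]

/-- The coefficients of the Lagrange basis form the inverse of the Vandermonde matrix; this and the
next lemma are the two one-sided inverse identities. -/
theorem sum_coeff_basis_mul_pow [DecidableEq V] {τ : V → k} {F : Finset V} (hτ : Set.InjOn τ F)
    {v w : V} (hv : v ∈ F) (hw : w ∈ F) :
    ∑ m ∈ Finset.range F.card, (Lagrange.basis F τ v).coeff m * τ w ^ m =
      if v = w then 1 else 0 := by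
  have hpos : 0 < F.card := Finset.card_pos.2 ⟨v, hv⟩
  rw [← Polynomial.eval_eq_sum_range' (by rw [Lagrange.natDegree_basis hτ hv]; omega)]
  split_ifs with h
  · rw [← h, Lagrange.eval_basis_self hτ hv]
  · exact Lagrange.eval_basis_of_ne h hw

theorem sum_pow_mul_coeff_basis [DecidableEq V] {τ : V → k} {F : Finset V} (hτ : Set.InjOn τ F)
    {l : ℕ} (hl : l < F.card) (m : ℕ) :
    ∑ v ∈ F, τ v ^ l * (Lagrange.basis F τ v).coeff m = if m = l then 1 else 0 := by
  have h := Lagrange.eq_interpolate (s := F) (v := τ) (f := (Polynomial.X : Polynomial k) ^ l) hτ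
    (by rw [Polynomial.degree_X_pow]; exact_mod_cast hl)
  have h1 := congrArg (fun q : Polynomial k => q.coeff m) h
  simp only [Lagrange.interpolate_apply, Polynomial.finsetSum_coeff, Polynomial.coeff_C_mul,
    Polynomial.eval_pow, Polynomial.eval_X, Polynomial.coeff_X_pow] at h1
  exact h1.symm

/-- The coordinate change on the variables of `F` sending the forms `powerForm τ F m` to
variables. -/
noncomputable def toPowerCoords [DecidableEq V] (τ : V → k) (F : Finset V) :
    MvPolynomial V k →ₐ[k] MvPolynomial ℕ k :=
  MvPolynomial.aeval fun v => if v ∈ F then ∑ m ∈ Finset.range F.card,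
    MvPolynomial.C ((Lagrange.basis F τ v).coeff m) * MvPolynomial.X m else 0

/-- The inverse coordinate change. -/
noncomputable def ofPowerCoords (τ : V → k) (F : Finset V) :
    MvPolynomial ℕ k →ₐ[k] MvPolynomial V k :=
  MvPolynomial.aeval fun m => powerForm τ F m

theorem ofPowerCoords_toPowerCoords [DecidableEq V] {τ : V → k} {F : Finset V}
    (hτ : Set.InjOn τ F) (p : MvPolynomial V k) :
    ofPowerCoords τ F (toPowerCoords τ F p) = restrictVars k F p := by
  have : (ofPowerCoords τ F).comp (toPowerCoords τ F) = restrictVars k F := by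
    ext1 v
    rw [AlgHom.comp_apply, toPowerCoords, MvPolynomial.aeval_X, restrictVars_X]
    split_ifs with hv
    · rw [map_sum]
      simp only [map_mul, ofPowerCoords, MvPolynomial.aeval_X, ← MvPolynomial.algebraMap_eq,
        AlgHom.commutes]
      simp only [MvPolynomial.algebraMap_eq, powerForm, Finset.mul_sum, ← mul_assoc, ← map_mul]
      rw [Finset.sum_comm]
      simp only [← Finset.sum_mul, ← map_sum]
      rw [Finset.sum_congr rfl fun w hw => by rw [sum_coeff_basis_mul_pow hτ hv hw]]
      rw [Finset.sum_eq_single v]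
      · simp
      · intro w _ hw
        simp [Ne.symm hw]
      · exact fun h => absurd hv h
    · rw [map_zero]
  exact DFunLike.congr_fun this p

theorem toPowerCoords_powerForm [DecidableEq V] {τ : V → k} {F : Finset V}
    (hτ : Set.InjOn τ F) {l : ℕ} (hl : l < F.card) :
    toPowerCoords τ F (powerForm τ F l) = MvPolynomial.X l := by
  rw [powerForm, map_sum]
  have : ∀ v ∈ F, toPowerCoords τ F (MvPolynomial.C (τ v ^ l) * MvPolynomial.X v) =
      ∑ m ∈ Finset.range F.card,
        MvPolynomial.C (τ v ^ l * (Lagrange.basis F τ v).coeff m) * MvPolynomial.X m := by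
    intro v hv
    rw [map_mul, toPowerCoords, MvPolynomial.aeval_X, if_pos hv, MvPolynomial.aeval_C,
      MvPolynomial.algebraMap_eq, Finset.mul_sum]
    exact Finset.sum_congr rfl fun m _ => by rw [map_mul, mul_assoc]
  rw [Finset.sum_congr rfl this, Finset.sum_comm]
  simp only [← Finset.sum_mul, ← map_sum]
  rw [Finset.sum_congr rfl fun m _ => by rw [sum_pow_mul_coeff_basis hτ hl m]]
  rw [Finset.sum_eq_single l]
  · simp
  · intro m _ hm
    simp [hm]
  · exact fun h => absurd (Finset.mem_range.2 hl) h

theorem mem_span_X_of_X_mul_mem {l : ℕ} {s : Set ℕ} (hl : l ∉ s) {p : MvPolynomial ℕ k}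
    (h : MvPolynomial.X l * p ∈ Ideal.span (MvPolynomial.X '' s)) :
    p ∈ Ideal.span (MvPolynomial.X '' s) := by
  rw [MvPolynomial.mem_ideal_span_X_image] at h ⊢
  intro m hm
  obtain ⟨i, hi, him⟩ := h (Finsupp.single l 1 + m) (by
    rw [MvPolynomial.mem_support_iff, MvPolynomial.coeff_X_mul]
    exact MvPolynomial.mem_support_iff.1 hm)
  refine ⟨i, hi, ?_⟩
  have : l ≠ i := fun h' => hl (h' ▸ hi)
  rwa [Finsupp.add_apply, Finsupp.single_eq_of_ne (Ne.symm this), zero_add] at him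

/-- For distinct parameters the first |F| power forms are linear coordinates on the variables of F.
In these coordinates the claim is that variables form a regular sequence. -/
theorem exists_eq_sum_powerForm_mul {τ : V → k} {F : Finset V} (hτ : Set.InjOn τ F) {l : ℕ}
    (hl : l < F.card) {p : MvPolynomial V k} (hp : restrictVars k F p = p)
    {q : ℕ → MvPolynomial V k}
    (h : powerForm τ F l * p = ∑ i ∈ Finset.range l, powerForm τ F i * q i) :
    ∃ q' : ℕ → MvPolynomial V k, (∀ i, restrictVars k F (q' i) = q' i) ∧
      p = ∑ i ∈ Finset.range l, powerForm τ F i * q' i := by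
  classical
  have h1 := congrArg (toPowerCoords τ F) h
  rw [map_mul, toPowerCoords_powerForm hτ hl, map_sum] at h1
  have h2 : MvPolynomial.X l * toPowerCoords τ F p ∈
      Ideal.span ((MvPolynomial.X : ℕ → MvPolynomial ℕ k) '' (Finset.range l : Set ℕ)) := by
    rw [h1]
    refine Ideal.sum_mem _ fun i hi => ?_
    rw [map_mul, toPowerCoords_powerForm hτ ((Finset.mem_range.1 hi).trans hl)]
    exact Ideal.mul_mem_right _ _ (Ideal.subset_span ⟨i, hi, rfl⟩)
  have h3 := mem_span_X_of_X_mul_mem (by simp) h2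
  obtain ⟨c, hc⟩ : ∃ c : ℕ → MvPolynomial ℕ k,
      ∑ i ∈ Finset.range l, MvPolynomial.X i * c i = toPowerCoords τ F p := by
    obtain ⟨c, hc⟩ := (Submodule.mem_span_image_finset_iff_exists_fun _).1 h3
    refine ⟨fun i => if hi : i ∈ Finset.range l then c ⟨i, hi⟩ else 0, ?_⟩
    rw [← hc, ← Finset.sum_coe_sort (Finset.range l)]
    refine Finset.sum_congr rfl fun i _ => ?_
    rw [smul_eq_mul, mul_comm]
    congr 1
    exact dif_pos i.2
  have h4 : ∀ i, restrictVars k F (ofPowerCoords τ F (MvPolynomial.X i)) = powerForm τ F i := by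
    intro i
    rw [ofPowerCoords, MvPolynomial.aeval_X, restrictVars_powerForm τ (Finset.Subset.refl F)]
  refine ⟨fun i => restrictVars k F (ofPowerCoords τ F (c i)),
    fun i => restrictVars_restrictVars (Finset.Subset.refl F) _, ?_⟩
  have h5 := congrArg (fun u => restrictVars k F (ofPowerCoords τ F u)) hc
  simp only [ofPowerCoords_toPowerCoords hτ, hp, map_sum, map_mul, h4] at h5
  exact h5.symm

theorem exists_eq_sum_of_mem_seqSpan {τ : V → k} {X : Finset V} (hX : ∀ F ∈ L, F ⊆ X) {j l : ℕ}
    {φ : PolyChain V k}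
    (hφ : φ ∈ seqSpan (fun i => faceMul (powerForm τ X i)) (polyChains k L j) l) {F : Finset V}
    (hF : F ∈ L) : ∃ q : ℕ → MvPolynomial V k,
      φ F = ∑ i ∈ Finset.range l, powerForm τ F i * q i := by
  induction l generalizing φ with
  | zero =>
    rw [seqSpan, Submodule.mem_bot] at hφ
    exact ⟨0, by simp [hφ]⟩
  | succ l ih =>
    obtain ⟨p, hp, _, ⟨b, hb, rfl⟩, rfl⟩ := Submodule.mem_sup.1 hφ
    obtain ⟨q, hq⟩ := ih hp
    refine ⟨Function.update q l (b F), ?_⟩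
    rw [Finset.sum_range_succ, Function.update_self, Finsupp.add_apply, faceMul_apply,
      restrictVars_powerForm τ (hX F hF), hq]
    congr 1
    refine Finset.sum_congr rfl fun i hi => ?_
    rw [Function.update_of_ne (Finset.mem_range.1 hi).ne]

/-- The module is a direct sum of polynomial rings in j variables, one for each face with j
vertices, and on each of them the first j forms restrict to coordinates. -/
theorem isRegularSeq_polyChains {τ : V → k} {X : Finset V} (hτ : Set.InjOn τ X)
    (hX : ∀ F ∈ L, F ⊆ X) (j : ℕ) :
    IsRegularSeq (fun i => faceMul (powerForm τ X i)) (polyChains k L j) j := by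
  intro l hl φ hφ htφ
  rw [← Finsupp.sum_single φ]
  refine Submodule.sum_mem _ fun F hF => ?_
  obtain ⟨hFL, hFj⟩ := (hφ F).2 (Finsupp.mem_support_iff.1 hF)
  obtain ⟨q, hq⟩ := exists_eq_sum_of_mem_seqSpan hX htφ hFL
  rw [faceMul_apply, restrictVars_powerForm τ (hX F hFL)] at hq
  obtain ⟨q', hq'1, hq'2⟩ := exists_eq_sum_powerForm_mul
    (hτ.mono (Finset.coe_subset.2 (hX F hFL))) (by omega) (hφ F).1 hq
  rw [hq'2, Finsupp.single_finsetSum]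
  refine Submodule.sum_mem _ fun i hi => ?_
  have := faceMul_single (powerForm τ X i) F (q' i)
  rw [restrictVars_powerForm τ (hX F hFL)] at this
  rw [← this]
  exact apply_mem_seqSpan_of_lt (t := fun i => faceMul (powerForm τ X i)) (Finset.mem_range.1 hi)
    (hFj ▸ single_mem_polyChains hFL (hq'1 i))

/-- The cycles with polynomial coefficients of a homology sphere have maximal depth. -/
theorem IsSphereComplex.isRegularSeq (h : IsSphereComplex k L d) {τ : V → k} {X : Finset V}
    (hτ : Set.InjOn τ X) (hX : ∀ F ∈ L, F ⊆ X) : ∀ j ≤ d,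
    IsRegularSeq (fun i => faceMul (powerForm τ X i))
      (polyChains k L j ⊓ LinearMap.ker (polyBoundary V k)) j
  | 0, _ => fun l hl => absurd hl (by omega)
  | j + 1, hj => by
    -- By exactness the cycles of level j+1 are the kernel of a map from a module of depth j+1 onto
    -- the cycles of level j, which have depth at least j by induction.
    refine (isRegularSeq_polyChains hτ hX (j + 1)).inf_ker (fun _ _ => faceMul_comm _ _)
      (fun _ => polyBoundary_faceMul _) (fun _ _ => faceMul_mem_polyChains _) ?_
    rw [h.map_polyChains (by omega)]
    exact h.isRegularSeq hτ hX j (by omega)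

end PolynomialChains

/-! ### Hilbert functions of graded modules with regular sequences -/

section GradedRegularSequence

variable {k E : Type*} [Field k] [AddCommGroup E] [Module k E]

/-- The degree `i` part of the sum of the images of a graded module with pieces `N` under the first
`l` operators, all of degree one. -/
def gradedSeqSpan (t : ℕ → E →ₗ[k] E) (N : ℕ → Submodule k E) : ℕ → ℕ → Submodule k E
  | 0, _ => ⊥
  | _ + 1, 0 => ⊥
  | l + 1, i + 1 => gradedSeqSpan t N l (i + 1) ⊔ (N i).map (t l)

/-- The Hilbert function of the quotient by the images of the first `l` operators. -/
noncomputable def quotientHilbert (t : ℕ → E →ₗ[k] E) (N : ℕ → Submodule k E) (l i : ℕ) : ℤ :=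
  (Module.finrank k (N i) : ℤ) - Module.finrank k (gradedSeqSpan t N l i)

/-- The submodules `N i` are the graded pieces of `M`, with projections `pr i`, and the operators
are of degree one. -/
structure IsGradedBy (t : ℕ → E →ₗ[k] E) (M : Submodule k E) (pr : ℕ → E →ₗ[k] E)
    (N : ℕ → Submodule k E) : Prop where
  comm : ∀ i j x, t i (t j x) = t j (t i x)
  mem : ∀ i, ∀ x ∈ M, t i x ∈ M
  piece_le : ∀ i, N i ≤ M
  finite : ∀ i, FiniteDimensional k (N i)
  apply_mem : ∀ l i, ∀ x ∈ N i, t l x ∈ N (i + 1)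
  pr_mem : ∀ i, ∀ x ∈ M, pr i x ∈ N i
  pr_eq : ∀ i, ∀ x ∈ N i, pr i x = x
  pr_zero : ∀ l, ∀ x ∈ M, pr 0 (t l x) = 0
  pr_succ : ∀ l i, ∀ x ∈ M, pr (i + 1) (t l x) = t l (pr i x)

variable {t : ℕ → E →ₗ[k] E} {M : Submodule k E} {pr : ℕ → E →ₗ[k] E} {N : ℕ → Submodule k E}

theorem gradedSeqSpan_zero (l : ℕ) : gradedSeqSpan t N l 0 = ⊥ := by
  cases l <;> rw [gradedSeqSpan]

theorem map_le_gradedSeqSpan {l m : ℕ} (h : l < m) (i : ℕ) :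
    (N i).map (t l) ≤ gradedSeqSpan t N m (i + 1) := by
  induction m with
  | zero => omega
  | succ m ih =>
    rw [gradedSeqSpan]
    rcases Nat.lt_succ_iff_lt_or_eq.1 h with h' | rfl
    · exact (ih h').trans le_sup_left
    · exact le_sup_right

namespace IsGradedBy

variable (h : IsGradedBy t M pr N)
include h

theorem gradedSeqSpan_le (l i : ℕ) : gradedSeqSpan t N l i ≤ N i := by
  induction l generalizing i with
  | zero => rw [gradedSeqSpan]; exact bot_le
  | succ l ih =>
    cases i with
    | zero => rw [gradedSeqSpan]; exact bot_le
    | succ i =>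
      rw [gradedSeqSpan]
      exact sup_le (ih _) (Submodule.map_le_iff_le_comap.2 (h.apply_mem l i))

theorem gradedSeqSpan_le_seqSpan (l i : ℕ) : gradedSeqSpan t N l i ≤ seqSpan t M l := by
  induction l generalizing i with
  | zero => rw [gradedSeqSpan]; exact bot_le
  | succ l ih =>
    cases i with
    | zero => rw [gradedSeqSpan]; exact bot_le
    | succ i =>
      rw [gradedSeqSpan]
      exact sup_le_sup (ih _) (Submodule.map_mono (h.piece_le i))

theorem pr_mem_gradedSeqSpan (l i : ℕ) {x : E} (hx : x ∈ seqSpan t M l) :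
    pr i x ∈ gradedSeqSpan t N l i := by
  induction l generalizing i x with
  | zero =>
    rw [seqSpan, Submodule.mem_bot] at hx
    rw [hx, map_zero]
    exact zero_mem _
  | succ l ih =>
    obtain ⟨p, hp, _, ⟨b, hb, rfl⟩, rfl⟩ := Submodule.mem_sup.1 hx
    rw [map_add]
    cases i with
    | zero =>
      rw [h.pr_zero l b hb, add_zero, gradedSeqSpan_zero, ← gradedSeqSpan_zero (t := t) (N := N) l]
      exact ih 0 hp
    | succ i =>
      rw [h.pr_succ l i b hb]
      exact Submodule.add_mem_sup (ih _ hp) ⟨_, h.pr_mem i b hb, rfl⟩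

theorem apply_mem_gradedSeqSpan (m l i : ℕ) {x : E} (hx : x ∈ gradedSeqSpan t N l i) :
    t m x ∈ gradedSeqSpan t N l (i + 1) := by
  have h1 := h.pr_mem_gradedSeqSpan l (i + 1)
    (apply_mem_seqSpan h.comm h.mem m (h.gradedSeqSpan_le_seqSpan l i hx))
  have h2 := h.gradedSeqSpan_le l i hx
  rwa [h.pr_succ m i x (h.piece_le i h2), h.pr_eq i x h2] at h1

theorem finiteDimensional_gradedSeqSpan (l i : ℕ) :
    FiniteDimensional k (gradedSeqSpan t N l i) :=
  have := h.finite i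
  Submodule.finiteDimensional_of_le (h.gradedSeqSpan_le l i)

/-- Regularity makes t_l injective from degree i to degree i+1 of the current quotient, so passing
to its cokernel subtracts the dimension in degree i. -/
theorem quotientHilbert_succ {d l : ℕ} (hreg : IsRegularSeq t M d) (hl : l < d) (i : ℕ) :
    quotientHilbert t N (l + 1) (i + 1) =
      quotientHilbert t N l (i + 1) - quotientHilbert t N l i := by
  set Q := gradedSeqSpan t N l (i + 1) with hQ
  have hT : gradedSeqSpan t N (l + 1) (i + 1) = Q ⊔ (N i).map (t l) := by rw [gradedSeqSpan]
  have := h.finite i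
  have := h.finiteDimensional_gradedSeqSpan (l + 1) (i + 1)
  have h1 := finrank_map_add_finrank_inf_ker (Q.mkQ ∘ₗ t l) (N i)
  have h2 := finrank_map_add_finrank_inf_ker Q.mkQ (gradedSeqSpan t N (l + 1) (i + 1))
  have h3 : N i ⊓ LinearMap.ker (Q.mkQ ∘ₗ t l) = gradedSeqSpan t N l i := by
    refine le_antisymm ?_ fun x hx => ⟨h.gradedSeqSpan_le l i hx, ?_⟩
    · rintro x ⟨hx, hx'⟩
      rw [SetLike.mem_coe, LinearMap.mem_ker, LinearMap.comp_apply, Submodule.mkQ_apply,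
        Submodule.Quotient.mk_eq_zero] at hx'
      rw [← h.pr_eq i x hx]
      exact h.pr_mem_gradedSeqSpan l i
        (hreg l hl x (h.piece_le i hx) (h.gradedSeqSpan_le_seqSpan l _ hx'))
    · rw [SetLike.mem_coe, LinearMap.mem_ker, LinearMap.comp_apply, Submodule.mkQ_apply,
        Submodule.Quotient.mk_eq_zero]
      exact h.apply_mem_gradedSeqSpan l l i hx
  have h4 : gradedSeqSpan t N (l + 1) (i + 1) ⊓ LinearMap.ker Q.mkQ = Q := by
    rw [Submodule.ker_mkQ, hT]
    exact inf_eq_right.2 le_sup_left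
  have h5 : (gradedSeqSpan t N (l + 1) (i + 1)).map Q.mkQ = (N i).map (Q.mkQ ∘ₗ t l) := by
    rw [hT, Submodule.map_sup, Submodule.map_comp, Submodule.mkQ_map_self,
      bot_sup_eq]
  rw [h3] at h1
  rw [h4, h5] at h2
  rw [quotientHilbert, quotientHilbert, quotientHilbert, ← hQ]
  omega

theorem mk_quotientHilbert {d l : ℕ} (hreg : IsRegularSeq t M d) (hl : l ≤ d) :
    PowerSeries.mk (quotientHilbert t N l) =
      (1 - PowerSeries.X) ^ l * PowerSeries.mk fun i => (Module.finrank k (N i) : ℤ) := by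
  induction l with
  | zero =>
    rw [pow_zero, one_mul]
    ext i
    rw [PowerSeries.coeff_mk, PowerSeries.coeff_mk, quotientHilbert, gradedSeqSpan, finrank_bot]
    simp
  | succ l ih =>
    rw [pow_succ', mul_assoc, ← ih (by omega), sub_mul, one_mul]
    ext i
    cases i with
    | zero =>
      rw [map_sub, PowerSeries.coeff_zero_X_mul, PowerSeries.coeff_mk, PowerSeries.coeff_mk,
        quotientHilbert, quotientHilbert, gradedSeqSpan_zero, gradedSeqSpan_zero, sub_zero]
    | succ i =>
      rw [map_sub, PowerSeries.coeff_succ_X_mul, PowerSeries.coeff_mk, PowerSeries.coeff_mk,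
        PowerSeries.coeff_mk, h.quotientHilbert_succ hreg (by omega)]

theorem quotientHilbert_le {l i : ℕ} {W : Submodule k E} [FiniteDimensional k W]
    (hW : N i ≤ gradedSeqSpan t N l i ⊔ W) : quotientHilbert t N l i ≤ Module.finrank k W := by
  have := h.finiteDimensional_gradedSeqSpan l i
  have h1 := Submodule.finrank_mono hW
  have h2 := Submodule.finrank_add_le_finrank_add_finrank (gradedSeqSpan t N l i) W
  rw [quotientHilbert]
  omega

end IsGradedBy

end GradedRegularSequence

/-! ### Counting the monomials supported on faces -/

section Counting

variable {V : Type*}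

/-- The series is x/(1-x), the generating function of positive exponents; its power counts the
monomials whose support is exactly F. -/
theorem coeff_prod_mk_pos [DecidableEq V] (F : Finset V) (i : ℕ) :
    PowerSeries.coeff i ((PowerSeries.mk fun m => if m = 0 then (0 : ℤ) else 1) ^ F.card) =
      (((F.finsuppAntidiag i).filter fun a => a.support = F).card : ℤ) := by
  rw [← Finset.prod_const, PowerSeries.coeff_prod, Finset.card_filter, Nat.cast_sum]
  refine Finset.sum_congr rfl fun a ha => ?_
  rw [Finset.mem_finsuppAntidiag] at ha
  simp only [PowerSeries.coeff_mk]
  split_ifs with h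
  · rw [Nat.cast_one]
    refine Finset.prod_eq_one fun v hv => if_neg ?_
    rwa [← h, Finsupp.mem_support_iff] at hv
  · obtain ⟨v, hv, hva⟩ : ∃ v ∈ F, v ∉ a.support := by
      by_contra! h'
      exact h (ha.2.antisymm h')
    rw [Nat.cast_zero]
    exact Finset.prod_eq_zero hv (if_pos (Finsupp.notMem_support_iff.1 hva))

theorem mk_card_filter_finsuppAntidiag [DecidableEq V] {Λ : Finset (Finset V)} {X : Finset V}
    (hX : ∀ F ∈ Λ, F ⊆ X) :
    (PowerSeries.mk fun i => (((X.finsuppAntidiag i).filter fun a => a.support ∈ Λ).card : ℤ)) =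
      ∑ F ∈ Λ, (PowerSeries.mk fun m => if m = 0 then (0 : ℤ) else 1) ^ F.card := by
  ext i
  rw [PowerSeries.coeff_mk, map_sum]
  simp only [coeff_prod_mk_pos]
  have hmaps : ∀ a ∈ (X.finsuppAntidiag i).filter (fun a => a.support ∈ Λ), a.support ∈ Λ :=
    fun a ha => (Finset.mem_filter.1 ha).2
  rw [← Nat.cast_sum, Nat.cast_inj, Finset.card_eq_sum_card_fiberwise hmaps]
  refine Finset.sum_congr rfl fun F hF => congrArg Finset.card ?_
  ext a
  simp only [Finset.mem_filter, Finset.mem_finsuppAntidiag']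
  constructor
  · rintro ⟨⟨⟨h1, h2⟩, h3⟩, rfl⟩
    exact ⟨⟨h1, subset_rfl⟩, rfl⟩
  · rintro ⟨⟨h1, h2⟩, rfl⟩
    exact ⟨⟨⟨h1, hX _ hF⟩, hF⟩, rfl⟩

theorem one_sub_X_mul_mk_pos :
    (1 - PowerSeries.X) * (PowerSeries.mk fun m => if m = 0 then (0 : ℤ) else 1) =
      PowerSeries.X := by
  ext i
  rw [sub_mul, one_mul, map_sub]
  rcases i with _ | _ | i
  · rw [PowerSeries.coeff_zero_X_mul, PowerSeries.coeff_mk]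
    simp
  · rw [PowerSeries.coeff_succ_X_mul, PowerSeries.coeff_mk, PowerSeries.coeff_mk]
    simp
  · rw [PowerSeries.coeff_succ_X_mul, PowerSeries.coeff_mk, PowerSeries.coeff_mk,
      PowerSeries.coeff_X]
    simp

theorem coeff_one_sub_X_pow (m j : ℕ) :
    PowerSeries.coeff j ((1 - PowerSeries.X : PowerSeries ℤ) ^ m) =
      (-1) ^ m * ((-1) ^ (m - j) * (m.choose j : ℤ)) := by
  have h : (1 - PowerSeries.X : PowerSeries ℤ) ^ m =
      (((-1 : Polynomial ℤ) ^ m * (Polynomial.X + Polynomial.C (-1)) ^ m : Polynomial ℤ) :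
        PowerSeries ℤ) := by
    rw [← mul_pow, Polynomial.coe_pow]
    congr 1
    have : (-1 : Polynomial ℤ) * (Polynomial.X + Polynomial.C (-1)) = 1 - Polynomial.X := by
      rw [map_neg, Polynomial.C_1]
      ring
    rw [this, Polynomial.coe_sub, Polynomial.coe_one, Polynomial.coe_X]
  rw [h, Polynomial.coeff_coe, ← Polynomial.C_1, ← Polynomial.C_neg, ← Polynomial.C_pow,
    Polynomial.coeff_C_mul, Polynomial.coeff_X_add_C_pow]

/-- A face with a vertices contributes (1-x)^d (x/(1-x))^a = x^a (1-x)^(d-a). Reading this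
polynomial backwards in degree d gives (x-1)^(d-a), the term that defines the h-vector. -/
theorem coeff_one_sub_X_pow_mul_sum {Λ : Finset (Finset V)} {d : ℕ} (hd : ∀ F ∈ Λ, F.card ≤ d)
    {i : ℕ} (hi : i ≤ d) :
    PowerSeries.coeff i ((1 - PowerSeries.X) ^ d *
      ∑ F ∈ Λ, (PowerSeries.mk fun m => if m = 0 then (0 : ℤ) else 1) ^ F.card) =
      hVector d (fun j => ((Λ.filter fun F => F.card = j).card : ℤ)) i := by
  have h1 : ∀ F ∈ Λ, PowerSeries.coeff i ((1 - PowerSeries.X) ^ d *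
      (PowerSeries.mk fun m => if m = 0 then (0 : ℤ) else 1) ^ F.card) =
        (((Polynomial.X : Polynomial ℤ) - 1) ^ (d - F.card)).coeff (d - i) := by
    intro F hF
    have h2 := hd F hF
    rw [← Nat.sub_add_cancel h2, pow_add, mul_assoc, ← mul_pow, one_sub_X_mul_mk_pos,
      PowerSeries.coeff_mul_X_pow', Nat.sub_add_cancel h2, coeff_one_sub_X_pow, sub_eq_add_neg,
      ← Polynomial.C_1, ← Polynomial.C_neg, Polynomial.coeff_X_add_C_pow]
    split_ifs with h3
    · rw [show d - F.card - (i - F.card) = d - i by omega,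
        show d - F.card - (d - i) = i - F.card by omega, ← mul_assoc, ← pow_add,
        Nat.choose_symm_of_eq_add (show d - F.card = (i - F.card) + (d - i) by omega),
        show d - F.card + (d - i) = (i - F.card) + 2 * (d - i) by omega, pow_add, pow_mul]
      simp
    · rw [Nat.choose_eq_zero_of_lt (by omega)]
      simp
  rw [Finset.mul_sum, map_sum, Finset.sum_congr rfl h1, hVector, Polynomial.finsetSum_coeff,
    ← Finset.sum_fiberwise_of_maps_to (t := Finset.range (d + 1)) (g := Finset.card)
      fun F hF => Finset.mem_range.2 (Nat.lt_succ_of_le (hd F hF))]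
  refine Finset.sum_congr rfl fun j _ => ?_
  rw [Polynomial.coeff_C_mul, Finset.sum_congr rfl fun F hF => by
    rw [(Finset.mem_filter.1 hF).2], Finset.sum_const, nsmul_eq_mul]

end Counting

/-! ### The face ring of a homology sphere acting on its fundamental cycle -/

section CycleMul

variable {V : Type*} [LinearOrder V] {k : Type*} [Field k]

theorem homogeneousComponent_mul_of_isHomogeneous {σ : Type*} {θ : MvPolynomial σ k} {m : ℕ}
    (hθ : θ.IsHomogeneous m) (i : ℕ) (p : MvPolynomial σ k) :
    MvPolynomial.homogeneousComponent (m + i) (θ * p) =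
      θ * MvPolynomial.homogeneousComponent i p := by
  induction p using MvPolynomial.induction_on' with
  | monomial a r =>
    have ha : (MvPolynomial.monomial a r).IsHomogeneous a.degree :=
      MvPolynomial.isHomogeneous_monomial r rfl
    rw [MvPolynomial.homogeneousComponent_of_mem (hθ.mul ha),
      MvPolynomial.homogeneousComponent_of_mem ha]
    by_cases h : a.degree = i
    · rw [if_pos h.symm, if_pos (by omega)]
    · rw [if_neg (Ne.symm h), if_neg (by omega), mul_zero]
  | add p q hp hq => rw [mul_add, map_add, map_add, mul_add, hp, hq]

theorem homogeneousComponent_zero_mul_of_isHomogeneous {σ : Type*} {θ : MvPolynomial σ k}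
    (hθ : θ.IsHomogeneous 1) (p : MvPolynomial σ k) :
    MvPolynomial.homogeneousComponent 0 (θ * p) = 0 := by
  induction p using MvPolynomial.induction_on' with
  | monomial a r =>
    have ha : (MvPolynomial.monomial a r).IsHomogeneous a.degree :=
      MvPolynomial.isHomogeneous_monomial r rfl
    rw [MvPolynomial.homogeneousComponent_of_mem (hθ.mul ha), if_neg (by omega)]
  | add p q hp hq => rw [mul_add, map_add, hp, hq, add_zero]

theorem isHomogeneous_powerForm (τ : V → k) (X : Finset V) (l : ℕ) :
    (powerForm τ X l).IsHomogeneous 1 := by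
  refine MvPolynomial.IsHomogeneous.sum _ _ _ fun v _ => ?_
  rw [← zero_add 1]
  exact (MvPolynomial.isHomogeneous_C _ _).mul (MvPolynomial.isHomogeneous_X _ _)

theorem homogeneousComponent_restrictVars (F : Finset V) (i : ℕ) (p : MvPolynomial V k) :
    MvPolynomial.homogeneousComponent i (restrictVars k F p) =
      restrictVars k F (MvPolynomial.homogeneousComponent i p) := by
  ext a
  rw [MvPolynomial.coeff_homogeneousComponent, coeff_restrictVars, coeff_restrictVars,
    MvPolynomial.coeff_homogeneousComponent]
  split_ifs <;> rfl

/-- The multiples of a chain by polynomials, restricted on each face to the variables of that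
face. -/
noncomputable def cycleMul (z : Finset V →₀ k) : MvPolynomial V k →ₗ[k] PolyChain V k :=
  ∑ F ∈ z.support, (Finsupp.lsingle F).comp (z F • (restrictVars k F).toLinearMap)

theorem cycleMul_apply (z : Finset V →₀ k) (p : MvPolynomial V k) (F : Finset V) :
    cycleMul z p F = z F • restrictVars k F p := by
  rw [cycleMul, LinearMap.sum_apply, Finsupp.finsetSum_apply]
  simp only [LinearMap.comp_apply, Finsupp.lsingle_apply, LinearMap.smul_apply,
    AlgHom.toLinearMap_apply]
  rw [Finset.sum_eq_single F]
  · rw [Finsupp.single_eq_same]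
  · intro F' _ h
    rw [Finsupp.single_eq_of_ne (Ne.symm h)]
  · intro h
    rw [Finsupp.notMem_support_iff.1 h, zero_smul, Finsupp.single_zero, Finsupp.zero_apply]

theorem faceMul_cycleMul (z : Finset V →₀ k) (q p : MvPolynomial V k) :
    faceMul q (cycleMul z p) = cycleMul z (q * p) := by
  ext1 F
  rw [faceMul_apply, cycleMul_apply, cycleMul_apply, map_mul, mul_smul_comm]

theorem cycleMul_monomial (z : Finset V →₀ k) (a : V →₀ ℕ) (r : k) :
    cycleMul z (MvPolynomial.monomial a r) =
      r • monomialChain a (z.filter fun F => a.support ⊆ F) := by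
  ext1 F
  rw [cycleMul_apply, restrictVars_monomial, Finsupp.smul_apply, monomialChain_apply,
    Finsupp.filter_apply]
  split_ifs
  · rw [MvPolynomial.smul_monomial, MvPolynomial.smul_monomial, smul_eq_mul, smul_eq_mul, mul_comm]
  · rw [smul_zero, MvPolynomial.monomial_zero, smul_zero]

variable {L : Set (Finset V)} {d : ℕ} {z : Finset V →₀ k}

theorem cycleMul_mem (hz : z ∈ starCycles k L ∅ d) (p : MvPolynomial V k) :
    cycleMul z p ∈ polyChains k L d ⊓ LinearMap.ker (polyBoundary V k) := by
  induction p using MvPolynomial.induction_on' with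
  | monomial a r =>
    rw [cycleMul_monomial]
    refine Submodule.smul_mem _ _ ?_
    have h := filter_mem_starCycles (Finset.empty_subset a.support) hz
    refine ⟨monomialChain_mem_polyChains h.1, ?_⟩
    rw [SetLike.mem_coe, LinearMap.mem_ker,
      polyBoundary_monomialChain (supported_starFaces_le _ _ _ h.1), LinearMap.mem_ker.1 h.2,
      map_zero]
  | add p q hp hq =>
    rw [map_add]
    exact add_mem hp hq

/-- In multidegree a, a top cycle is a top cycle of the star of the support of a, hence a multiple
of the restriction of z. -/
theorem IsSphereComplex.exists_eq_cycleMul (h : IsSphereComplex k L d)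
    (hgen : ∀ G ∈ L, ∀ c ∈ starCycles k L G d, ∃ r : k, c = r • z.filter fun F => G ⊆ F)
    {φ : PolyChain V k} (hφ : φ ∈ polyChains k L d ⊓ LinearMap.ker (polyBoundary V k)) :
    ∃ p, φ = cycleMul z p := by
  obtain ⟨A, hA1, hA⟩ := sum_monomialChain_coeffChain φ
  suffices φ ∈ LinearMap.range (cycleMul z) by
    obtain ⟨p, hp⟩ := this
    exact ⟨p, hp.symm⟩
  rw [hA]
  refine Submodule.sum_mem _ fun a ha => ?_
  obtain ⟨F, -, hF⟩ := hA1 a ha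
  have h1 := coeffChain_polyBoundary a hφ.1
  rw [LinearMap.mem_ker.1 hφ.2, map_zero] at h1
  obtain ⟨r, hr⟩ := hgen a.support (support_mem_of_coeff_ne_zero h.isLowerSet hφ.1 hF) _
    ⟨coeffChain_mem_supported a hφ.1, h1.symm⟩
  exact ⟨MvPolynomial.monomial a r, by rw [cycleMul_monomial, hr, map_smul]⟩

/-- The homogeneous multiples of degree `i` of a chain. -/
noncomputable def cyclePiece (z : Finset V →₀ k) (i : ℕ) : Submodule k (PolyChain V k) :=
  (MvPolynomial.homogeneousSubmodule V k i).map (cycleMul z)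

theorem cycleMul_monomial_mem_cyclePiece (z : Finset V →₀ k) (a : V →₀ ℕ) :
    cycleMul z (MvPolynomial.monomial a 1) ∈ cyclePiece z a.degree :=
  ⟨_, MvPolynomial.isHomogeneous_monomial 1 rfl, rfl⟩

theorem cycleMul_monomial_eq_zero (hL : IsLowerSet L) (hz : z ∈ starCycles k L ∅ d) {a : V →₀ ℕ}
    (ha : a.support ∉ L) (r : k) : cycleMul z (MvPolynomial.monomial a r) = 0 := by
  ext1 F
  rw [cycleMul_apply, restrictVars_monomial]
  split_ifs with h
  · rw [(Finsupp.mem_supported' _ _).1 hz.1 F fun hF => ha (hL h hF.1), zero_smul,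
      Finsupp.zero_apply]
  · rw [smul_zero, Finsupp.zero_apply]

theorem cyclePiece_le {i : ℕ} {N : Submodule k (PolyChain V k)}
    (h : ∀ a : V →₀ ℕ, a.degree = i → cycleMul z (MvPolynomial.monomial a 1) ∈ N) :
    cyclePiece z i ≤ N := by
  rintro _ ⟨p, hp, rfl⟩
  rw [MvPolynomial.as_sum p, map_sum]
  refine Submodule.sum_mem _ fun a ha => ?_
  have h1 : cycleMul z (MvPolynomial.monomial a (MvPolynomial.coeff a p)) =
      MvPolynomial.coeff a p • cycleMul z (MvPolynomial.monomial a 1) := by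
    rw [← map_smul, MvPolynomial.smul_monomial, smul_eq_mul, mul_one]
  rw [h1]
  refine Submodule.smul_mem _ _ (h a ?_)
  by_contra h'
  exact MvPolynomial.mem_support_iff.1 ha
    (MvPolynomial.IsHomogeneous.coeff_eq_zero ((MvPolynomial.mem_homogeneousSubmodule _ _).1 hp) h')

theorem coeffChain_cycleMul_monomial (a b : V →₀ ℕ) :
    coeffChain b (cycleMul z (MvPolynomial.monomial a 1)) =
      if a = b then z.filter fun F => a.support ⊆ F else 0 := by
  ext1 F
  rw [coeffChain_apply, cycleMul_apply, MvPolynomial.coeff_smul, coeff_restrictVars,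
    MvPolynomial.coeff_monomial]
  by_cases hab : a = b
  · subst hab
    rw [if_pos rfl, if_pos rfl, Finsupp.filter_apply]
    split_ifs <;> simp
  · rw [if_neg hab, if_neg hab]
    simp

/-! ### The Hilbert function of the module of top cycles -/

section Hilbert

variable (h : IsSphereComplex k L d) (hz : z ∈ starCycles k L ∅ d)
include h hz

theorem cyclePiece_eq_span {X : Finset V} (hX : ∀ F ∈ L, F ⊆ X) (i : ℕ) :
    cyclePiece z i = Submodule.span k (Set.range fun a : ((X.finsuppAntidiag i).filter
      fun a => a.support ∈ h.finite.toFinset) => cycleMul z (MvPolynomial.monomial a.1 1)) := by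
  refine le_antisymm (cyclePiece_le fun a ha => ?_) (Submodule.span_le.2 ?_)
  · by_cases haL : a.support ∈ L
    · refine Submodule.subset_span ⟨⟨a, ?_⟩, rfl⟩
      rw [Finset.mem_filter, Finset.mem_finsuppAntidiag', Set.Finite.mem_toFinset]
      exact ⟨⟨ha, hX _ haL⟩, haL⟩
    · rw [cycleMul_monomial_eq_zero h.isLowerSet hz haL]
      exact zero_mem _
  · rintro _ ⟨⟨a, ha⟩, rfl⟩
    rw [Finset.mem_filter, Finset.mem_finsuppAntidiag'] at ha
    obtain ⟨⟨rfl, -⟩, -⟩ := ha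
    exact cycleMul_monomial_mem_cyclePiece z a

/-- Monomials with support outside L annihilate z, while the others give independent chains, since
each produces a nonzero restriction of z in its own multidegree. Thus the multiples of z form a copy
of the face ring. -/
theorem finrank_cyclePiece (hne : ∀ G ∈ L, (z.filter fun F => G ⊆ F) ≠ 0) {X : Finset V}
    (hX : ∀ F ∈ L, F ⊆ X) (i : ℕ) :
    Module.finrank k (cyclePiece z i) =
      ((X.finsuppAntidiag i).filter fun a => a.support ∈ h.finite.toFinset).card := by
  rw [cyclePiece_eq_span h hz hX, finrank_span_eq_card, Fintype.card_coe]
  rw [linearIndependent_iff']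
  intro s c hs a ha
  have h1 := congrArg (coeffChain a.1) hs
  simp only [map_sum, map_smul, coeffChain_cycleMul_monomial, map_zero] at h1
  rw [Finset.sum_eq_single a] at h1
  · rw [if_pos rfl] at h1
    refine (smul_eq_zero.1 h1).resolve_right (hne _ ?_)
    exact h.finite.mem_toFinset.1 (Finset.mem_filter.1 a.2).2
  · intro b _ hb
    rw [if_neg fun h' => hb (Subtype.ext h'), smul_zero]
  · exact fun h' => absurd ha h'

theorem isGradedBy_cyclePiece
    (hgen : ∀ G ∈ L, ∀ c ∈ starCycles k L G d, ∃ r : k, c = r • z.filter fun F => G ⊆ F)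
    (τ : V → k) (X : Finset V) (hX : ∀ F ∈ L, F ⊆ X) :
    IsGradedBy (fun i => faceMul (powerForm τ X i))
      (polyChains k L d ⊓ LinearMap.ker (polyBoundary V k))
      (fun i => Finsupp.mapRange.linearMap (MvPolynomial.homogeneousComponent i))
      (cyclePiece z) := by
  have hpr : ∀ i p, Finsupp.mapRange.linearMap (MvPolynomial.homogeneousComponent i)
      (cycleMul z p) = cycleMul z (MvPolynomial.homogeneousComponent i p) := by
    intro i p
    ext1 F
    rw [Finsupp.mapRange.linearMap_apply, Finsupp.mapRange_apply, cycleMul_apply, cycleMul_apply,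
      map_smul, homogeneousComponent_restrictVars]
  refine ⟨fun _ _ => faceMul_comm _ _, ?_, ?_, ?_, ?_, ?_, ?_, ?_, ?_⟩
  · intro i x hx
    obtain ⟨p, rfl⟩ := h.exists_eq_cycleMul hgen hx
    rw [faceMul_cycleMul]
    exact cycleMul_mem hz _
  · rintro i _ ⟨p, -, rfl⟩
    exact cycleMul_mem hz p
  · intro i
    rw [cyclePiece_eq_span h hz hX]
    exact FiniteDimensional.span_of_finite k (Set.finite_range _)
  · rintro l i _ ⟨p, hp, rfl⟩
    rw [faceMul_cycleMul]
    refine ⟨_, ?_, rfl⟩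
    rw [add_comm]
    exact (isHomogeneous_powerForm τ X l).mul hp
  · intro i x hx
    obtain ⟨p, rfl⟩ := h.exists_eq_cycleMul hgen hx
    rw [hpr]
    exact ⟨_, MvPolynomial.homogeneousComponent_mem i p, rfl⟩
  · rintro i _ ⟨p, hp, rfl⟩
    rw [hpr, MvPolynomial.homogeneousComponent_of_mem hp, if_pos rfl]
  · intro l x hx
    obtain ⟨p, rfl⟩ := h.exists_eq_cycleMul hgen hx
    rw [faceMul_cycleMul, hpr, homogeneousComponent_zero_mul_of_isHomogeneous
      (isHomogeneous_powerForm τ X l), map_zero]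
  · intro l i x hx
    obtain ⟨p, rfl⟩ := h.exists_eq_cycleMul hgen hx
    rw [faceMul_cycleMul, hpr, hpr, faceMul_cycleMul, add_comm i 1,
      homogeneousComponent_mul_of_isHomogeneous (isHomogeneous_powerForm τ X l)]

theorem quotientHilbert_cyclePiece
    (hfund : ∀ G ∈ L, (z.filter fun F => G ⊆ F) ≠ 0 ∧
      ∀ c ∈ starCycles k L G d, ∃ r : k, c = r • z.filter fun F => G ⊆ F)
    {τ : V → k} {X : Finset V} (hτ : Set.InjOn τ X) (hX : ∀ F ∈ L, F ⊆ X) {i : ℕ} (hi : i ≤ d) :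
    quotientHilbert (fun i => faceMul (powerForm τ X i)) (cyclePiece z) d i =
      hVector d (fun j => (faceCount L j : ℤ)) i := by
  have hgr := isGradedBy_cyclePiece h hz (fun G hG => (hfund G hG).2) τ X hX
  have h1 := congrArg (PowerSeries.coeff i)
    (hgr.mk_quotientHilbert (h.isRegularSeq hτ hX d le_rfl) le_rfl)
  simp only [finrank_cyclePiece h hz (fun G hG => (hfund G hG).1) hX] at h1
  rw [mk_card_filter_finsuppAntidiag fun F hF => hX F (h.finite.mem_toFinset.1 hF),
    coeff_one_sub_X_pow_mul_sum (fun F hF => h.card_le F (h.finite.mem_toFinset.1 hF)) hi,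
    PowerSeries.coeff_mk] at h1
  simp only [h1, h.faceCount_eq]

end Hilbert

/-! ### The upper bound theorem -/

/-- The multiples of a chain by the monomials of degree `i` in the variables of `S`. -/
noncomputable def monomialSpan (z : Finset V →₀ k) (S : Finset V) (i : ℕ) :
    Submodule k (PolyChain V k) :=
  Submodule.span k
    ((fun b => cycleMul z (MvPolynomial.monomial b 1)) '' (S.finsuppAntidiag i : Set (V →₀ ℕ)))

/-- Weighting the power forms by the coefficients of the Lagrange polynomial of v on Y gives a form
whose coefficient at w is the value of that polynomial at τ w: 1 at v and 0 elsewhere on Y. -/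
theorem exists_sum_smul_powerForm {τ : V → k} {X Y : Finset V} (hτ : Set.InjOn τ X) (hY : Y ⊆ X)
    {v : V} (hv : v ∈ Y) : ∃ c e : _ → k,
      (MvPolynomial.X v : MvPolynomial V k) =
        ∑ m ∈ Finset.range Y.card, c m • powerForm τ X m +
          ∑ w ∈ X \ Y, e w • MvPolynomial.X w := by
  refine ⟨fun m => (Lagrange.basis Y τ v).coeff m, fun w =>
    -∑ m ∈ Finset.range Y.card, (Lagrange.basis Y τ v).coeff m * τ w ^ m, ?_⟩
  have h1 : ∑ m ∈ Finset.range Y.card, (Lagrange.basis Y τ v).coeff m • powerForm τ X m =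
      ∑ w ∈ X, (∑ m ∈ Finset.range Y.card, (Lagrange.basis Y τ v).coeff m * τ w ^ m) •
        (MvPolynomial.X w : MvPolynomial V k) := by
    simp only [powerForm, Finset.smul_sum, Finset.sum_smul]
    rw [Finset.sum_comm]
    refine Finset.sum_congr rfl fun w _ => Finset.sum_congr rfl fun m _ => ?_
    rw [MvPolynomial.C_mul', smul_smul]
  rw [h1, ← Finset.sum_sdiff hY]
  simp only [neg_smul, Finset.sum_neg_distrib]
  rw [add_comm, neg_add_cancel_left, Finset.sum_congr rfl fun w hw => by
    rw [sum_coeff_basis_mul_pow (hτ.mono (Finset.coe_subset.2 hY)) hv hw]]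
  simp [hv]

theorem X_mul_mem_monomialSpan {S : Finset V} {i : ℕ} {v : V} (hv : v ∈ S) {x : PolyChain V k}
    (hx : x ∈ monomialSpan z S i) : faceMul (MvPolynomial.X v) x ∈ monomialSpan z S (i + 1) := by
  suffices monomialSpan z S i ≤ (monomialSpan z S (i + 1)).comap (faceMul (MvPolynomial.X v)) from
    this hx
  refine Submodule.span_le.2 ?_
  rintro _ ⟨b, hb, rfl⟩
  rw [SetLike.mem_coe, Submodule.mem_comap, faceMul_cycleMul, MvPolynomial.X,
    MvPolynomial.monomial_mul, one_mul]
  refine Submodule.subset_span (Set.mem_image_of_mem _ ?_)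
  rw [Finset.mem_coe, Finset.mem_finsuppAntidiag] at hb ⊢
  refine ⟨?_, ?_⟩
  · simp only [Finsupp.coe_add, Pi.add_apply]
    rw [Finset.sum_add_distrib, hb.1, Finset.sum_eq_single v, Finsupp.single_eq_same, add_comm]
    · exact fun w _ hw => Finsupp.single_eq_of_ne hw
    · exact fun h' => absurd hv h'
  · refine (Finsupp.support_add).trans (Finset.union_subset ?_ hb.2)
    exact Finsupp.support_single_subset.trans (Finset.singleton_subset_iff.2 hv)

theorem faceMul_add_apply (p q : MvPolynomial V k) (x : PolyChain V k) :
    faceMul (p + q) x = faceMul p x + faceMul q x := by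
  ext1 F
  simp only [faceMul_apply, Finsupp.add_apply, map_add, add_mul]

theorem faceMul_sum_smul_apply {ι : Type*} (s : Finset ι) (c : ι → k) (p : ι → MvPolynomial V k)
    (x : PolyChain V k) : faceMul (∑ i ∈ s, c i • p i) x = ∑ i ∈ s, c i • faceMul (p i) x := by
  ext1 F
  simp only [faceMul_apply, Finsupp.finsetSum_apply, Finsupp.smul_apply, map_sum, map_smul,
    Finset.sum_mul, smul_mul_assoc]

/-- Modulo the d forms, each variable of the facet Y is a combination of the variables outside Y.
Induction on the degree removes the variables of Y from every monomial. -/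
theorem IsSphereComplex.cyclePiece_le_sup (h : IsSphereComplex k L d)
    (hz : z ∈ starCycles k L ∅ d)
    (hgen : ∀ G ∈ L, ∀ c ∈ starCycles k L G d, ∃ r : k, c = r • z.filter fun F => G ⊆ F)
    {τ : V → k} {X Y : Finset V} (hτ : Set.InjOn τ X) (hX : ∀ F ∈ L, F ⊆ X) (hY : Y ∈ L)
    (hYd : Y.card = d) (i : ℕ) :
    cyclePiece z i ≤ gradedSeqSpan (fun i => faceMul (powerForm τ X i)) (cyclePiece z) d i ⊔
      monomialSpan z (X \ Y) i := by
  have hgr := isGradedBy_cyclePiece h hz hgen τ X hX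
  have hXmul : ∀ i v, ∀ x ∈ cyclePiece z i, faceMul (MvPolynomial.X v) x ∈ cyclePiece z (i + 1) := by
    rintro i v _ ⟨p, hp, rfl⟩
    rw [faceMul_cycleMul]
    refine ⟨_, ?_, rfl⟩
    rw [add_comm]
    exact (MvPolynomial.isHomogeneous_X k v).mul hp
  have hQ : ∀ l i v, ∀ x ∈ gradedSeqSpan (fun i => faceMul (powerForm τ X i)) (cyclePiece z) l i,
      faceMul (MvPolynomial.X v) x ∈
        gradedSeqSpan (fun i => faceMul (powerForm τ X i)) (cyclePiece z) l (i + 1) := by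
    intro l
    induction l with
    | zero =>
      intro i v x hx
      rw [gradedSeqSpan, Submodule.mem_bot] at hx
      rw [hx, map_zero]
      exact zero_mem _
    | succ l ih =>
      intro i v x hx
      cases i with
      | zero =>
        rw [gradedSeqSpan, Submodule.mem_bot] at hx
        rw [hx, map_zero]
        exact zero_mem _
      | succ i =>
        rw [gradedSeqSpan] at hx ⊢
        obtain ⟨p, hp, _, ⟨b, hb, rfl⟩, rfl⟩ := Submodule.mem_sup.1 hx
        rw [map_add, faceMul_comm]
        exact Submodule.add_mem_sup (ih _ _ _ hp) ⟨_, hXmul _ _ _ hb, rfl⟩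
  have hWle : ∀ i, monomialSpan z (X \ Y) i ≤ cyclePiece z i := by
    intro i
    refine Submodule.span_le.2 ?_
    rintro _ ⟨b, hb, rfl⟩
    rw [Finset.mem_coe, Finset.mem_finsuppAntidiag'] at hb
    obtain ⟨rfl, -⟩ := hb
    exact cycleMul_monomial_mem_cyclePiece z b
  have hW : ∀ i, ∀ v ∈ X, ∀ x ∈ monomialSpan z (X \ Y) i, faceMul (MvPolynomial.X v) x ∈
      gradedSeqSpan (fun i => faceMul (powerForm τ X i)) (cyclePiece z) d (i + 1) ⊔
        monomialSpan z (X \ Y) (i + 1) := by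
    intro i v hv x hx
    by_cases hvY : v ∈ Y
    · obtain ⟨c, e, hce⟩ := exists_sum_smul_powerForm hτ (hX Y hY) hvY
      rw [hce, faceMul_add_apply, faceMul_sum_smul_apply, faceMul_sum_smul_apply]
      refine Submodule.add_mem_sup (Submodule.sum_mem _ fun m hm => Submodule.smul_mem _ _ ?_)
        (Submodule.sum_mem _ fun w hw => Submodule.smul_mem _ _ (X_mul_mem_monomialSpan hw hx))
      exact map_le_gradedSeqSpan (t := fun i => faceMul (powerForm τ X i))
        (hYd ▸ Finset.mem_range.1 hm) i ⟨x, hWle i hx, rfl⟩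
    · exact Submodule.mem_sup_right
        (X_mul_mem_monomialSpan (Finset.mem_sdiff.2 ⟨hv, hvY⟩) hx)
  refine cyclePiece_le fun a ha => ?_
  induction i generalizing a with
  | zero =>
    refine Submodule.mem_sup_right (Submodule.subset_span (Set.mem_image_of_mem _ ?_))
    rw [(Finsupp.degree_eq_zero_iff a).1 ha]
    simp
  | succ i ih =>
    -- Monomials not supported on a face kill z; in the others every variable is a vertex of the
    -- complex and can be split off.
    by_cases haL : a.support ∈ L
    · obtain ⟨v, hv⟩ : a.support.Nonempty := by
        rw [Finset.nonempty_iff_ne_empty, Ne, Finsupp.support_eq_empty]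
        rintro rfl
        simp at ha
      have hle : Finsupp.single v 1 ≤ a := by
        rw [Finsupp.single_le_iff]
        exact Nat.one_le_iff_ne_zero.2 (Finsupp.mem_support_iff.1 hv)
      obtain ⟨b, rfl⟩ := exists_add_of_le hle
      have hb : b.degree = i := by
        rw [map_add, Finsupp.degree_single] at ha
        omega
      have h1 : faceMul (MvPolynomial.X v) (cycleMul z (MvPolynomial.monomial b 1)) =
          cycleMul z (MvPolynomial.monomial (Finsupp.single v 1 + b) 1) := by
        rw [faceMul_cycleMul, MvPolynomial.X, MvPolynomial.monomial_mul, one_mul]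
      obtain ⟨p, hp, w, hw, hpw⟩ := Submodule.mem_sup.1 (ih b hb)
      rw [← h1, ← hpw, map_add]
      exact add_mem (Submodule.mem_sup_left (hQ _ _ _ _ hp)) (hW i v (hX _ haL hv) w hw)
    · rw [cycleMul_monomial_eq_zero h.isLowerSet hz haL]
      exact zero_mem _

/-- The upper bound theorem for the `h`-vectors of homology spheres. -/
theorem IsSphereComplex.hVector_le [Infinite k] (h : IsSphereComplex k L d) {n : ℕ}
    (hn : faceCount L 1 ≤ n) (hdn : d < n) {i : ℕ} (hi : i ≤ d) :
    hVector d (fun j => (faceCount L j : ℤ)) i ≤ ((n - d - 1 + i).choose i : ℤ) := by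
  obtain ⟨z, hz, hfund⟩ := h.exists_fundamental_cycle
  set X : Finset V := h.finite.toFinset.biUnion id with hXdef
  have hX : ∀ F ∈ L, F ⊆ X := fun F hF =>
    Finset.subset_biUnion_of_mem id (h.finite.mem_toFinset.2 hF)
  have hXn : X.card ≤ n := by
    refine le_trans ?_ hn
    rw [h.faceCount_eq]
    refine Finset.card_le_card_of_injOn (fun v => {v}) (fun v hv => ?_)
      fun v _ w _ hvw => Finset.singleton_injective hvw
    obtain ⟨F, hF, hvF⟩ := Finset.mem_biUnion.1 (Finset.mem_coe.1 hv)
    rw [Finset.mem_coe, Finset.mem_filter, Set.Finite.mem_toFinset]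
    exact ⟨h.isLowerSet (Finset.singleton_subset_iff.2 hvF) (h.finite.mem_toFinset.1 hF),
      Finset.card_singleton v⟩
  -- The Vandermonde forms need pairwise distinct parameters, available because the field is
  -- infinite.
  obtain ⟨g, hg⟩ := Set.countable_iff_exists_injOn.1 X.countable_toSet
  set τ : V → k := fun v => Infinite.natEmbedding k (g v) with hτdef
  have hτ : Set.InjOn τ X := fun v hv w hw hvw =>
    hg hv hw ((Infinite.natEmbedding k).injective hvw)
  -- Any face in the support of the fundamental cycle serves as the facet.
  obtain ⟨Y, hY, -⟩ := exists_ne_zero_of_mem_starCycles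
    (filter_mem_starCycles (Finset.empty_subset ∅) hz) (hfund ∅ h.empty_mem).1
  have hgr := isGradedBy_cyclePiece h hz (fun G hG => (hfund G hG).2) τ X hX
  have : FiniteDimensional k (monomialSpan z (X \ Y) i) :=
    FiniteDimensional.span_of_finite k ((Finset.finite_toSet _).image _)
  have h1 := hgr.quotientHilbert_le (h.cyclePiece_le_sup hz (fun G hG => (hfund G hG).2) hτ hX
    hY.1 hY.2.2 i)
  rw [quotientHilbert_cyclePiece h hz hfund hτ hX hi] at h1
  refine h1.trans (Nat.cast_le.2 ?_)
  classical
  rw [monomialSpan, ← Finset.coe_image]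
  refine (finrank_span_finset_le_card _).trans (Finset.card_image_le.trans ?_)
  rw [Finset.card_finsuppAntidiag_nat_eq_choose, Finset.card_sdiff_of_subset (hX Y hY.1), hY.2.2]
  exact Nat.choose_le_choose i (by omega)

end CycleMul

/-! ### Comparison of face numbers -/

section Comparison

theorem hVector_zero (d : ℕ) (f : ℕ → ℤ) : hVector d f 0 = f 0 := by
  rw [eq_sum_hVector_mul_choose f (Nat.zero_le d), Finset.sum_eq_single 0]
  · simp
  · intro i hi hi0
    rw [Finset.mem_range] at hi
    rw [Nat.choose_eq_zero_of_lt (by omega), Nat.cast_zero, mul_zero]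
  · exact fun h => absurd (Finset.mem_range.2 (Nat.succ_pos d)) h

theorem IsEulerian.sub_eq_sum {d j : ℕ} {f f' : ℕ → ℤ} (hf : IsEulerian d f)
    (hf' : IsEulerian d f') (hj : j ≤ d) :
    f' j - f j = ∑ l ∈ Finset.range (d / 2 + 1),
      (gVector d f' l - gVector d f l) * gCoeff d l (d - j) := by
  rw [hf.eq_sum_gVector hj, hf'.eq_sum_gVector hj, ← Finset.sum_sub_distrib]
  exact Finset.sum_congr rfl fun l _ => (sub_mul _ _ _).symm

/-- A comparison of two Eulerian sequences at one index carries over to the next index. -/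
theorem IsEulerian.le_succ_of_le {d j : ℕ} {f f' : ℕ → ℤ} (hf : IsEulerian d f)
    (hf' : IsEulerian d f') (h0 : gVector d f 0 = gVector d f' 0)
    (hg : ∀ k ≤ d / 2, gVector d f' k < gVector d f k →
      ∀ i, 1 ≤ i → i ≤ k → gVector d f' i ≤ gVector d f i)
    (hU : f 1 ≤ f' 1 → ∀ i ≤ d, f i ≤ f' i) (hj : 1 ≤ j) (hjd : j + 1 ≤ d) (hle : f j ≤ f' j) :
    f (j + 1) ≤ f' (j + 1) := by
  set c : ℕ → ℤ := fun l => gVector d f' l - gVector d f l with hc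
  have hdiff : ∀ i ≤ d, f' i - f i = ∑ l ∈ Finset.range (d / 2 + 1), c l * gCoeff d l (d - i) :=
    fun i hi => hf.sub_eq_sum hf' hi
  have hsum := sub_nonneg.2 hle
  rw [hdiff j (by omega)] at hsum
  by_cases hall : ∀ l ≤ d / 2, 0 ≤ c l
  · rw [← sub_nonneg, hdiff _ hjd]
    refine Finset.sum_nonneg fun l hl => mul_nonneg (hall l ?_) (gCoeff_nonneg _ _ _)
    exact Nat.lt_succ_iff.1 (Finset.mem_range.1 hl)
  push Not at hall
  obtain ⟨k₀, hk₀, hck₀⟩ := hall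
  -- The last index at which Δ has the larger g-number; by `hg` all differences up to it are
  -- nonpositive.
  set k := Nat.findGreatest (fun l => c l < 0) (d / 2) with hk
  have hkd : k ≤ d / 2 := Nat.findGreatest_le _
  have hck : c k < 0 := Nat.findGreatest_spec (P := fun l => c l < 0) hk₀ hck₀
  have hpos : ∀ l, k < l → l ≤ d / 2 → 0 ≤ c l := fun l h1 h2 =>
    not_lt.1 (Nat.findGreatest_is_greatest (P := fun l => c l < 0) h1 h2)
  have hneg : ∀ l ≤ k, c l ≤ 0 := by
    intro l hl
    rcases Nat.eq_zero_or_pos l with rfl | hl0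
    · exact (sub_eq_zero.2 h0.symm).le
    · exact sub_nonpos.2 (hg k hkd (sub_neg.1 hck) l hl0 hl)
  obtain ⟨b, hb⟩ : ∃ b, d - j = b + 1 := ⟨d - j - 1, by omega⟩
  by_cases hkb : b + 1 + k ≤ d
  · rw [hb] at hsum
    have h1 := gCoeff_comparison (by omega) hneg hpos (gCoeff_pos (by omega) hkb) hsum
    rw [← sub_nonneg, hdiff _ hjd, show d - (j + 1) = b by omega]
    exact h1
  -- Here the coefficients beyond k vanish, so a sum of nonpositive terms is nonnegative and each
  -- term is zero. The coefficient of c 1 is positive, which forces equal numbers of vertices.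
  · refine hU ?_ _ hjd
    have hterm : ∀ l ∈ Finset.range (d / 2 + 1), c l * gCoeff d l (d - j) ≤ 0 := by
      intro l _
      rcases le_or_gt l k with h | h
      · exact mul_nonpos_of_nonpos_of_nonneg (hneg l h) (gCoeff_nonneg _ _ _)
      · rw [gCoeff_eq_zero (by omega), mul_zero]
    have h1 := (Finset.sum_eq_zero_iff_of_nonpos hterm).1
      (le_antisymm (Finset.sum_nonpos hterm) hsum) 1 (Finset.mem_range.2 (by omega))
    have hc1 : c 1 = 0 := (mul_eq_zero.1 h1).resolve_right
      (gCoeff_pos (by omega) (by omega)).ne'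
    have h2 : f' 1 - f 1 = 0 := by
      rw [hdiff 1 (by omega)]
      refine Finset.sum_eq_zero fun l _ => ?_
      rcases l with _ | _ | l
      · rw [show c 0 = 0 from sub_eq_zero.2 h0.symm, zero_mul]
      · rw [zero_add, hc1, zero_mul]
      · rw [gCoeff_eq_zero (by omega), mul_zero]
    omega

/-- The numbers `binom(N + j - 1, j)` are, below a place where they are exceeded, bounded by the
members of an `m`-sequence. -/
theorem IsLittleMSequence.choose_le {δ N : ℕ} {a : ℕ → ℤ} (ha : IsLittleMSequence δ a) {k : ℕ}
    (hk : k ≤ δ) (hlt : ((N + k - 1).choose k : ℤ) < a k) {i : ℕ} (hi : 1 ≤ i) (hik : i ≤ k) :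
    ((N + i - 1).choose i : ℤ) ≤ a i := by
  -- The descent lowers both entries of the binomial by one, keeping N fixed. For N = 0 the binomial
  -- at k is 0 and gives nothing to descend from, but a k ≥ 1 = binom(k, k) starts the descent with
  -- N = 1.
  have key : ∀ m, m + 1 ≤ k → ((max N 1 + (k - m) - 1).choose (k - m) : ℤ) ≤ a (k - m) := by
    intro m
    induction m with
    | zero =>
      intro hk1
      rw [Nat.sub_zero]
      rcases Nat.eq_zero_or_pos N with rfl | hN
      · rw [Nat.choose_eq_zero_of_lt (by omega)] at hlt
        rw [max_eq_right (Nat.zero_le 1), Nat.add_sub_cancel_left, Nat.choose_self]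
        omega
      · rw [max_eq_left hN]
        exact hlt.le
    | succ m ih =>
      intro hm
      have h1 := ha.2 (k - m) _ (by omega) (by omega) (by omega) (ih (by omega))
      rw [show k - (m + 1) = k - m - 1 by omega,
        show max N 1 + (k - m - 1) - 1 = max N 1 + (k - m) - 1 - 1 by omega]
      exact h1
  have h1 := key (k - i) (by omega)
  rw [Nat.sub_sub_self hik] at h1
  refine le_trans (Nat.cast_le.2 (Nat.choose_le_choose i ?_)) h1
  have := le_max_left N 1
  omega

theorem hVector_galeCount {n d i : ℕ} (hn : d < n) (hi : 2 * i ≤ d) :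
    hVector d (fun j => (galeCount n d j : ℤ)) i = ((n - d - 1 + i).choose i : ℤ) :=
  hVector_of_neighborly (J := d / 2) hn (by omega)
    (fun j hj => by rw [galeCount_of_two_mul_le (by omega)]) (by omega)

theorem gVector_galeCount {n d i : ℕ} (hn : d < n) (hi0 : 1 ≤ i) (hi : 2 * i ≤ d) :
    gVector d (fun j => (galeCount n d j : ℤ)) i = ((n - d - 1 + i - 1).choose i : ℤ) := by
  obtain ⟨i, rfl⟩ : ∃ m, i = m + 1 := ⟨i - 1, by omega⟩
  rw [gVector, hVector_galeCount hn hi, hVector_galeCount hn (by omega), ← add_assoc,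
    Nat.choose_succ_succ, Nat.add_sub_cancel]
  push_cast
  ring

end Comparison

/-! ### Face counts and g-numbers of the given complex -/

namespace PreAbstractSimplicialComplex

variable {V : Type*} (K : PreAbstractSimplicialComplex V)

theorem faceCount_allFaces (j : ℕ) : faceCount K.allFaces j = K.fShift j := by
  cases j with
  | zero =>
    rw [fShift, faceCount, Set.ncard_eq_one]
    refine ⟨∅, Set.ext fun F => ?_⟩
    simp only [Set.mem_ofPred_eq, Finset.card_eq_zero, Set.mem_singleton_iff]
    exact ⟨fun h => h.2, fun h => ⟨h ▸ Set.mem_insert _ _, h⟩⟩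
  | succ j =>
    rw [fShift, fNumber, faceCount]
    congr 1
    ext F
    simp only [Set.mem_ofPred_eq, allFaces, Set.mem_insert_iff]
    refine ⟨fun h => ⟨h.1.resolve_left ?_, h.2⟩, fun h => ⟨Or.inr h.1, h.2⟩⟩
    rintro rfl
    simp at h

theorem gNumber_eq_gVector (d i : ℕ) :
    K.gNumber d i = gVector d (fun j => (faceCount K.allFaces j : ℤ)) i := by
  have h : ∀ i, K.hNumber d i = hVector d (fun j => (faceCount K.allFaces j : ℤ)) i := by
    intro i
    simp only [faceCount_allFaces]
    rfl
  cases i with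
  | zero =>
    rw [gNumber, gVector, hVector_zero, faceCount_allFaces, fShift, Nat.cast_one]
  | succ i => rw [gNumber, gVector, h, h]

end PreAbstractSimplicialComplex

/-- The upper bound theorem for the face numbers of homology spheres. -/
theorem IsSphereComplex.faceCount_le {V k : Type*} [LinearOrder V] [Field k] [Infinite k]
    {L : Set (Finset V)} {d : ℕ} (h : IsSphereComplex k L d) {n : ℕ} (hn : faceCount L 1 ≤ n)
    (hdn : d < n) {j : ℕ} (hj : j ≤ d) : faceCount L j ≤ galeCount n d j := by
  have h1 : ∀ i, 2 * i ≤ d → hVector d (fun j => (faceCount L j : ℤ)) i ≤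
      hVector d (fun j => (galeCount n d j : ℤ)) i := by
    intro i hi
    rw [hVector_galeCount hdn hi]
    exact h.hVector_le hn hdn (by omega)
  -- Face numbers are nonnegative combinations of h-numbers, and the upper half of the h-vector is
  -- bounded through its mirror image.
  rw [← Nat.cast_le (α := ℤ), eq_sum_hVector_mul_choose (fun j => (faceCount L j : ℤ)) hj,
    eq_sum_hVector_mul_choose (fun j => (galeCount n d j : ℤ)) hj]
  refine Finset.sum_le_sum fun i hi => mul_le_mul_of_nonneg_right ?_ (Nat.cast_nonneg _)
  rw [Finset.mem_range] at hi
  rcases le_or_gt (2 * i) d with h2 | h2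
  · exact h1 i h2
  · rw [← h.isEulerian.hVector_symm (by omega), ← (isEulerian_galeCount hdn).hVector_symm (by omega)]
    exact h1 (d - i) (by omega)

theorem corollary5 {R : Type*} [CommRing R] [Nontrivial R] {V : Type*} [LinearOrder V]
    (d : ℕ) (hd : 3 ≤ d) (K : PreAbstractSimplicialComplex V)
    (hK : K.IsHomologySphere R d) (hg : IsLittleMSequence (d / 2) (K.gNumber d))
    (n : ℕ) (hn : d < n) (t : Fin n → ℝ) (ht : StrictMono t)
    (r : ℕ) (hr : r + 2 ≤ d)
    (hle : K.fNumber r ≤ polytopeFNumber (cyclicPolytope d t) r)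
    (s : ℕ) (hrs : r < s) (hsd : s < d) :
    K.fNumber s ≤ polytopeFNumber (cyclicPolytope d t) s := by
  -- A residue field of R exists since R is nontrivial; it may be finite, so its algebraic closure
  -- is taken.
  obtain ⟨m, hm⟩ := Ideal.exists_maximal R
  let _ : Field (R ⧸ m) := Ideal.Quotient.field m
  have hL : IsSphereComplex (AlgebraicClosure (R ⧸ m)) K.allFaces d := by
    obtain ⟨e, rfl⟩ : ∃ e, d = e + 1 := ⟨d - 1, by omega⟩
    exact hK.isSphereComplex.map
      ((algebraMap (R ⧸ m) (AlgebraicClosure (R ⧸ m))).comp (Ideal.Quotient.mk m))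
  have hcount : ∀ i, K.fNumber i = faceCount K.allFaces (i + 1) := fun i =>
    (K.faceCount_allFaces (i + 1)).symm
  rw [hcount, polytopeFNumber_cyclicPolytope ht hn (by omega)] at hle
  rw [hcount, polytopeFNumber_cyclicPolytope ht hn hsd]
  have h1 : galeCount n d 1 = n := by
    rw [galeCount_of_two_mul_le (by omega), Nat.choose_one_right]
  have hg' : IsLittleMSequence (d / 2)
      (gVector d fun j => (faceCount K.allFaces j : ℤ)) := by
    rwa [← funext (K.gNumber_eq_gVector d)]
  have hstep : ∀ j, 1 ≤ j → j + 1 ≤ d → faceCount K.allFaces j ≤ galeCount n d j →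
      faceCount K.allFaces (j + 1) ≤ galeCount n d (j + 1) := by
    intro j hj hjd hle
    refine Nat.cast_le.1 (hL.isEulerian.le_succ_of_le (isEulerian_galeCount hn) ?_ ?_ ?_ hj hjd
      (Nat.cast_le.2 hle))
    · rw [hg'.1, gVector, hVector_galeCount hn (by omega), Nat.choose_zero_right, Nat.cast_one]
    · intro k hk hlt i hi hik
      rw [gVector_galeCount hn (by omega) (by omega)] at hlt ⊢
      exact hg'.choose_le hk hlt hi hik
    · intro h2 i hi
      rw [h1, Nat.cast_le] at h2
      exact Nat.cast_le.2 (hL.faceCount_le h2 hn hi)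
  clear hd hr
  induction s, hrs using Nat.le_induction with
  | base => exact hstep (r + 1) (by omega) hsd hle
  | succ s hs ih => exact hstep (s + 1) (by omega) hsd (ih (by omega))
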